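/- **Setting.** Let $T$ be a real treatment variable, $\boldsymbol X\in\mathbb R^r$ a covariate vector and $\{Y(t)\}_{t\in[0,1]}$ potential outcomes, with $Y(t)$ jointly measurable as a function of $t$ and of the potential-outcome process; the observed outcome is $Y=Y(T)$. Put $\mathcal T=[0,1]$, $\bar F_t(y)=\mathbb P\{Y(t)\ge y\}$, $q_t(\alpha)=\inf\{y:\bar F_t(y)\le 1-\alpha\}$. Let $f_T$ be the density of $T$, $f_{T|X}$ the conditional density of $T$ given $\boldsymbol X$, $\pi_0(t,\boldsymbol x)=f_T(t)/f_{T|X}(t|\boldsymbol x)$, and let $$\omega_t(y,h)=\sup_{z\ge y,\ t'\in\mathcal T,\ |t'-t|\le h}\frac1{\log z}\Big|\log\frac{\bar F_{t'}(z)}{\bar F_t(z)}\Big| .$$ Assume: 1. For $t\in\mathcal T$, $\bar F_t(y)$ is continuously differentiable in $y$; for each $y$ it is three times continuously differentiable in $t\in\mathcal T$; and there is $\gamma(t)>0$ with $\lim_{y\to\infty}y f_{Y(t)}(y)/\bar F_t(y)=1/\gamma(t)$, where $f_{Y(t)}=-\partial_y\bar F_t$. 2. $T$ and $\{Y(t)\}_{t\in\mathcal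 T}$ are conditionally independent given $\boldsymbol X$. 3. The support $\mathcal X$ of $\boldsymbol X$ is compact, the support of $T$ is $\mathcal T$, and $0<\eta_1\le\pi_0\le\eta_2<\infty$ on $\mathcal T\times\mathcal X$. 4. There is a version of the conditional distribution function $F_{Y|T,\boldsymbol X}(y|t,\boldsymbol x)$ that is continuous in $y$ for $(t,\boldsymbol x)\in\mathcal T\times\mathcal X$ and continuously differentiable in $(t,\boldsymbol x)\in\mathcal T\times\mathcal X$ for each $y$; $f_T$ is three times continuously differentiable on $\mathcal T$ with $0<\eta_3\le f_T\le\eta_4<\infty$ there. 5. $K\ge0$ is a bounded measurable symmetric kernel supported in $[-1,1]$ with $\int K=1$, $0<\int u^2K(u)\,du<\infty$, $\int K^2<\infty$. 6. There are $\rho(t)<0$ and functions $A_t$, eventually positive or eventually negative, with $A_t(y)\to0$ as $y\to\infty$ and, for all $z>0$, $$\lim_{y\to\infty}\frac{\bar F_t(zy)/\bar F_t(y)-z^{-1/\gamma(t)}}{A_t(1/\bar F_t(y))}=z^{-1/\gamma(t)}\frac{z^{\rho(t)/\gamma(t)}-1}{\gamma(t)\rho(t)}\qquad(t\in\mathcal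 T).$$ Let $(T_i,\boldsymbol X_i,Y_i)$ be i.i.d. copies of $(T,\boldsymbol X,Y)$ and let $\hat\pi=\hat\pi_N$ be (measurable) random functions with $\sup_{1\le i\le N}|\hat\pi(T_i,\boldsymbol X_i)-\pi_0(T_i,\boldsymbol X_i)|=O_p(\delta_N)$, $\delta_N\to0$. Define $$\widehat{\bar F}_{t,h}(y)=\frac{\sum_{i=1}^N\hat\pi(T_i,\boldsymbol X_i)\mathbb 1(Y_i>y)K((T_i-t)/h)}{\sum_{i=1}^N\hat\pi(T_i,\boldsymbol X_i)K((T_i-t)/h)},\qquad \hat q_{t,h}(\alpha)=\inf\{z:\widehat{\bar F}_{t,h}(z)\le1-\alpha\},$$ $$\hat q^E_{t,h}(\alpha)=\hat q_{t,h}(1-k_N/N)\Big(\frac{k_N}{N(1-\alpha)}\Big)^{\hat\gamma(t)} .$$ **Rates.** Let $\alpha_N\in(0,1)$, $h=h_N>0$, $k_N\in\mathbb N$ satisfy, as $N\to\infty$: $\alpha_N\to1$, $h\to0$, $k_N\to\infty$, $Nh(1-\alpha_N)\to c\in[0,\infty)$, $k_N/N\to0$, $k_Nh\to\infty$, $k_Nh^3\to0$,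 $k_Nh\delta_N^2\to0$, $\sqrt{k_Nh}/\log(k_N/\{N(1-\alpha_N)\})\to\infty$, and for every $t\in\mathcal T$: $\sqrt{k_Nh}\,A_t(N/k_N)\to0$ and, for some $\lambda=\lambda(t)>1$, $$\omega_t\big(q_t(1-\lambda k_N/N),h\big)\log(k_N/N)\to0,\qquad \sqrt{k_Nh}\;\omega_t\big(q_t(1-\lambda k_N/N),h\big)\log(k_N/N)\to0 .$$ **Tail index estimator.** Let $\hat\gamma(t)=\hat\gamma_N(t)$ be random variables and $\Gamma(t)$, $t\in\mathcal T$, random variables such that, for all $t_1\ne t_2$ in $\mathcal T$, $\Gamma(t_1)$ and $\Gamma(t_2)$ are independent and $\sqrt{k_Nh}\,(\hat\gamma(t_1)-\gamma(t_1),\hat\gamma(t_2)-\gamma(t_2))\to(\Gamma(t_1),\Gamma(t_2))$ in distribution. **Theorem.** Let $\Delta_0\in(0,1)$ and, for $\upsilon\in[\Delta_0,1]$, $$\mathcal Q^E_{t,h}(\upsilon)=\frac{\sqrt{k_Nh}}{\log\big(k_N/\{N\upsilon(1-\alpha_N)\}\big)}\left\{\frac{\hat q^E_{t,h}(1-\upsilon(1-\alpha_N))}{q_t(1-\upsilon(1-\alpha_N))}-1\right\}.$$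 Then for all $t_1\ne t_2$ in $\mathcal T$, $$\big(\mathcal Q^E_{t_1,h}(\upsilon),\mathcal Q^E_{t_2,h}(\upsilon)\big)\Rightarrow\big(\Gamma(t_1),\Gamma(t_2)\big)\quad\text{in }\ell^\infty([\Delta_0,1]),$$ that is, the paths are bounded for all large $N$ and there is weak convergence (in the Hoffmann-Jørgensen sense, with outer expectations) to the process that is constant in $\upsilon$. -/

import Mathlib

open MeasureTheory ProbabilityTheory Set Filter Topology
open scoped ENNReal BoundedContinuousFunction

/-! ## Continuous treatment model: population objects -/

/-- The observed outcome `Y = Y(T)`. -/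
def observedOutcome {Ω : Type*} (T : Ω → ℝ) (Y : ℝ → Ω → ℝ) (ω : Ω) : ℝ := Y (T ω) ω

/-- The sigma-algebra generated by the family of potential outcomes `Y(t)`, `t ∈ [0,1]`. -/
abbrev outcomeSigma {Ω : Type*} (Y : ℝ → Ω → ℝ) : MeasurableSpace Ω :=
  ⨆ s ∈ Icc (0 : ℝ) 1, MeasurableSpace.comap (Y s) inferInstance

/-- Counterfactual survival function `F̄_t(y) = P(Y(t) ≥ y)`. -/
noncomputable def survival {Ω : Type*} [MeasurableSpace Ω] (P : Measure Ω) (Y : ℝ → Ω → ℝ)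
    (t y : ℝ) : ℝ := P.real {ω | y ≤ Y t ω}

/-- For a survival function `S`, the generalised inverse `inf {y : S(y) ≤ 1 - α}`. -/
noncomputable def survivalQuantile (S : ℝ → ℝ) (α : ℝ) : ℝ := sInf {y | S y ≤ 1 - α}

/-- Counterfactual quantile `q_t(α)`. -/
noncomputable def popQuantile {Ω : Type*} [MeasurableSpace Ω] (P : Measure Ω) (Y : ℝ → Ω → ℝ)
    (t α : ℝ) : ℝ := survivalQuantile (survival P Y t) α

/-- Stabilised weight `π₀(t,x) = f_T(t) / f_{T|X}(t|x)`. -/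
noncomputable def stabWeight {E : Type*} (fT : ℝ → ℝ) (fTX : ℝ → E → ℝ) (t : ℝ) (x : E) : ℝ :=
  fT t / fTX t x

/-- Conditional independence of two sigma-algebras given a third one (no topological assumption
on the sample space). -/
def CondIndepGiven {Ω : Type*} [mΩ : MeasurableSpace Ω] (P : Measure Ω)
    (m m₁ m₂ : MeasurableSpace Ω) : Prop :=
  ∀ A B : Set Ω, MeasurableSet[m₁] A → MeasurableSet[m₂] B →
    P⟦A ∩ B|m⟧ =ᵐ[P] P⟦A|m⟧ * P⟦B|m⟧

/-- Measurability of the model: `T`, `X`, `Y(t)` are random variables and, so that `Y(T)` is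
meaningful, `Y(t)` is jointly measurable in the treatment level and the potential outcomes
process. -/
structure IsTreatmentModel {Ω E : Type*} [MeasurableSpace Ω] [MeasurableSpace E]
    (T : Ω → ℝ) (X : Ω → E) (Y : ℝ → Ω → ℝ) : Prop where
  measurable_T : Measurable T
  measurable_X : Measurable X
  measurable_Y : ∀ t ∈ Icc (0 : ℝ) 1, Measurable (Y t)
  measurable_joint :
    Measurable[MeasurableSpace.prod (inferInstance : MeasurableSpace (Icc (0 : ℝ) 1))
      (outcomeSigma Y)] (fun p : Icc (0 : ℝ) 1 × Ω => Y p.1 p.2)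

/-- Unconfoundedness: `T` and `{Y(t)}_{t ∈ [0,1]}` are independent given `X`. -/
def Unconfounded {Ω E : Type*} [MeasurableSpace Ω] [MeasurableSpace E] (P : Measure Ω)
    (T : Ω → ℝ) (X : Ω → E) (Y : ℝ → Ω → ℝ) : Prop :=
  CondIndepGiven P (MeasurableSpace.comap X inferInstance)
    (MeasurableSpace.comap T inferInstance) (outcomeSigma Y)

/-- `fT` is a density of `T`, and `fTX t x` is a conditional density of `T` at `t` given
`X = x`. -/
structure AreDensities {Ω E : Type*} [MeasurableSpace Ω] [MeasurableSpace E] (P : Measure Ω)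
    (T : Ω → ℝ) (X : Ω → E) (fT : ℝ → ℝ) (fTX : ℝ → E → ℝ) : Prop where
  measurable_fT : Measurable fT
  nonneg_fT : ∀ t, 0 ≤ fT t
  density : P.map T = volume.withDensity (fun t => ENNReal.ofReal (fT t))
  measurable_fTX : Measurable (fun p : ℝ × E => fTX p.1 p.2)
  nonneg_fTX : ∀ t x, 0 ≤ fTX t x
  cond_density : P.map (fun ω => (X ω, T ω)) =
    ((P.map X).prod volume).withDensity (fun p => ENNReal.ofReal (fTX p.2 p.1))

/-- The counterfactual survival functions are smooth and heavy tailed with extreme-value index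
`γ`. As `F̄_t` is continuously differentiable, the density of `Y(t)` is minus its derivative. -/
structure HeavyTail (S : ℝ → ℝ → ℝ) (γ : ℝ → ℝ) : Prop where
  smooth_y : ∀ t ∈ Icc (0 : ℝ) 1, ContDiff ℝ 1 (S t)
  smooth_t : ∀ y, ContDiffOn ℝ 3 (fun t => S t y) (Icc 0 1)
  pos : ∀ t ∈ Icc (0 : ℝ) 1, 0 < γ t
  tail : ∀ t ∈ Icc (0 : ℝ) 1,
    Tendsto (fun y => y * (-deriv (S t) y) / S t y) atTop (𝓝 (1 / γ t))

/-- Compact supports and bounded stabilised weights. -/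
structure SupportOverlap {Ω E : Type*} [MeasurableSpace Ω] [TopologicalSpace E]
    [MeasurableSpace E] (P : Measure Ω) (T : Ω → ℝ) (X : Ω → E) (fT : ℝ → ℝ)
    (fTX : ℝ → E → ℝ) : Prop where
  compact_X : IsCompact (P.map X).support
  support_T : (P.map T).support = Icc 0 1
  overlap : ∃ η₁ η₂ : ℝ, 0 < η₁ ∧ ∀ t ∈ Icc (0 : ℝ) 1, ∀ x ∈ (P.map X).support,
    η₁ ≤ stabWeight fT fTX t x ∧ stabWeight fT fTX t x ≤ η₂

/-- Smoothness of the conditional distribution function of `Y` given `(T,X)`, and of the density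
of `T`. The kernel `κ` is a regular conditional distribution of the outcome `Yobs`. -/
structure SmoothLaws {Ω E : Type*} [MeasurableSpace Ω] [NormedAddCommGroup E] [NormedSpace ℝ E]
    [MeasurableSpace E] (P : Measure Ω) (T : Ω → ℝ) (X : Ω → E) (Yobs : Ω → ℝ)
    (fT : ℝ → ℝ) : Prop where
  cond_cdf : ∃ κ : Kernel (ℝ × E) ℝ, IsMarkovKernel κ ∧
    (P.map (fun ω => (T ω, X ω))) ⊗ₘ κ = P.map (fun ω => ((T ω, X ω), Yobs ω)) ∧
    (∀ p ∈ Icc (0 : ℝ) 1 ×ˢ (P.map X).support, Continuous (fun y => (κ p).real (Iic y))) ∧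
    (∀ y, ContDiffOn ℝ 1 (fun p => (κ p).real (Iic y)) (Icc (0 : ℝ) 1 ×ˢ (P.map X).support))
  smooth_fT : ContDiffOn ℝ 3 fT (Icc 0 1)
  bounds_fT : ∃ η₃ η₄ : ℝ, 0 < η₃ ∧ ∀ t ∈ Icc (0 : ℝ) 1, η₃ ≤ fT t ∧ fT t ≤ η₄

/-- Kernel functions used for smoothing. -/
structure IsSmoothingKernel (K : ℝ → ℝ) : Prop where
  measurable : Measurable K
  nonneg : ∀ u, 0 ≤ K u
  bounded : ∃ C, ∀ u, K u ≤ C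
  symm : ∀ u, K (-u) = K u
  support_subset : Function.support K ⊆ Icc (-1) 1
  integral_eq_one : ∫ u, K u = 1
  second_moment : Integrable (fun u => u ^ 2 * K u) ∧ 0 < ∫ u, u ^ 2 * K u
  square_integrable : Integrable (fun u => K u ^ 2)

/-- Second-order regular variation of the counterfactual survival functions. -/
structure SecondOrder (S : ℝ → ℝ → ℝ) (γ ρ : ℝ → ℝ) (A : ℝ → ℝ → ℝ) : Prop where
  rho_neg : ∀ t ∈ Icc (0 : ℝ) 1, ρ t < 0
  eventual_sign : ∀ t ∈ Icc (0 : ℝ) 1, (∀ᶠ y in atTop, 0 < A t y) ∨ (∀ᶠ y in atTop, A t y < 0)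
  tendsto_zero : ∀ t ∈ Icc (0 : ℝ) 1, Tendsto (A t) atTop (𝓝 0)
  limit : ∀ t ∈ Icc (0 : ℝ) 1, ∀ z : ℝ, 0 < z →
    Tendsto (fun y => (S t (z * y) / S t y - z ^ (-1 / γ t)) / A t (1 / S t y)) atTop
      (𝓝 (z ^ (-1 / γ t) * ((z ^ (ρ t / γ t) - 1) / (γ t * ρ t))))

/-- Oscillation `ω_t(y,h)` of the survival functions above the level `y`, a supremum with values
in `[0,∞]`. -/
noncomputable def tailOscillation (S : ℝ → ℝ → ℝ) (t y h : ℝ) : ℝ≥0∞ :=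
  ⨆ (z : ℝ) (_ : y ≤ z) (s : ℝ) (_ : s ∈ Icc (0 : ℝ) 1 ∧ |s - t| ≤ h),
    ENNReal.ofReal (1 / Real.log z * |Real.log (S s z / S t z)|)

/-! ## Sample, estimators -/

/-- `(Tᵢ, Xᵢ, Yᵢ)` are i.i.d. copies of `(T, X, Y(T))`. -/
structure IsIIDSample {Ω₀ Ω E : Type*} [MeasurableSpace Ω₀] [MeasurableSpace Ω]
    [MeasurableSpace E] (P₀ : Measure Ω₀) (P : Measure Ω) (T : Ω₀ → ℝ) (X : Ω₀ → E)
    (Yobs : Ω₀ → ℝ) (Ts : ℕ → Ω → ℝ) (Xs : ℕ → Ω → E) (Ys : ℕ → Ω → ℝ) : Prop where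
  indep : iIndepFun (fun i ω => (Ts i ω, Xs i ω, Ys i ω)) P
  ident : ∀ i, IdentDistrib (fun ω => (Ts i ω, Xs i ω, Ys i ω))
    (fun ω => (T ω, X ω, Yobs ω)) P P₀

/-- `Zₙ = O_p(rₙ)`. -/
def IsBigOInProb {Ω : Type*} [MeasurableSpace Ω] (P : Measure Ω) (Z : ℕ → Ω → ℝ)
    (r : ℕ → ℝ) : Prop :=
  ∀ ε : ℝ, 0 < ε → ∃ M : ℝ, ∀ᶠ n in atTop,
    P {ω | M * |r n| < |Z n ω|} ≤ ENNReal.ofReal ε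

open Classical in
/-- Kernel estimator of the survival function at treatment `t`, bandwidth `h`, from the first `N`
observations, with weight function `w` (an estimate of `π₀`). -/
noncomputable def survivalEst {E : Type*} (K : ℝ → ℝ) (N : ℕ) (w : ℝ → E → ℝ) (Ts : ℕ → ℝ)
    (Xs : ℕ → E) (Ys : ℕ → ℝ) (h t y : ℝ) : ℝ :=
  (∑ i ∈ Finset.range N, w (Ts i) (Xs i) * (if y < Ys i then 1 else 0) * K ((Ts i - t) / h)) /
    (∑ i ∈ Finset.range N, w (Ts i) (Xs i) * K ((Ts i - t) / h))

/-- Quantile estimator `q̂_{t,h}(α)` obtained by inverting the estimated survival function. -/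
noncomputable def quantileEst {E : Type*} (K : ℝ → ℝ) (N : ℕ) (w : ℝ → E → ℝ) (Ts : ℕ → ℝ)
    (Xs : ℕ → E) (Ys : ℕ → ℝ) (h t α : ℝ) : ℝ :=
  survivalQuantile (survivalEst K N w Ts Xs Ys h t) α

/-- Extrapolated estimator `q̂^E_{t,h}(α) = q̂_{t,h}(1 - k/N) (k / (N (1 - α)))^g`, where `g` is an
estimate of the extreme-value index at `t`. -/
noncomputable def extremeQuantileEst {E : Type*} (K : ℝ → ℝ) (N k : ℕ) (w : ℝ → E → ℝ)
    (Ts : ℕ → ℝ) (Xs : ℕ → E) (Ys : ℕ → ℝ) (h t g α : ℝ) : ℝ :=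
  quantileEst K N w Ts Xs Ys h t (1 - (k : ℝ) / N) * ((k : ℝ) / (N * (1 - α))) ^ g

/-- Normalised relative error of the extrapolated estimator at level `1 - υ (1 - α)`:
`√(k h) / log (k / (N υ (1 - α))) * (q̂^E / q - 1)`, with `S` the true survival function. -/
noncomputable def extremeProcess {E : Type*} (S : ℝ → ℝ) (K : ℝ → ℝ) (N k : ℕ) (w : ℝ → E → ℝ)
    (Ts : ℕ → ℝ) (Xs : ℕ → E) (Ys : ℕ → ℝ) (h t g α υ : ℝ) : ℝ :=
  Real.sqrt (k * h) / Real.log (k / (N * υ * (1 - α))) *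
    (extremeQuantileEst K N k w Ts Xs Ys h t g (1 - υ * (1 - α)) /
      survivalQuantile S (1 - υ * (1 - α)) - 1)

/-! ## Weak convergence of processes in the space of bounded functions -/

/-- Outer expectation of a bounded, possibly non-measurable function. -/
noncomputable def outerExpectation {Ω : Type*} [MeasurableSpace Ω] (P : Measure Ω)
    (g : Ω → ℝ) : ℝ :=
  sInf {c | ∃ U : Ω → ℝ, Measurable U ∧ Integrable U P ∧ (∀ ω, g ω ≤ U ω) ∧ c = ∫ ω, U ω ∂P}

open Classical in
/-- A bounded function as an element of `ℓ^∞`. (Unbounded functions are sent to `0`; they play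
no role, see the next definition.) -/
noncomputable def toLinfty {ι F : Type*} [NormedAddCommGroup F] (g : ι → F) :
    lp (fun _ : ι => F) ∞ :=
  if hg : Memℓp (E := fun _ : ι => F) g ∞ then ⟨g, hg⟩ else 0

/-- Weak convergence `Zₙ ⇒ Z` in `ℓ^∞(ι; F)` in the sense of Hoffmann-Jørgensen: the paths are
bounded (those of `Zₙ` for all large `n`), the limit is measurable when tested against continuous
functions, and `E* f(Zₙ) → E f(Z)` for every bounded continuous `f` on `ℓ^∞`. -/
structure WeakConvLinfty {Ω Λ ι F : Type*} [MeasurableSpace Ω] [MeasurableSpace Λ]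
    [NormedAddCommGroup F] (P : Measure Ω) (Q : Measure Λ) (Z : ℕ → Ω → ι → F)
    (Zlim : Λ → ι → F) : Prop where
  bounded : ∀ᶠ n in atTop, ∀ ω, Memℓp (E := fun _ : ι => F) (Z n ω) ∞
  bounded_lim : ∀ l, Memℓp (E := fun _ : ι => F) (Zlim l) ∞
  measurable_lim : ∀ f : lp (fun _ : ι => F) ∞ →ᵇ ℝ,
    AEStronglyMeasurable (fun l => f (toLinfty (Zlim l))) Q
  tendsto : ∀ f : lp (fun _ : ι => F) ∞ →ᵇ ℝ,
    Tendsto (fun n => outerExpectation P (fun ω => f (toLinfty (Z n ω)))) atTop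
      (𝓝 (∫ l, f (toLinfty (Zlim l)) ∂Q))

/-! The extrapolated estimator is a product, so its error is additive on the log scale. Write s =
√(kh) and L = log(k/(Nυ(1-α))). The logarithm of the ratio of estimated to true extreme quantile is
the sum of three terms: the log-error of the quantile estimator at the intermediate level 1 - k/N,
the index error (γ̂ - γ)L, and the deterministic bias log q_t(1-k/N) + γL - log q_t(1-υ(1-α))
(`extremeProcess_eq_exp`). After multiplication by s/L the middle term is s(γ̂ - γ), which does not
depend on υ and has the limit Γ. It remains to see that the other two terms, and the linearisation
of the exponential (`abs_exp_expansion_sub_le`), are negligible uniformly in υ.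

Bias: it is O(A_t(N/k)) however far one extrapolates. Pointwise second-order regular variation is
made uniform by a Baire argument on bounded increments, and the increments are then summed as a
geometric series because ρ < 0 (`exists_forall_increment_le`,
`IsHeavyTailed.exists_second_order_bound`).

Intermediate quantile: no central limit theorem is needed. A relative error o_p(L/s) is enough, and
since L → ∞ this is weaker than the natural rate 1/s. So second moments suffice: at the points q(1 ±
η) with sη → ∞ the weighted exceedance sum has relative drift of order η, which beats its random
fluctuation, of order 1/s, and the weight error, of order δ. The drift is computed from two facts:
weighting by π₀ turns expectations into kernel averages of counterfactual survival functions
(`SupportOverlap.lintegral_stabWeight_mul`), and the oscillation condition keeps those close to the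
one at t (`exists_survival_window`). The outcome is `tendsto_measure_quantileEst_notMem`.

Weak convergence: the paths are thus uniformly close, in outer probability, to random constants.
Constants embed continuously into ℓ^∞, so convergence in distribution in ℝ² transfers
(`weakConvLinfty_const`). -/

/-! ## Second-order regular variation: a uniform bound -/

/-- If the increments of a continuous function `G`, normalised by `b`, converge pointwise to
`(exp (κ u) - 1) / β` with `κ < 0`, then all forward increments of `G` are `O(b)`, uniformly. -/
theorem exists_forall_increment_le {G b : ℝ → ℝ} {κ β : ℝ} (hG : Continuous G)
    (hb : ∀ᶠ x in atTop, b x ≠ 0) (hκ : κ < 0) (hβ : β ≠ 0)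
    (hlim : ∀ u, Tendsto (fun x => (G (x + u) - G x) / b x) atTop
      (𝓝 ((Real.exp (κ * u) - 1) / β))) :
    ∃ C x₀ : ℝ, 0 ≤ C ∧ ∀ x ≥ x₀, ∀ u ≥ 0, |G (x + u) - G x| ≤ C * |b x| := by
  have shift : ∀ v : ℝ, Tendsto (fun x : ℝ => x + v) atTop atTop := fun v =>
    tendsto_atTop_add_const_right _ _ tendsto_id
  set H1 : ℝ := (Real.exp κ - 1) / β with hH1
  have hH1ne : H1 ≠ 0 := by
    have : Real.exp κ < 1 := Real.exp_lt_one_iff.2 hκ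
    exact div_ne_zero (by linarith) hβ
  have h1 : Tendsto (fun x => (G (x + 1) - G x) / b x) atTop (𝓝 H1) := by
    simpa using hlim 1
  -- The increment of length v + 1 minus that of length v, both from x, is the unit increment from x
  -- + v. Comparing limits forces `b` to scale by exp(κ v); no regular variation of `b` has to be
  -- assumed.
  have hratio : ∀ v, Tendsto (fun x => b (x + v) / b x) atTop (𝓝 (Real.exp (κ * v))) := by
    intro v
    have e1 : Tendsto (fun x => (G (x + v + 1) - G (x + v)) / b (x + v)) atTop (𝓝 H1) :=
      h1.comp (shift v)
    have e2 : Tendsto (fun x => (G (x + v + 1) - G (x + v)) / b x) atTop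
        (𝓝 (Real.exp (κ * v) * H1)) := by
      have := (hlim (v + 1)).sub (hlim v)
      have h' : (Real.exp (κ * (v + 1)) - 1) / β - (Real.exp (κ * v) - 1) / β
          = Real.exp (κ * v) * H1 := by
        rw [mul_add, Real.exp_add, hH1, mul_one]; ring
      rw [h'] at this
      refine this.congr fun x => ?_
      rw [← add_assoc]; ring
    have e3 := e2.div e1 hH1ne
    rw [mul_div_assoc, div_self hH1ne, mul_one] at e3
    refine e3.congr' ?_
    filter_upwards [hb, (shift v).eventually hb, e1.eventually_ne hH1ne] with x hx hxv hne
    have : G (x + v + 1) - G (x + v) ≠ 0 := fun h0 => hne (by rw [h0, zero_div])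
    simp only [Pi.div_apply]
    field_simp
  -- `b` has no regularity, so its continuous proxy `B` serves as the gauge; this keeps the sets of
  -- the Baire argument closed.
  set B : ℝ → ℝ := fun x => |G (x + 1) - G x| with hB
  have hBcont : Continuous B := by fun_prop
  have hBb : ∀ᶠ x in atTop, B x ≤ (|H1| + 1) * |b x| := by
    filter_upwards [h1.abs.eventually_lt_const (lt_add_one |H1|), hb] with x hx hbx
    rw [abs_div, div_lt_iff₀ (abs_pos.2 hbx)] at hx
    exact hx.le
  have hcover : ∀ u : ℝ, ∃ n : ℕ, ∀ x ≥ (n : ℝ), |G (x + u) - G x| ≤ n * B x := by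
    intro u
    have e := (((hlim u).div h1 hH1ne).abs).eventually_lt_const (lt_add_one _)
    obtain ⟨M, hM⟩ := eventually_atTop.1 (e.and (hb.and (h1.eventually_ne hH1ne)))
    set c := |(Real.exp (κ * u) - 1) / β / H1| + 1
    -- One integer is used both as threshold for x and as constant, so countably many sets cover the
    -- line.
    obtain ⟨n, hn⟩ := exists_nat_ge (max M c)
    refine ⟨n, fun x hx => ?_⟩
    obtain ⟨hx1, hbx, hne⟩ := hM x (le_trans (le_trans (le_max_left _ _) hn) hx)
    have hne' : G (x + 1) - G x ≠ 0 := fun h0 => hne (by rw [h0, zero_div])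
    have hBpos : 0 < B x := abs_pos.2 hne'
    have h2 : |(G (x + u) - G x) / b x / ((G (x + 1) - G x) / b x)| =
        |G (x + u) - G x| / B x := by
      rw [div_div_div_cancel_right₀ hbx, abs_div]
    simp only [Pi.div_apply] at hx1
    rw [h2, div_lt_iff₀ hBpos] at hx1
    refine hx1.le.trans ?_
    gcongr
    exact (le_max_right _ _).trans hn
  -- Baire category: one of the closed sets has interior, which makes the pointwise bound uniform
  -- for u in an interval around `u₀`.
  obtain ⟨n, u₀, hu₀⟩ : ∃ n : ℕ, (interior {u : ℝ | ∀ x ≥ (n : ℝ),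
      |G (x + u) - G x| ≤ n * B x}).Nonempty := by
    refine nonempty_interior_of_iUnion_of_closed (fun n => ?_) ?_
    · simp only [ofPred_forall]
      refine isClosed_iInter fun x => isClosed_iInter fun _ => ?_
      exact isClosed_le (by fun_prop) continuous_const
    · exact eq_univ_of_forall fun u => mem_iUnion.2 (hcover u)
  obtain ⟨ε, hε, hball⟩ := Metric.isOpen_iff.1 isOpen_interior u₀ hu₀
  have hmem : ∀ v ∈ Icc (0 : ℝ) (ε / 2), ∀ x ≥ (n : ℝ),
      |G (x + (u₀ + v)) - G x| ≤ n * B x := by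
    intro v hv
    refine interior_subset (hball ?_)
    rw [Metric.mem_ball, Real.dist_eq, add_sub_cancel_left, abs_of_nonneg hv.1]
    linarith [hv.2]
  set e := ε / 2 with he
  have hepos : 0 < e := by positivity
  set C : ℝ := 2 * n * ((|H1| + 1) * (Real.exp (κ * (-u₀)) + 1)) with hC
  have hCnn : 0 ≤ C := by positivity
  -- Moving the base point back by `u₀` carries the interval around `u₀` to one starting at 0: the
  -- increment over [x, x + v] is the difference of the increments of lengths u₀ + v and u₀ from x -
  -- u₀.
  have hstep : ∀ᶠ x in atTop, ∀ v ∈ Icc (0 : ℝ) e, |G (x + v) - G x| ≤ C * |b x| := by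
    filter_upwards [(shift (-u₀)).eventually hBb, (shift (-u₀)).eventually_ge_atTop (n : ℝ),
      (hratio (-u₀)).abs.eventually_lt_const (lt_add_one _), hb] with x hx1 hx2 hx3 hx4 v hv
    rw [abs_div, div_lt_iff₀ (abs_pos.2 hx4), abs_of_pos (Real.exp_pos _)] at hx3
    have m1 := hmem v hv _ hx2
    have m2 := hmem 0 ⟨le_rfl, hepos.le⟩ _ hx2
    have r1 : x + -u₀ + (u₀ + v) = x + v := by ring
    have r2 : x + -u₀ + (u₀ + 0) = x := by ring
    rw [r1] at m1
    rw [r2] at m2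
    calc |G (x + v) - G x| = |(G (x + v) - G (x + -u₀)) - (G x - G (x + -u₀))| := by
          congr 1; ring
      _ ≤ n * B (x + -u₀) + n * B (x + -u₀) := (abs_sub _ _).trans (add_le_add m1 m2)
      _ = 2 * n * B (x + -u₀) := by ring
      _ ≤ 2 * n * ((|H1| + 1) * ((Real.exp (κ * (-u₀)) + 1) * |b x|)) := by
          have : B (x + -u₀) ≤ (|H1| + 1) * ((Real.exp (κ * (-u₀)) + 1) * |b x|) :=
            hx1.trans (by gcongr)
          gcongr
      _ = C * |b x| := by rw [hC]; ring
  have hθ1 : Real.exp (κ * e) < 1 := Real.exp_lt_one_iff.2 (mul_neg_of_neg_of_pos hκ hepos)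
  obtain ⟨θ, hθ, hθ'⟩ := exists_between hθ1
  have hcontr : ∀ᶠ x in atTop, |b (x + e)| ≤ θ * |b x| := by
    filter_upwards [(hratio e).abs.eventually_lt_const (by
      rwa [abs_of_pos (Real.exp_pos _)]), hb] with x hx hbx
    rw [abs_div, div_lt_iff₀ (abs_pos.2 hbx)] at hx
    exact hx.le
  obtain ⟨x₀, hx₀⟩ := eventually_atTop.1 (hstep.and hcontr)
  have hθ0 : 0 < 1 - θ := by linarith
  have hθpos : 0 ≤ θ := (Real.exp_pos _).le.trans hθ.le
  -- The sum of the geometric series with ratio θ, that is, the fixed point of D ↦ θD + C; hence one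
  -- constant survives every induction step.
  set D := C / (1 - θ) with hD
  have hDC : D * θ + C = D := by rw [hD]; field_simp; ring
  have hDnn : 0 ≤ D := by positivity
  have hCD : C ≤ D := by nlinarith [mul_nonneg hDnn hθpos]
  refine ⟨D, x₀, hDnn, ?_⟩
  have key : ∀ m : ℕ, ∀ x ≥ x₀, ∀ u ∈ Icc (0 : ℝ) (m * e), |G (x + u) - G x| ≤ D * |b x| := by
    intro m
    induction m with
    | zero =>
      intro x hx u hu
      have : u = 0 := le_antisymm (by simpa using hu.2) hu.1
      subst this
      simpa using mul_nonneg hDnn (abs_nonneg (b x))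
    | succ m ih =>
      intro x hx u hu
      rcases le_total u e with hue | hue
      · exact ((hx₀ x hx).1 u ⟨hu.1, hue⟩).trans (by gcongr)
      · have i1 := ih (x + e) (by linarith) (u - e) ⟨by linarith, by
          have := hu.2; push_cast at this; linarith⟩
        have i2 := (hx₀ x hx).1 e ⟨hepos.le, le_rfl⟩
        have i3 := (hx₀ x hx).2
        rw [show x + e + (u - e) = x + u by ring] at i1
        calc |G (x + u) - G x| = |(G (x + u) - G (x + e)) + (G (x + e) - G x)| := by
              congr 1; ring
          _ ≤ D * |b (x + e)| + C * |b x| := (abs_add_le _ _).trans (add_le_add i1 i2)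
          _ ≤ D * (θ * |b x|) + C * |b x| := by gcongr
          _ = (D * θ + C) * |b x| := by ring
          _ = D * |b x| := by rw [hDC]
  intro x hx u hu
  obtain ⟨m, hm⟩ := exists_nat_ge (u / e)
  exact key m x hx u ⟨hu, by rwa [div_le_iff₀ hepos] at hm⟩

/-! ## Smooth heavy-tailed survival functions -/

/-- A continuously differentiable survival function with extreme-value index `g > 0`. -/
structure IsHeavyTailed (S : ℝ → ℝ) (g : ℝ) : Prop where
  anti : Antitone S
  nonneg : ∀ y, 0 ≤ S y
  tendsto_top : Tendsto S atTop (𝓝 0)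
  tendsto_bot : Tendsto S atBot (𝓝 1)
  smooth : ContDiff ℝ 1 S
  index_pos : 0 < g
  tail : Tendsto (fun y => y * (-deriv S y) / S y) atTop (𝓝 (1 / g))

namespace IsHeavyTailed

variable {S : ℝ → ℝ} {g : ℝ}

theorem pos (h : IsHeavyTailed S g) (y : ℝ) : 0 < S y := by
  have hg : (1 / g : ℝ) ≠ 0 := (one_div_pos.2 h.index_pos).ne'
  obtain ⟨z, hz, hyz⟩ := ((h.tail.eventually_ne hg).and (eventually_ge_atTop y)).exists
  have : S z ≠ 0 := fun h0 => hz (by rw [h0, div_zero])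
  exact ((h.nonneg z).lt_of_ne this.symm).trans_le (h.anti hyz)

theorem bddBelow_quantileSet (h : IsHeavyTailed S g) {p : ℝ} (hp : p < 1) :
    BddBelow {y | S y ≤ p} := by
  obtain ⟨z, hz⟩ := (h.tendsto_bot.eventually_const_lt hp).exists
  refine ⟨z, fun y hy => ?_⟩
  by_contra! hlt
  exact absurd (h.anti hlt.le) (not_le.2 (lt_of_le_of_lt hy hz))

theorem nonempty_quantileSet (h : IsHeavyTailed S g) {p : ℝ} (hp : 0 < p) :
    {y | S y ≤ p}.Nonempty :=
  let ⟨z, hz⟩ := (h.tendsto_top.eventually_lt_const hp).exists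
  ⟨z, hz.le⟩

/-- By continuity the sublevel set is closed, so the infimum is attained. All later order relations
between quantiles and survival probabilities come from this Galois connection. -/
theorem quantile_le_iff (h : IsHeavyTailed S g) {p : ℝ} (hp : p ∈ Ioo (0 : ℝ) 1) (y : ℝ) :
    survivalQuantile S (1 - p) ≤ y ↔ S y ≤ p := by
  rw [survivalQuantile, sub_sub_cancel]
  refine ⟨fun hy => ?_, fun hy => csInf_le (h.bddBelow_quantileSet hp.2) hy⟩
  have hcl : IsClosed {y | S y ≤ p} := isClosed_le h.smooth.continuous continuous_const
  exact (h.anti hy).trans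
    (hcl.csInf_mem (h.nonempty_quantileSet hp.1) (h.bddBelow_quantileSet hp.2))

theorem apply_quantile (h : IsHeavyTailed S g) {p : ℝ} (hp : p ∈ Ioo (0 : ℝ) 1) :
    S (survivalQuantile S (1 - p)) = p := by
  refine le_antisymm ((h.quantile_le_iff hp _).1 le_rfl) ?_
  obtain ⟨a, ha⟩ := (h.tendsto_bot.eventually_const_lt hp.2).exists
  obtain ⟨b, hb⟩ := (h.tendsto_top.eventually_lt_const hp.1).exists
  obtain ⟨c, hc⟩ := mem_range_of_exists_le_of_exists_ge h.smooth.continuous ⟨b, hb.le⟩ ⟨a, ha.le⟩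
  exact hc.ge.trans (h.anti ((h.quantile_le_iff hp c).2 hc.le))

theorem quantile_anti (h : IsHeavyTailed S g) {p p' : ℝ} (hp : p ∈ Ioo (0 : ℝ) 1)
    (hp' : p' ∈ Ioo (0 : ℝ) 1) (hpp : p ≤ p') :
    survivalQuantile S (1 - p') ≤ survivalQuantile S (1 - p) :=
  (h.quantile_le_iff hp' _).2 ((h.apply_quantile hp).trans_le hpp)

theorem tendsto_quantile (h : IsHeavyTailed S g) {ι : Type*} {l : Filter ι} {p : ι → ℝ}
    (hp : Tendsto p l (𝓝 0)) (hpos : ∀ᶠ i in l, 0 < p i) :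
    Tendsto (fun i => survivalQuantile S (1 - p i)) l atTop := by
  refine tendsto_atTop.2 fun M => ?_
  filter_upwards [hpos, hp.eventually_lt_const (h.pos M), hp.eventually_lt_const one_pos]
    with i h0 hM h1
  exact le_of_not_ge fun hle => absurd ((h.quantile_le_iff ⟨h0, h1⟩ M).1 hle) (not_le.2 hM)

/-- In the variable log y the slope of -log S is y f(y)/S(y), which tends to 1/g and so eventually
lies between 1/(2g) and 2/g. Consequently log S + c log y is antitone for the first constant and
monotone for the second. -/
theorem log_div_bounds (h : IsHeavyTailed S g) : ∃ y₀ : ℝ, 1 < y₀ ∧ ∀ y z, y₀ ≤ y → y ≤ z →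
    1 / (2 * g) * Real.log (z / y) ≤ Real.log (S y) - Real.log (S z) ∧
    Real.log (S y) - Real.log (S z) ≤ 2 / g * Real.log (z / y) := by
  have hg := h.index_pos
  have hg' : (0 : ℝ) < 1 / g := one_div_pos.2 hg
  have l1 : 1 / (2 * g) < 1 / g := by
    rw [one_div_lt_one_div (by positivity) hg]; linarith
  have l2 : 1 / g < 2 / g := by gcongr; norm_num
  obtain ⟨y₁, hy₁⟩ := eventually_atTop.1
    ((h.tail.eventually_const_lt l1).and (h.tail.eventually_lt_const l2))
  refine ⟨max y₁ 2, by simp, ?_⟩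
  have hdiff : ∀ c : ℝ, ∀ y ∈ Ici (max y₁ 2),
      HasDerivAt (fun y => Real.log (S y) + c * Real.log y)
        (deriv S y / S y + c * y⁻¹) y := by
    intro c y hy
    have hy0 : (0 : ℝ) < y := by linarith [le_trans (le_max_right y₁ 2) hy]
    have d1 : HasDerivAt S (deriv S y) y :=
      (h.smooth.differentiable one_ne_zero y).hasDerivAt
    exact (d1.log (h.pos y).ne').add ((Real.hasDerivAt_log hy0.ne').const_mul c)
  have hderiv : ∀ c : ℝ, ∀ y ∈ Ici (max y₁ 2),
      deriv S y / S y + c * y⁻¹ = y⁻¹ * (c - y * (-deriv S y) / S y) := by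
    intro c y hy
    have hy0 : (0 : ℝ) < y := by linarith [le_trans (le_max_right y₁ 2) hy]
    have := (h.pos y).ne'
    field_simp
    ring
  have hanti : AntitoneOn (fun y => Real.log (S y) + 1 / (2 * g) * Real.log y)
      (Ici (max y₁ 2)) := by
    refine antitoneOn_of_deriv_nonpos (convex_Ici _)
      (fun y hy => (hdiff _ y hy).continuousAt.continuousWithinAt)
      (fun y hy => (hdiff _ y (interior_subset hy)).differentiableAt.differentiableWithinAt)
      fun y hy => ?_
    have hy' := interior_subset hy
    have hy0 : (0 : ℝ) < y := by linarith [le_trans (le_max_right y₁ 2) hy']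
    rw [(hdiff _ y hy').deriv, hderiv _ y hy']
    have := (hy₁ y ((le_max_left _ _).trans hy')).1
    exact mul_nonpos_of_nonneg_of_nonpos (by positivity) (by linarith)
  have hmono : MonotoneOn (fun y => Real.log (S y) + 2 / g * Real.log y)
      (Ici (max y₁ 2)) := by
    refine monotoneOn_of_deriv_nonneg (convex_Ici _)
      (fun y hy => (hdiff _ y hy).continuousAt.continuousWithinAt)
      (fun y hy => (hdiff _ y (interior_subset hy)).differentiableAt.differentiableWithinAt)
      fun y hy => ?_
    have hy' := interior_subset hy
    have hy0 : (0 : ℝ) < y := by linarith [le_trans (le_max_right y₁ 2) hy']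
    rw [(hdiff _ y hy').deriv, hderiv _ y hy']
    have := (hy₁ y ((le_max_left _ _).trans hy')).2
    exact mul_nonneg (by positivity) (by linarith)
  intro y z hy hyz
  have hy0 : (0 : ℝ) < y := by linarith [le_trans (le_max_right y₁ 2) hy]
  have hz0 : 0 < z := hy0.trans_le hyz
  have a1 := hanti (mem_Ici.2 hy) (mem_Ici.2 (hy.trans hyz)) hyz
  have a2 := hmono (mem_Ici.2 hy) (mem_Ici.2 (hy.trans hyz)) hyz
  simp only at a1 a2
  rw [Real.log_div hz0.ne' hy0.ne', mul_sub, mul_sub]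
  exact ⟨by linarith, by linarith⟩

/-- The slope 1/(2g) is halved to absorb the value at the starting point. At an intermediate
quantile this bounds log q by a multiple of |log(k/N)|, the factor present in the oscillation
condition. -/
theorem log_le_abs_log (h : IsHeavyTailed S g) :
    ∀ᶠ y in atTop, 1 / (4 * g) * Real.log y ≤ |Real.log (S y)| := by
  obtain ⟨y₀, hy₀, hb⟩ := h.log_div_bounds
  have hg := h.index_pos
  filter_upwards [eventually_ge_atTop y₀, Real.tendsto_log_atTop.eventually_ge_atTop
    (4 * g * (Real.log (S y₀) + 1 / (2 * g) * Real.log y₀))] with y hy hy2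
  have h1 := (hb y₀ y le_rfl hy).1
  rw [Real.log_div (by linarith) (by linarith), mul_sub] at h1
  have h2 : Real.log (S y₀) + 1 / (2 * g) * Real.log y₀ ≤ 1 / (4 * g) * Real.log y := by
    rw [show 1 / (4 * g) * Real.log y = Real.log y / (4 * g) by ring, le_div_iff₀ (by positivity)]
    linarith
  have h3 : 1 / (2 * g) * Real.log y = 2 * (1 / (4 * g) * Real.log y) := by
    field_simp; ring
  refine le_trans ?_ (neg_le_abs _)
  linarith

/-- With x = log y, the function log S(eˣ) + x/g has increments whose normalised limits are
(exp(ρu/g) - 1)/(gρ), so the uniform increment bound applies with κ = ρ/g and β = gρ. The gain over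
the hypothesis is uniformity in z/y ≥ 1, which extrapolation to arbitrarily remote levels requires.
-/
theorem exists_second_order_bound (h : IsHeavyTailed S g) {ρ : ℝ} {A : ℝ → ℝ} (hρ : ρ < 0)
    (hsign : (∀ᶠ y in atTop, 0 < A y) ∨ (∀ᶠ y in atTop, A y < 0))
    (hA : Tendsto A atTop (𝓝 0))
    (hlim : ∀ z : ℝ, 0 < z → Tendsto (fun y => (S (z * y) / S y - z ^ (-1 / g)) / A (1 / S y))
      atTop (𝓝 (z ^ (-1 / g) * ((z ^ (ρ / g) - 1) / (g * ρ))))) :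
    ∃ C y₀ : ℝ, 0 ≤ C ∧ 0 < y₀ ∧ ∀ y z, y₀ ≤ y → y ≤ z →
      |Real.log (S z) - Real.log (S y) + 1 / g * Real.log (z / y)| ≤ C * |A (1 / S y)| := by
  have hg := h.index_pos
  have hne : ∀ᶠ y in atTop, A y ≠ 0 := by
    rcases hsign with hs | hs
    · exact hs.mono fun y hy => hy.ne'
    · exact hs.mono fun y hy => hy.ne
  have hinv : Tendsto (fun x => 1 / S (Real.exp x)) atTop atTop := by
    simp only [one_div]
    exact (tendsto_inv_nhdsGT_zero.comp (tendsto_nhdsWithin_of_tendsto_nhds_of_eventually_within _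
      h.tendsto_top (Eventually.of_forall h.pos))).comp Real.tendsto_exp_atTop
  set G : ℝ → ℝ := fun x => Real.log (S (Real.exp x)) + x / g with hG
  set b : ℝ → ℝ := fun x => A (1 / S (Real.exp x)) with hb
  have hb0 : ∀ᶠ x in atTop, b x ≠ 0 := hinv.eventually hne
  have hbt : Tendsto b atTop (𝓝 0) := hA.comp hinv
  have hGc : Continuous G := by
    have : Continuous fun x => S (Real.exp x) := h.smooth.continuous.comp Real.continuous_exp
    exact (this.log fun x => (h.pos _).ne').add (continuous_id.div_const g)
  have hGlim : ∀ u, Tendsto (fun x => (G (x + u) - G x) / b x) atTop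
      (𝓝 ((Real.exp (ρ / g * u) - 1) / (g * ρ))) := by
    intro u
    set r : ℝ → ℝ := fun x => Real.exp (G (x + u) - G x) with hr
    have e1 : Tendsto (fun x => (r x - 1) / b x) atTop
        (𝓝 ((Real.exp (ρ / g * u) - 1) / (g * ρ))) := by
      have e0 := ((hlim (Real.exp u) (Real.exp_pos u)).comp Real.tendsto_exp_atTop).const_mul
        (Real.exp (u / g))
      have c1 : Real.exp u ^ (-1 / g) = Real.exp (-(u / g)) := by
        rw [← Real.exp_mul]; congr 1; ring
      have c2 : Real.exp u ^ (ρ / g) = Real.exp (ρ / g * u) := by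
        rw [← Real.exp_mul]; congr 1; ring
      rw [c1, c2, ← mul_assoc, ← Real.exp_add, add_neg_cancel, Real.exp_zero, one_mul] at e0
      refine e0.congr fun x => ?_
      simp only [Function.comp_apply, hr, hb, hG]
      rw [← mul_div_assoc]
      congr 1
      have : Real.log (S (Real.exp (x + u))) + (x + u) / g - (Real.log (S (Real.exp x)) + x / g)
          = Real.log (S (Real.exp (x + u))) - Real.log (S (Real.exp x)) + u / g := by ring
      have c3 : Real.exp (u / g) * Real.exp (-(u / g)) = 1 := by
        rw [← Real.exp_add, add_neg_cancel, Real.exp_zero]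
      rw [mul_sub, c3, ← Real.exp_add u x, add_comm u x, this, Real.exp_add _ (u / g),
        Real.exp_sub, Real.exp_log (h.pos _), Real.exp_log (h.pos _)]
      ring
    have e2 : Tendsto r atTop (𝓝 1) := by
      have := (e1.mul hbt).add_const 1
      rw [mul_zero, zero_add] at this
      refine this.congr' ?_
      filter_upwards [hb0] with x hx
      field_simp
      ring
    have hd : HasDerivAt Real.log 1 1 := by simpa using Real.hasDerivAt_log one_ne_zero
    -- `dslope` writes log r as r - 1 times a factor tending to 1, with no separate case r = 1; this
    -- passes the expansion of r to its logarithm.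
    have e3 : Tendsto (fun x => dslope Real.log 1 (r x)) atTop (𝓝 1) := by
      have hc : ContinuousAt (dslope Real.log 1) 1 :=
        continuousAt_dslope_same.2 hd.differentiableAt
      have := hc.tendsto.comp e2
      rwa [dslope_same, hd.deriv] at this
    have e4 := e3.mul e1
    rw [one_mul] at e4
    refine e4.congr fun x => ?_
    have : (r x - 1) • dslope Real.log 1 (r x) = Real.log (r x) - Real.log 1 :=
      sub_smul_dslope _ _ _
    rw [smul_eq_mul, Real.log_one, sub_zero, Real.log_exp] at this
    rw [← this]
    ring
  obtain ⟨C, x₀, hC, hbd⟩ := exists_forall_increment_le hGc hb0 (div_neg_of_neg_of_pos hρ hg)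
    (mul_neg_of_pos_of_neg hg hρ).ne hGlim
  refine ⟨C, Real.exp x₀, hC, Real.exp_pos _, fun y z hy hyz => ?_⟩
  have hy0 : 0 < y := (Real.exp_pos _).trans_le hy
  have hz0 : 0 < z := hy0.trans_le hyz
  have hxy : x₀ ≤ Real.log y := by rwa [Real.le_log_iff_exp_le hy0]
  have := hbd (Real.log y) hxy (Real.log z - Real.log y)
    (sub_nonneg.2 (Real.log_le_log hy0 hyz))
  simp only [hG, hb, add_sub_cancel, Real.exp_log hy0, Real.exp_log hz0] at this
  rw [Real.log_div hz0.ne' hy0.ne']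
  refine le_trans (le_of_eq ?_) this
  congr 1
  ring

end IsHeavyTailed

/-! ## Conditional independence and stabilised weights -/

/-- If a weight decouples `τ` and `Z` on rectangles, it decouples them for all nonnegative
measurable functions. -/
theorem lintegral_mul_eq_of_rectangles {Ω Ω' S : Type*} [MeasurableSpace Ω] [MeasurableSpace Ω']
    [MeasurableSpace S] (P : Measure Ω) [IsProbabilityMeasure P] {Z : Ω → Ω'} (hZ : Measurable Z)
    {τ : Ω → S} (hτ : Measurable τ) {w : Ω → ℝ≥0∞} (hw : Measurable w)
    (hrect : ∀ A B, MeasurableSet A → MeasurableSet B →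
      ∫⁻ ω in τ ⁻¹' A ∩ Z ⁻¹' B, w ω ∂P = P (τ ⁻¹' A) * P (Z ⁻¹' B))
    {Φ : S × Ω' → ℝ≥0∞} (hΦ : Measurable Φ) :
    ∫⁻ ω, w ω * Φ (τ ω, Z ω) ∂P = ∫⁻ s, ∫⁻ ω, Φ (s, Z ω) ∂P ∂(P.map τ) := by
  have hpair : Measurable fun ω => (τ ω, Z ω) := hτ.prodMk hZ
  have : IsProbabilityMeasure (P.map τ) := Measure.isProbabilityMeasure_map hτ.aemeasurable
  have : IsProbabilityMeasure (P.map Z) := Measure.isProbabilityMeasure_map hZ.aemeasurable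
  have hprod : (P.map τ).prod (P.map Z) = (P.withDensity w).map fun ω => (τ ω, Z ω) := by
    refine Measure.prod_eq fun A B hA hB => ?_
    rw [Measure.map_apply hpair (hA.prod hB), Measure.map_apply hτ hA, Measure.map_apply hZ hB,
      mk_preimage_prod, withDensity_apply _ ((hτ hA).inter (hZ hB)), hrect A B hA hB]
  calc ∫⁻ ω, w ω * Φ (τ ω, Z ω) ∂P = ∫⁻ ω, Φ (τ ω, Z ω) ∂(P.withDensity w) :=
        (lintegral_withDensity_eq_lintegral_mul P hw (hΦ.comp hpair)).symm
    _ = ∫⁻ p, Φ p ∂((P.map τ).prod (P.map Z)) := by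
        rw [hprod, lintegral_map hΦ hpair]
    _ = ∫⁻ s, ∫⁻ z, Φ (s, z) ∂(P.map Z) ∂(P.map τ) := lintegral_prod _ hΦ.aemeasurable
    _ = _ := by
        refine lintegral_congr fun s => ?_
        exact lintegral_map (hΦ.comp measurable_prodMk_left) hZ

/-- Under conditional independence of `T` and `m₂` given `X`, restricting to an event of `m₂`
changes the law of `(X, T)` by a density depending on `X` only. -/
theorem CondIndepGiven.exists_density {Ω E : Type*} {m₂ : MeasurableSpace Ω} [mΩ : MeasurableSpace Ω] [MeasurableSpace E]
    {P : Measure Ω} [IsProbabilityMeasure P] {T : Ω → ℝ} {X : Ω → E} (hT : Measurable T)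
    (hX : Measurable X) (hm₂ : m₂ ≤ mΩ)
    (h : CondIndepGiven P (MeasurableSpace.comap X inferInstance)
      (MeasurableSpace.comap T inferInstance) m₂) {B : Set Ω} (hB : MeasurableSet[m₂] B) :
    ∃ b : E → ℝ≥0∞, Measurable b ∧ ∀ φ : E × ℝ → ℝ≥0∞, Measurable φ →
      ∫⁻ ω in B, φ (X ω, T ω) ∂P = ∫⁻ ω, φ (X ω, T ω) * b (X ω) ∂P := by
  have hm : MeasurableSpace.comap X inferInstance ≤ mΩ := hX.comap_le
  have hB' : MeasurableSet B := hm₂ _ hB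
  have hind : ∀ s : Set Ω, MeasurableSet s → Integrable (s.indicator fun _ => (1 : ℝ)) P :=
    fun s hs => (integrable_const 1).indicator hs
  -- The density is P(B | X), factored as a function of X.
  obtain ⟨b, hbm, hb⟩ := (stronglyMeasurable_condExp (μ := P)
    (m := MeasurableSpace.comap X inferInstance)
    (f := B.indicator fun _ => (1 : ℝ))).exists_eq_measurable_comp
  have hb0 : 0 ≤ᵐ[P] b ∘ X := by
    rw [← hb]
    exact condExp_nonneg (Eventually.of_forall fun ω => indicator_nonneg (fun _ _ => zero_le_one) ω)
  have hbint : Integrable (b ∘ X) P := by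
    rw [← hb]
    exact integrable_condExp
  have hbE : Measurable fun x => ENNReal.ofReal (b x) := hbm.measurable.ennreal_ofReal
  refine ⟨fun x => ENNReal.ofReal (b x), hbE, ?_⟩
  have hXT : Measurable fun ω => (X ω, T ω) := hX.prodMk hT
  have hset : ∀ (C : Set E) (A : Set ℝ), MeasurableSet C → MeasurableSet A →
      ∫ ω in X ⁻¹' C ∩ T ⁻¹' A, b (X ω) ∂P = P.real (X ⁻¹' C ∩ T ⁻¹' A ∩ B) := by
    intro C A hC hA
    set a : Ω → ℝ := (T ⁻¹' A).indicator fun _ => 1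
    have hA' : MeasurableSet (T ⁻¹' A) := hT hA
    have hC' : MeasurableSet[MeasurableSpace.comap X inferInstance] (X ⁻¹' C) := ⟨C, hC, rfl⟩
    have hab : Integrable (a * (b ∘ X)) P := by
      have : a * (b ∘ X) = (T ⁻¹' A).indicator (b ∘ X) := by
        ext ω
        by_cases hω : ω ∈ T ⁻¹' A <;> simp [a, hω]
      rw [this]
      exact hbint.indicator hA'
    have hpull : P[a * (b ∘ X)|MeasurableSpace.comap X inferInstance] =ᵐ[P]
        P[a|MeasurableSpace.comap X inferInstance] * (b ∘ X) :=
      condExp_mul_of_stronglyMeasurable_right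
        (hbm.comp_measurable (comap_measurable X)) hab (hind _ hA')
    have hci := h (T ⁻¹' A) B ⟨A, hA, rfl⟩ hB
    rw [hb] at hci
    calc ∫ ω in X ⁻¹' C ∩ T ⁻¹' A, b (X ω) ∂P = ∫ ω in X ⁻¹' C, (a * (b ∘ X)) ω ∂P := by
          rw [← setIntegral_indicator hA']
          refine integral_congr_ae (Eventually.of_forall fun ω => ?_)
          by_cases hω : ω ∈ T ⁻¹' A <;> simp [a, hω]
      _ = ∫ ω in X ⁻¹' C, (P[a * (b ∘ X)|MeasurableSpace.comap X inferInstance]) ω ∂P :=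
          (setIntegral_condExp hm hab hC').symm
      _ = ∫ ω in X ⁻¹' C, (P⟦T ⁻¹' A ∩ B|MeasurableSpace.comap X inferInstance⟧) ω ∂P :=
          setIntegral_congr_ae (hm _ hC') ((hpull.trans hci.symm).mono fun ω hω _ => hω)
      _ = ∫ ω in X ⁻¹' C, (T ⁻¹' A ∩ B).indicator (fun _ => (1 : ℝ)) ω ∂P :=
          setIntegral_condExp hm (hind _ (hA'.inter hB')) hC'
      _ = P.real (X ⁻¹' C ∩ T ⁻¹' A ∩ B) := by
          rw [setIntegral_indicator (hA'.inter hB'), ← inter_assoc]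
          simp [Measure.real]
  have hmeas : (P.restrict B).map (fun ω => (X ω, T ω)) =
      (P.withDensity fun ω => ENNReal.ofReal (b (X ω))).map fun ω => (X ω, T ω) := by
    refine Measure.ext_prod fun {C A} hC hA => ?_
    have hCA : MeasurableSet (X ⁻¹' C ∩ T ⁻¹' A) := (hX hC).inter (hT hA)
    rw [Measure.map_apply hXT (hC.prod hA), Measure.map_apply hXT (hC.prod hA), mk_preimage_prod,
      Measure.restrict_apply hCA, withDensity_apply _ hCA]
    refine Eq.trans ?_ (ofReal_integral_eq_lintegral_ofReal hbint.integrableOn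
      (ae_restrict_of_ae hb0))
    rw [show ∫ ω in X ⁻¹' C ∩ T ⁻¹' A, b (X ω) ∂P = _ from hset C A hC hA, Measure.real, ENNReal.ofReal_toReal (measure_ne_top _ _)]
  intro φ hφ
  calc ∫⁻ ω in B, φ (X ω, T ω) ∂P = ∫⁻ p, φ p ∂((P.restrict B).map fun ω => (X ω, T ω)) :=
        (lintegral_map hφ hXT).symm
    _ = ∫⁻ ω, φ (X ω, T ω) ∂(P.withDensity fun ω => ENNReal.ofReal (b (X ω))) := by
        rw [hmeas, lintegral_map hφ hXT]
    _ = ∫⁻ ω, ENNReal.ofReal (b (X ω)) * φ (X ω, T ω) ∂P :=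
        lintegral_withDensity_eq_lintegral_mul P (hbE.comp hX) (hφ.comp hXT)
    _ = _ := lintegral_congr fun ω => mul_comm _ _

section Population

variable {Ω E : Type*} [mΩ : MeasurableSpace Ω] [MeasurableSpace E]
  {P : Measure Ω} {T : Ω → ℝ} {X : Ω → E} {Y : ℝ → Ω → ℝ}
  {fT : ℝ → ℝ} {fTX : ℝ → E → ℝ}

theorem IsTreatmentModel.outcomeSigma_le (h : IsTreatmentModel T X Y) : outcomeSigma Y ≤ mΩ :=
  iSup₂_le fun t ht => (h.measurable_Y t ht).comap_le

theorem AreDensities.measurable_stabWeight (h : AreDensities P T X fT fTX) :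
    Measurable fun p : E × ℝ => stabWeight fT fTX p.2 p.1 :=
  (h.measurable_fT.comp measurable_snd).div (h.measurable_fTX.comp measurable_swap)

variable [TopologicalSpace E]

theorem SupportOverlap.ae_mem_treatment (h : SupportOverlap P T X fT fTX) (hT : Measurable T) :
    ∀ᵐ ω ∂P, T ω ∈ Icc (0 : ℝ) 1 := by
  have := Measure.support_mem_ae (μ := P.map T)
  rw [h.support_T] at this
  exact ae_of_ae_map hT.aemeasurable this

variable [HereditarilyLindelofSpace E]

/-- Conditional independence replaces 1_B by b(X) with b(x) = P(B | X = x). Integrating over T given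
X = x, the conditional density cancels the denominator of the weight and leaves f_T, so the integral
over s no longer depends on x and the expectation factorises. -/
theorem SupportOverlap.lintegral_stabWeight_rectangle [IsProbabilityMeasure P]
    (h : SupportOverlap P T X fT fTX) (hmodel : IsTreatmentModel T X Y)
    (hdens : AreDensities P T X fT fTX) (hunc : Unconfounded P T X Y)
    {A : Set ℝ} (hA : MeasurableSet A) {B : Set Ω} (hB : MeasurableSet[outcomeSigma Y] B) :
    ∫⁻ ω in T ⁻¹' A ∩ B, ENNReal.ofReal (stabWeight fT fTX (T ω) (X ω)) ∂P =
      P (T ⁻¹' A) * P B := by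
  have hT := hmodel.measurable_T
  have hX := hmodel.measurable_X
  have hXT : Measurable fun ω => (X ω, T ω) := hX.prodMk hT
  obtain ⟨b, hbm, hb⟩ := CondIndepGiven.exists_density (P := P) hT hX hmodel.outcomeSigma_le hunc hB
  have hw : Measurable fun p : E × ℝ => ENNReal.ofReal (stabWeight fT fTX p.2 p.1) :=
    hdens.measurable_stabWeight.ennreal_ofReal
  have hPB : ∫⁻ x, b x ∂(P.map X) = P B := by
    have := hb (fun _ => 1) measurable_const
    simp only [lintegral_const, Measure.restrict_apply MeasurableSet.univ, univ_inter,
      one_mul] at this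
    rw [lintegral_map hbm hX, ← this]
  -- Overlap gives no information outside [0,1]; there both integrands vanish because the marginal
  -- density does, almost everywhere.
  have hfT : ∀ᵐ s : ℝ, s ∉ Icc (0 : ℝ) 1 → fT s = 0 := by
    have h0 : P.map T (Icc 0 1)ᶜ = 0 := by
      have := Measure.support_mem_ae (μ := P.map T)
      rwa [h.support_T] at this
    rw [hdens.density, withDensity_apply _ measurableSet_Icc.compl,
      lintegral_eq_zero_iff hdens.measurable_fT.ennreal_ofReal] at h0
    have := (ae_restrict_iff' measurableSet_Icc.compl).1 h0
    filter_upwards [this] with s hs hs'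
    exact le_antisymm (ENNReal.ofReal_eq_zero.1 (hs hs')) (hdens.nonneg_fT s)
  obtain ⟨η₁, η₂, hη, hover⟩ := h.overlap
  have hφ : Measurable fun p : E × ℝ =>
      (Prod.snd ⁻¹' A).indicator (fun p : E × ℝ => ENNReal.ofReal (stabWeight fT fTX p.2 p.1)) p :=
    hw.indicator (measurable_snd hA)
  have hinner : ∀ x ∈ (P.map X).support,
      ∫⁻ s, ENNReal.ofReal (fTX s x) * ((Prod.snd ⁻¹' A).indicator
        (fun p : E × ℝ => ENNReal.ofReal (stabWeight fT fTX p.2 p.1)) (x, s) * b x) =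
      P (T ⁻¹' A) * b x := by
    intro x hx
    have : ∀ᵐ s : ℝ, ENNReal.ofReal (fTX s x) * ((Prod.snd ⁻¹' A).indicator
        (fun p : E × ℝ => ENNReal.ofReal (stabWeight fT fTX p.2 p.1)) (x, s) * b x) =
        A.indicator (fun s => ENNReal.ofReal (fT s)) s * b x := by
      filter_upwards [hfT] with s hs
      by_cases hsA : s ∈ A
      · rw [indicator_of_mem (show (x, s) ∈ Prod.snd ⁻¹' A from hsA), indicator_of_mem hsA,
          ← mul_assoc, ← ENNReal.ofReal_mul (hdens.nonneg_fTX s x)]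
        congr 2
        by_cases hsI : s ∈ Icc (0 : ℝ) 1
        · have h1 := (hover s hsI x hx).1
          -- Division by zero returns 0, so a vanishing conditional density would give weight 0,
          -- contrary to the lower bound η₁ > 0.
          have h2 : fTX s x ≠ 0 := by
            intro h0
            rw [stabWeight, h0, div_zero] at h1
            linarith
          simp only [stabWeight]
          field_simp
        · simp [stabWeight, hs hsI]
      · rw [indicator_of_notMem (show (x, s) ∉ Prod.snd ⁻¹' A from hsA), indicator_of_notMem hsA]
        simp
    rw [lintegral_congr_ae this, lintegral_mul_const _
      (hdens.measurable_fT.ennreal_ofReal.indicator hA), lintegral_indicator hA,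
      ← withDensity_apply _ hA, ← hdens.density, Measure.map_apply hT hA]
  have : IsProbabilityMeasure (P.map X) := Measure.isProbabilityMeasure_map hX.aemeasurable
  have hdm : Measurable fun p : E × ℝ => ENNReal.ofReal (fTX p.2 p.1) :=
    (hdens.measurable_fTX.comp measurable_swap).ennreal_ofReal
  have hφb : Measurable fun p : E × ℝ => (Prod.snd ⁻¹' A).indicator
      (fun p : E × ℝ => ENNReal.ofReal (stabWeight fT fTX p.2 p.1)) p * b p.1 :=
    hφ.mul (hbm.comp measurable_fst)
  calc ∫⁻ ω in T ⁻¹' A ∩ B, ENNReal.ofReal (stabWeight fT fTX (T ω) (X ω)) ∂P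
      = ∫⁻ ω in B, (Prod.snd ⁻¹' A).indicator
        (fun p : E × ℝ => ENNReal.ofReal (stabWeight fT fTX p.2 p.1)) (X ω, T ω) ∂P := by
        rw [← setLIntegral_indicator (hT hA)]
        rfl
    _ = ∫⁻ ω, (Prod.snd ⁻¹' A).indicator
        (fun p : E × ℝ => ENNReal.ofReal (stabWeight fT fTX p.2 p.1)) (X ω, T ω) * b (X ω) ∂P :=
        hb _ hφ
    _ = ∫⁻ p, (Prod.snd ⁻¹' A).indicator
        (fun p : E × ℝ => ENNReal.ofReal (stabWeight fT fTX p.2 p.1)) p * b p.1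
          ∂(P.map fun ω => (X ω, T ω)) := (lintegral_map hφb hXT).symm
    _ = ∫⁻ x, (∫⁻ s, ENNReal.ofReal (fTX s x) * ((Prod.snd ⁻¹' A).indicator
        (fun p : E × ℝ => ENNReal.ofReal (stabWeight fT fTX p.2 p.1)) (x, s) * b x))
          ∂(P.map X) := by
        rw [hdens.cond_density, lintegral_withDensity_eq_lintegral_mul _ hdm hφb,
          lintegral_prod _ (hdm.mul hφb).aemeasurable]
        rfl
    _ = ∫⁻ x, P (T ⁻¹' A) * b x ∂(P.map X) :=
        lintegral_congr_ae (by
          filter_upwards [Measure.support_mem_ae (μ := P.map X)] with x hx using hinner x hx)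
    _ = _ := by rw [lintegral_const_mul _ hbm, hPB]

/-- The stabilised weight removes the confounding: for nonnegative measurable `g`,
`E[π₀(T,X) g(T) 1(Y(T) > z)] = ∫ g(s) P(Y(s) > z) dP_T(s)`. -/
theorem SupportOverlap.lintegral_stabWeight_mul [IsProbabilityMeasure P]
    (h : SupportOverlap P T X fT fTX) (hmodel : IsTreatmentModel T X Y)
    (hdens : AreDensities P T X fT fTX) (hunc : Unconfounded P T X Y)
    {g : ℝ → ℝ≥0∞} (hg : Measurable g) {D : Set ℝ} (hD : MeasurableSet D) :
    ∫⁻ ω, ENNReal.ofReal (stabWeight fT fTX (T ω) (X ω)) *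
        (g (T ω) * (observedOutcome T Y ⁻¹' D).indicator 1 ω) ∂P =
      ∫⁻ s, g s * P (Y s ⁻¹' D) ∂(P.map T) := by
  have hT := hmodel.measurable_T
  -- Joint measurability is available only over treatment levels in [0,1], hence a modification of T
  -- taking all its values there.
  set τ : Ω → Icc (0 : ℝ) 1 := fun ω => projIcc 0 1 zero_le_one (T ω) with hτdef
  have hproj : Measurable (projIcc (0 : ℝ) 1 zero_le_one) := continuous_projIcc.measurable
  have hτ : Measurable τ := hproj.comp hT
  have hτT : ∀ᵐ ω ∂P, (τ ω : ℝ) = T ω := by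
    filter_upwards [h.ae_mem_treatment hT] with ω hω
    rw [hτdef]
    exact congrArg Subtype.val (projIcc_of_mem zero_le_one hω)
  have hwm : Measurable fun ω => ENNReal.ofReal (stabWeight fT fTX (T ω) (X ω)) :=
    (hdens.measurable_stabWeight.comp (hmodel.measurable_X.prodMk hT)).ennreal_ofReal
  -- The whole outcome process is encoded as the identity map into the sample space with the coarser
  -- σ-algebra it generates, so rectangles are exactly the events covered by unconfoundedness.
  have hid : @Measurable Ω Ω mΩ (outcomeSigma Y) id :=
    measurable_id'' hmodel.outcomeSigma_le
  have hΦ : Measurable[MeasurableSpace.prod inferInstance (outcomeSigma Y)]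
      fun p : Icc (0 : ℝ) 1 × Ω => g p.1 * D.indicator (1 : ℝ → ℝ≥0∞) (Y p.1 p.2) := by
    refine Measurable.mul (m := MeasurableSpace.prod inferInstance (outcomeSigma Y)) ?_ ?_
    · exact (hg.comp measurable_subtype_coe).comp
        (@measurable_fst (Icc (0 : ℝ) 1) Ω _ (outcomeSigma Y))
    · exact (measurable_one.indicator hD).comp hmodel.measurable_joint
  have key := @lintegral_mul_eq_of_rectangles Ω Ω (Icc (0 : ℝ) 1) mΩ (outcomeSigma Y) _ P _ id hid
    τ hτ _ hwm (fun A B hA hB => by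
      have hA' : MeasurableSet (projIcc (0 : ℝ) 1 zero_le_one ⁻¹' A) := hproj hA
      exact h.lintegral_stabWeight_rectangle hmodel hdens hunc hA' hB) _ hΦ
  have hmap : P.map T = (P.map τ).map Subtype.val := by
    rw [Measure.map_map measurable_subtype_coe hτ]
    exact Measure.map_congr (hτT.mono fun ω hω => hω.symm)
  have hemb : MeasurableEmbedding (Subtype.val : Icc (0 : ℝ) 1 → ℝ) :=
    MeasurableEmbedding.subtype_coe measurableSet_Icc
  rw [hmap, hemb.lintegral_map]
  calc _ = ∫⁻ ω, ENNReal.ofReal (stabWeight fT fTX (T ω) (X ω)) *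
        (g (τ ω) * D.indicator (1 : ℝ → ℝ≥0∞) (Y (τ ω) (id ω))) ∂P := by
        refine lintegral_congr_ae (hτT.mono fun ω hω => ?_)
        simp only [hω, id]
        rfl
    _ = _ := key
    _ = _ := by
        refine lintegral_congr fun s => ?_
        have hm : MeasurableSet (Y s ⁻¹' D) := hmodel.measurable_Y s s.2 hD
        change ∫⁻ ω, g s * (D.indicator (1 : ℝ → ℝ≥0∞) ∘ Y s) ω ∂P = _
        rw [lintegral_const_mul _ ((measurable_one.indicator hD).comp
          (hmodel.measurable_Y s s.2)), ← lintegral_indicator_one hm]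
        rfl

end Population

/-! ## Survival functions near an intermediate quantile -/

/-- Extracts a real inequality from the extended-valued rate condition: a product tending to 0 is
eventually below 1, and each term of the supremum inherits the bound. -/
theorem tailOscillation_mul_le {S : ℝ → ℝ → ℝ} {t y h u v : ℝ} (hu : 0 ≤ u) (hy : 1 < y)
    (hlt : ENNReal.ofReal u * tailOscillation S t y h * ENNReal.ofReal v < 1)
    {z s : ℝ} (hz : y ≤ z) (hs : s ∈ Icc (0 : ℝ) 1) (hst : |s - t| ≤ h) :
    u * v * |Real.log (S s z / S t z)| ≤ Real.log z := by
  have hlog : 0 < Real.log z := Real.log_pos (hy.trans_le hz)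
  have h1 : ENNReal.ofReal (1 / Real.log z * |Real.log (S s z / S t z)|) ≤
      tailOscillation S t y h := by
    unfold tailOscillation
    exact le_iSup₂_of_le z hz (le_iSup₂_of_le s ⟨hs, hst⟩ le_rfl)
  have h2 : ENNReal.ofReal (u * (1 / Real.log z * |Real.log (S s z / S t z)|) * v) < 1 := by
    refine lt_of_le_of_lt ?_ hlt
    rw [ENNReal.ofReal_mul (by positivity), ENNReal.ofReal_mul hu]
    gcongr
  rw [← ENNReal.ofReal_one, ENNReal.ofReal_lt_ofReal_iff one_pos] at h2
  have h3 : u * (1 / Real.log z * |Real.log (S s z / S t z)|) * v =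
      u * v * |Real.log (S s z / S t z)| / Real.log z := by ring
  rw [h3, div_lt_one hlog] at h2
  exact h2.le

/-- Moving from q to q(1 ± η) changes log S_t by at least η/(4g), while passing from S_t to S_s
costs at most η/(8g); a net change of η/(8g) remains. The condition on log λ keeps the lower point
where S_t ≤ λa, the only region in which the oscillation is controlled: this is why λ > 1 is needed.
-/
theorem IsHeavyTailed.survival_window {St Ss : ℝ → ℝ} {g a η y₀ lam q : ℝ}
    (hT : IsHeavyTailed St g) (hs : ∀ y, 0 < Ss y)
    (hb : ∀ y z, y₀ ≤ y → y ≤ z →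
      1 / (2 * g) * Real.log (z / y) ≤ Real.log (St y) - Real.log (St z) ∧
      Real.log (St y) - Real.log (St z) ≤ 2 / g * Real.log (z / y))
    (hy₀ : 1 < y₀) (hSq : St q = a) (ha0 : 0 < a) (hη0 : 0 < η) (hη2 : η < 1 / 2)
    (hη8 : η < 8 * g) (hq0 : 2 * y₀ ≤ q) (hlam : 1 < lam)
    (hosc : ∀ z, St z ≤ lam * a → 0 < z → z ≤ 2 * q →
      |Real.log (Ss z) - Real.log (St z)| ≤ η / (8 * g))
    (hlam' : 2 / g * Real.log (1 / (1 - η)) + η / (8 * g) < Real.log lam)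
    (hlog2 : 2 / g * Real.log (1 / (1 - η)) + η / (8 * g) < Real.log 2) :
    Ss (q * (1 + η)) ≤ a * (1 - 1 / (16 * g) * η) ∧
      a * (1 + 1 / (16 * g) * η) ≤ Ss (q * (1 - η)) ∧ Ss (q * (1 - η)) ≤ 2 * a := by
  have hg : 0 < g := hT.index_pos
  have hqpos : 0 < q := by linarith
  have hqz : Real.log (St q) = Real.log (a) := by rw [hSq]
  -- the upper point
  have hle1 : q ≤ q * (1 + η) := by nlinarith
  have hz1 := (hb q (q * (1 + η)) (by linarith) hle1).1
  rw [mul_div_cancel_left₀ _ hqpos.ne', hqz] at hz1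
  have hla0 : 0 < lam * a := by positivity
  have ho1 := abs_le.1 (hosc (q * (1 + η))
    ((hT.anti hle1).trans (by rw [hSq]; nlinarith)) (by positivity) (by nlinarith))
  have hlog1 : η / 2 ≤ Real.log (1 + η) := by
    have := Real.one_sub_inv_le_log_of_pos (show 0 < 1 + η by linarith)
    have h2 : 1 - (1 + η)⁻¹ = η / (1 + η) := by field_simp; ring
    rw [h2] at this
    refine le_trans ?_ this
    gcongr
    linarith
  have hlow1 : Real.log (Ss (q * (1 + η))) ≤ Real.log (a) - η / (8 * g) := by
    have : 1 / (2 * g) * (η / 2) ≤ 1 / (2 * g) * Real.log (1 + η) := by gcongr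
    have h4 : 1 / (2 * g) * (η / 2) = 2 * (η / (8 * g)) := by field_simp; ring
    linarith [ho1.2]
  -- the lower point
  have hpos2 : 0 < 1 - η := by linarith
  have hle2 : q * (1 - η) ≤ q := by nlinarith
  have hz2 := hb (q * (1 - η)) q (by nlinarith) hle2
  have hdiv : q / (q * (1 - η)) = 1 / (1 - η) := by field_simp
  rw [hdiv, hqz] at hz2
  have hx0 : 0 < η / (8 * g) := by positivity
  have hS2 : St (q * (1 - η)) ≤ lam * a := by
    rw [← Real.log_le_log_iff (hT.pos _) hla0, Real.log_mul (by positivity) ha0.ne']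
    linarith [hz2.2]
  have ho2 := abs_le.1 (hosc (q * (1 - η)) hS2 (by positivity) (by nlinarith))
  have hlog2' : η ≤ Real.log (1 / (1 - η)) := by
    rw [one_div, Real.log_inv]
    linarith [Real.log_le_sub_one_of_pos hpos2]
  have hlow2 : Real.log (a) + η / (8 * g) ≤ Real.log (Ss (q * (1 - η))) := by
    have : 1 / (2 * g) * η ≤ 1 / (2 * g) * Real.log (1 / (1 - η)) := by gcongr
    have h4 : 1 / (2 * g) * η = 4 * (η / (8 * g)) := by field_simp; ring
    linarith [ho2.1, hz2.1]
  have hup2 : Real.log (Ss (q * (1 - η))) ≤ Real.log (2 * a) := by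
    rw [Real.log_mul (by norm_num) ha0.ne']
    linarith [ho2.2, hz2.2]
  -- Half of the exponent x = η/(8g) is given up in linearising: exp(-x) ≤ 1 - x/2 for 0 ≤ x ≤ 1.
  have hc : 1 / (16 * g) * η = η / (8 * g) / 2 := by field_simp; ring
  have hx1 : η / (8 * g) ≤ 1 := by rw [div_le_one (by positivity)]; exact hη8.le
  rw [hc]
  set x := η / (8 * g)
  refine ⟨?_, ?_, ?_⟩
  · rw [Real.log_le_iff_le_exp (hs _), Real.exp_sub, Real.exp_log ha0] at hlow1
    refine hlow1.trans ?_
    rw [div_eq_mul_inv]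
    gcongr
    rw [inv_le_comm₀ (Real.exp_pos _) (by linarith)]
    refine le_trans ?_ (Real.add_one_le_exp x)
    rw [inv_le_iff_one_le_mul₀ (by linarith)]
    nlinarith
  · rw [Real.le_log_iff_exp_le (hs _), Real.exp_add, Real.exp_log ha0] at hlow2
    refine le_trans ?_ hlow2
    gcongr
    linarith [Real.add_one_le_exp x]
  · exact (Real.log_le_log_iff (hs _) (by positivity)).1 hup2

theorem exists_survival_window {S : ℝ → ℝ → ℝ} {γ : ℝ → ℝ}
    (hS : ∀ s ∈ Icc (0 : ℝ) 1, IsHeavyTailed (S s) (γ s)) {t : ℝ} (ht : t ∈ Icc (0 : ℝ) 1)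
    {ι : Type*} {l : Filter ι} {a u h η : ι → ℝ} (ha : Tendsto a l (𝓝 0))
    (hapos : ∀ᶠ i in l, 0 < a i) (hη : Tendsto η l (𝓝 0)) (hηpos : ∀ᶠ i in l, 0 < η i)
    (hu : ∀ i, 0 ≤ u i) (huη : Tendsto (fun i => u i * η i) l atTop) {lam : ℝ} (hlam : 1 < lam)
    (hosc : Tendsto (fun i => ENNReal.ofReal (u i) *
      tailOscillation S t (survivalQuantile (S t) (1 - lam * a i)) (h i) *
        ENNReal.ofReal |Real.log (a i)|) l (𝓝 0)) :
    ∃ c : ℝ, 0 < c ∧ ∀ᶠ i in l, ∀ s ∈ Icc (0 : ℝ) 1, |s - t| ≤ h i →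
      S s (survivalQuantile (S t) (1 - a i) * (1 + η i)) ≤ a i * (1 - c * η i) ∧
      a i * (1 + c * η i) ≤ S s (survivalQuantile (S t) (1 - a i) * (1 - η i)) ∧
      S s (survivalQuantile (S t) (1 - a i) * (1 - η i)) ≤ 2 * a i := by
  have hT := hS t ht
  set g := γ t with hgdef
  have hg : 0 < g := hT.index_pos
  obtain ⟨y₀, hy₀, hb⟩ := hT.log_div_bounds
  have hQ : Tendsto (fun i => survivalQuantile (S t) (1 - a i)) l atTop :=
    hT.tendsto_quantile ha hapos
  have hla : Tendsto (fun i => lam * a i) l (𝓝 0) := by simpa using ha.const_mul lam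
  have hlapos : ∀ᶠ i in l, 0 < lam * a i := hapos.mono fun i hi => by positivity
  have hQl : Tendsto (fun i => survivalQuantile (S t) (1 - lam * a i)) l atTop :=
    hT.tendsto_quantile hla hlapos
  have hlogη : Tendsto (fun i => 2 / g * Real.log (1 / (1 - η i)) + η i / (8 * g)) l (𝓝 0) := by
    have h1 : Tendsto (fun i => 1 / (1 - η i)) l (𝓝 1) := by
      have := (tendsto_const_nhds (x := (1 : ℝ))).div (hη.const_sub 1) (by norm_num)
      rw [sub_zero, div_one] at this
      exact this
    have h2 := ((h1.log one_ne_zero).const_mul (2 / g)).add (hη.div_const (8 * g))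
    simpa using h2
  refine ⟨1 / (16 * g), by positivity, ?_⟩
  filter_upwards [hapos, hηpos, ha.eventually_lt_const one_pos, hla.eventually_lt_const one_pos,
    hlapos, hη.eventually_lt_const (show (0 : ℝ) < 1 / 2 by norm_num),
    hη.eventually_lt_const (show (0 : ℝ) < 8 * g by positivity),
    hQ.eventually_ge_atTop (2 * y₀), hQ.eventually hT.log_le_abs_log,
    hQ.eventually_ge_atTop 2, hQl.eventually_gt_atTop 1,
    hosc.eventually_lt_const one_pos, huη.eventually_ge_atTop (64 * g ^ 2),
    hlogη.eventually_lt_const (Real.log_pos hlam),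
    hlogη.eventually_lt_const (Real.log_pos one_lt_two)]
    with i ha0 hη0 ha1 hla1 hla0 hη2 hη8 hq0 hqlog hq2 hql1 hosc1 hui hlam' hlog2 s hs hst
  set q := survivalQuantile (S t) (1 - a i) with hqdef
  have hSq : S t q = a i := hT.apply_quantile ⟨ha0, ha1⟩
  have hqpos : 0 < q := by linarith
  have hup : 0 < u i := by
    rcases (hu i).eq_or_lt with h0 | h0
    · rw [← h0, zero_mul] at hui
      nlinarith [sq_pos_of_pos hg]
    · exact h0
  have hloga : 0 < |Real.log (a i)| := abs_pos.2 (Real.log_neg ha0 ha1).ne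
  have hlogq : Real.log q ≤ 4 * g * |Real.log (a i)| := by
    rw [hSq, one_div, inv_mul_eq_div, div_le_iff₀ (by positivity)] at hqlog
    linarith
  have hlogq0 : Real.log 2 ≤ Real.log q := Real.log_le_log (by norm_num) hq2
  -- The log-ratio is at most log z / (u |log a|), and log z ≤ 2 log q ≤ 8g |log a|, so it is at
  -- most 8g/u. The threshold uη ≥ 64g² makes this at most η/(8g).
  have hosc2 : ∀ z, survivalQuantile (S t) (1 - lam * a i) ≤ z → 0 < z → z ≤ 2 * q →
      |Real.log (S s z) - Real.log (S t z)| ≤ η i / (8 * g) := by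
    intro z hz hz0 hzq
    have h1 := tailOscillation_mul_le hup.le hql1 hosc1 hz hs hst
    rw [Real.log_div ((hS s hs).pos z).ne' (hT.pos z).ne'] at h1
    have h2 : Real.log z ≤ 8 * g * |Real.log (a i)| := by
      have : Real.log z ≤ Real.log 2 + Real.log q := by
        rw [← Real.log_mul (by norm_num) hqpos.ne']
        exact Real.log_le_log hz0 hzq
      linarith
    have h3 : u i * |Real.log (S s z) - Real.log (S t z)| ≤ 8 * g := by
      refine le_of_mul_le_mul_right ?_ hloga
      linarith
    rw [le_div_iff₀ (by positivity)]
    refine le_of_mul_le_mul_left ?_ hup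
    nlinarith
  exact hT.survival_window (hS s hs).pos hb hy₀ hSq ha0 hη0 hη2 hη8 hq0 hlam
    (fun z hz => hosc2 z ((hT.quantile_le_iff ⟨hla0, hla1⟩ z).2 hz)) hlam' hlog2

/-! ## Inverting the estimated survival function -/

/-- If the weighted exceedance sum is positive at `z₁` and negative at `z₂`, then the estimated
quantile lies in `[z₁, z₂]`. -/
theorem quantileEst_mem_Icc {E : Type*} {K : ℝ → ℝ} {N : ℕ} {w : ℝ → E → ℝ} {Ts : ℕ → ℝ}
    {Xs : ℕ → E} {Ys : ℕ → ℝ} {h t a z₁ z₂ : ℝ} (hK : ∀ u, 0 ≤ K u)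
    (hw : ∀ i < N, 0 < w (Ts i) (Xs i))
    (h₁ : 0 < ∑ i ∈ Finset.range N, w (Ts i) (Xs i) * K ((Ts i - t) / h) *
      ((Ioi z₁).indicator 1 (Ys i) - a))
    (h₂ : ∑ i ∈ Finset.range N, w (Ts i) (Xs i) * K ((Ts i - t) / h) *
      ((Ioi z₂).indicator 1 (Ys i) - a) < 0) :
    quantileEst K N w Ts Xs Ys h t (1 - a) ∈ Icc z₁ z₂ := by
  classical
  set c : ℕ → ℝ := fun i => w (Ts i) (Xs i) * K ((Ts i - t) / h) with hc
  have hc0 : ∀ i ∈ Finset.range N, 0 ≤ c i := fun i hi =>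
    mul_nonneg (hw i (Finset.mem_range.1 hi)).le (hK _)
  set W := ∑ i ∈ Finset.range N, c i with hW
  set num : ℝ → ℝ := fun z => ∑ i ∈ Finset.range N, c i * (Ioi z).indicator 1 (Ys i) with hnum
  have hsum : ∀ z, ∑ i ∈ Finset.range N, c i * ((Ioi z).indicator 1 (Ys i) - a) =
      num z - a * W := by
    intro z
    rw [hnum, hW, Finset.mul_sum, ← Finset.sum_sub_distrib]
    exact Finset.sum_congr rfl fun i _ => by ring
  have hest : ∀ z, survivalEst K N w Ts Xs Ys h t z = num z / W := by
    intro z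
    unfold survivalEst
    congr 1
    refine Finset.sum_congr rfl fun i _ => ?_
    by_cases hz : z < Ys i
    · simp [hc, hz]
    · simp [hc, hz]
  have hle : ∀ z, num z ≤ W := fun z => Finset.sum_le_sum fun i hi =>
    mul_le_of_le_one_right (hc0 i hi) (indicator_le_self' (fun _ _ => zero_le_one) _)
  have hanti : Antitone num := fun z z' hzz => Finset.sum_le_sum fun i hi =>
    mul_le_mul_of_nonneg_left (indicator_le_indicator_of_subset (Ioi_subset_Ioi hzz)
      (fun _ => zero_le_one) _) (hc0 i hi)
  rw [hsum] at h₁ h₂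
  -- The denominator of the estimator is positive because of the strict inequality at `z₁`: if all
  -- kernel weights vanished, the score sum would be 0.
  have hWpos : 0 < W := by
    rcases (Finset.sum_nonneg hc0).eq_or_lt with h0 | h0
    · have := hle z₁
      rw [hW, ← h0] at this h₁
      linarith
    · exact h0
  have hmem : ∀ z, survivalEst K N w Ts Xs Ys h t z ≤ 1 - (1 - a) ↔ num z ≤ a * W := by
    intro z
    rw [hest, sub_sub_cancel, div_le_iff₀ hWpos]
  have hlow : ∀ z, survivalEst K N w Ts Xs Ys h t z ≤ 1 - (1 - a) → z₁ ≤ z := by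
    intro z hz
    by_contra! hlt
    linarith [hanti hlt.le, (hmem z).1 hz]
  have hz₂ : survivalEst K N w Ts Xs Ys h t z₂ ≤ 1 - (1 - a) := (hmem z₂).2 (by linarith)
  exact ⟨le_csInf ⟨z₂, hz₂⟩ hlow, csInf_le ⟨z₁, hlow⟩ hz₂⟩

/-! ## Survival functions of real random variables -/

section Survival

variable {Ω : Type*} [MeasurableSpace Ω] {P : Measure Ω} [IsProbabilityMeasure P]
  {Y : ℝ → Ω → ℝ} {s : ℝ}

theorem one_sub_cdf_le_survival (hY : Measurable (Y s)) (y : ℝ) :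
    1 - cdf (P.map (Y s)) y ≤ survival P Y s y := by
  have : IsProbabilityMeasure (P.map (Y s)) := Measure.isProbabilityMeasure_map hY.aemeasurable
  rw [cdf_eq_real, ← probReal_compl_eq_one_sub measurableSet_Iic,
    map_measureReal_apply hY measurableSet_Iic.compl]
  refine measureReal_mono fun ω hω => ?_
  simp only [mem_preimage, mem_compl_iff, mem_Iic, not_le] at hω
  exact hω.le

theorem survival_le_one_sub_cdf (hY : Measurable (Y s)) {x y : ℝ} (hxy : x < y) :
    survival P Y s y ≤ 1 - cdf (P.map (Y s)) x := by
  have : IsProbabilityMeasure (P.map (Y s)) := Measure.isProbabilityMeasure_map hY.aemeasurable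
  rw [cdf_eq_real, ← probReal_compl_eq_one_sub measurableSet_Iic,
    map_measureReal_apply hY measurableSet_Iic.compl]
  refine measureReal_mono fun ω hω => ?_
  simp only [mem_preimage, mem_compl_iff, mem_Iic, not_le]
  exact hxy.trans_le hω

theorem survival_antitone : Antitone (survival P Y s) := fun _ _ hxy =>
  measureReal_mono fun _ hω => hxy.trans hω

/-- The estimator counts Y > z while the survival function uses Y ≥ z; continuity rules out the atom
that would separate them. -/
theorem measure_preimage_Ioi_eq_survival (hY : Measurable (Y s))
    (hc : Continuous (survival P Y s)) (z : ℝ) :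
    P (Y s ⁻¹' Ioi z) = ENNReal.ofReal (survival P Y s z) := by
  have : IsProbabilityMeasure (P.map (Y s)) := Measure.isProbabilityMeasure_map hY.aemeasurable
  have h1 : P.real (Y s ⁻¹' Ioi z) = 1 - cdf (P.map (Y s)) z := by
    rw [cdf_eq_real, ← probReal_compl_eq_one_sub measurableSet_Iic, compl_Iic,
      map_measureReal_apply hY measurableSet_Ioi]
  have h2 : survival P Y s z = 1 - cdf (P.map (Y s)) z := by
    refine le_antisymm ?_ (one_sub_cdf_le_survival hY z)
    refine le_of_tendsto ((hc.tendsto z).mono_left (nhdsWithin_le_nhds (s := Ioi z))) ?_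
    exact eventually_mem_nhdsWithin.mono fun y hy => survival_le_one_sub_cdf hY hy
  rw [h2, ← h1, Measure.real, ENNReal.ofReal_toReal (measure_ne_top _ _)]

theorem HeavyTail.isHeavyTailed {γ : ℝ → ℝ} (h : HeavyTail (survival P Y) γ)
    (hs : s ∈ Icc (0 : ℝ) 1) (hY : Measurable (Y s)) :
    IsHeavyTailed (survival P Y s) (γ s) where
  anti := survival_antitone
  nonneg _ := measureReal_nonneg
  tendsto_top := by
    -- The shift by one absorbs a possible atom at y in P(Y ≥ y).
    have h1 : Tendsto (fun y : ℝ => 1 - cdf (P.map (Y s)) (y - 1)) atTop (𝓝 0) := by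
      have := ((tendsto_cdf_atTop (P.map (Y s))).comp
        (tendsto_atTop_add_const_right atTop (-1 : ℝ) tendsto_id)).const_sub 1
      simpa [sub_eq_add_neg] using this
    exact squeeze_zero (fun _ => measureReal_nonneg)
      (fun y => survival_le_one_sub_cdf hY (sub_one_lt y)) h1
  tendsto_bot := by
    have h1 := (tendsto_cdf_atBot (P.map (Y s))).const_sub 1
    rw [sub_zero] at h1
    exact tendsto_of_tendsto_of_tendsto_of_le_of_le h1 tendsto_const_nhds
      (one_sub_cdf_le_survival hY) fun _ => measureReal_le_one
  smooth := h.smooth_y s hs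
  index_pos := h.pos s hs
  tail := h.tail s hs

end Survival

/-! ## Moments of the smoothed exceedance scores -/

/-- For t at an endpoint of [0,1] only one side of the smoothing window carries treatments; symmetry
guarantees that this side retains half of the kernel mass. -/
theorem IsSmoothingKernel.integral_half {K : ℝ → ℝ} (hK : IsSmoothingKernel K) :
    ∫ u in (0 : ℝ)..1, K u = 1 / 2 ∧ ∫ u in (-1 : ℝ)..0, K u = 1 / 2 := by
  have hint : Integrable K := by
    by_contra hn
    have := hK.integral_eq_one
    rw [integral_undef hn] at this
    norm_num at this
  have h1 : ∫ u in (-1 : ℝ)..0, K u = ∫ u in (0 : ℝ)..1, K u := by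
    have := intervalIntegral.integral_comp_neg (a := 0) (b := 1) K
    simp only [hK.symm, neg_zero] at this
    exact this.symm
  have h2 : (∫ u in (-1 : ℝ)..0, K u) + ∫ u in (0 : ℝ)..1, K u = 1 := by
    rw [intervalIntegral.integral_add_adjacent_intervals hint.intervalIntegrable
      hint.intervalIntegrable, intervalIntegral.integral_of_le (by norm_num),
      ← integral_Icc_eq_integral_Ioc]
    refine Eq.trans ?_ hK.integral_eq_one
    exact setIntegral_eq_integral_of_forall_compl_eq_zero fun x hx =>
      Function.notMem_support.1 fun hx' => hx (hK.support_subset hx')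
  constructor <;> linarith

/-- Score `w(t',x) K((t'-t)/h) (1(y > z) - a)` of an observation `(t',x,y)`. -/
noncomputable def exceedScore {E : Type*} (w : ℝ → E → ℝ) (K : ℝ → ℝ) (t h z a : ℝ)
    (p : ℝ × E × ℝ) : ℝ :=
  w p.1 p.2.1 * K ((p.1 - t) / h) * ((Ioi z).indicator 1 p.2.2 - a)

/-- Mass `K((t'-t)/h) (1(y > z) + a)` of an observation `(t',x,y)`. -/
noncomputable def exceedMass {E : Type*} (K : ℝ → ℝ) (t h z a : ℝ) (p : ℝ × E × ℝ) : ℝ :=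
  K ((p.1 - t) / h) * ((Ioi z).indicator 1 p.2.2 + a)

section Moments

variable {Ω E : Type*} [MeasurableSpace Ω] [MeasurableSpace E] {P : Measure Ω}
  {T : Ω → ℝ} {X : Ω → E} {Y : ℝ → Ω → ℝ} {fT : ℝ → ℝ} {fTX : ℝ → E → ℝ} {K : ℝ → ℝ} {t h : ℝ}

/-- The smoothed mass of the treatment near `t` is at least of the order of the bandwidth. -/
theorem AreDensities.le_integral_kernel [IsProbabilityMeasure P] (hdens : AreDensities P T X fT fTX) (hT : Measurable T)
    (hK : IsSmoothingKernel K) {η : ℝ} (hfT : ∀ s ∈ Icc (0 : ℝ) 1, η ≤ fT s)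
    (ht : t ∈ Icc (0 : ℝ) 1) (hh : 0 < h) (hh2 : h ≤ 1 / 2) :
    η * h / 2 ≤ ∫ ω, K ((T ω - t) / h) ∂P := by
  obtain ⟨C, hC⟩ := hK.bounded
  have hKm : Measurable fun s => K ((s - t) / h) :=
    hK.measurable.comp ((measurable_id.sub_const t).div_const h)
  have e1 : ∫ ω, K ((T ω - t) / h) ∂P = ∫ s, fT s * K ((s - t) / h) := by
    rw [← integral_map (f := fun s => K ((s - t) / h)) hT.aemeasurable hKm.aestronglyMeasurable,
      hdens.density, integral_withDensity_eq_integral_toReal_smul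
      hdens.measurable_fT.ennreal_ofReal (Eventually.of_forall fun _ => ENNReal.ofReal_lt_top)]
    simp only [ENNReal.toReal_ofReal (hdens.nonneg_fT _), smul_eq_mul]
  have : IsProbabilityMeasure (P.map T) := Measure.isProbabilityMeasure_map hT.aemeasurable
  have hfint : Integrable fT := by
    refine ⟨hdens.measurable_fT.aestronglyMeasurable, ?_⟩
    rw [hasFiniteIntegral_iff_ofReal (Eventually.of_forall hdens.nonneg_fT),
      ← setLIntegral_univ, ← withDensity_apply _ MeasurableSet.univ, ← hdens.density]
    exact measure_lt_top _ _
  have hint : Integrable fun s => fT s * K ((s - t) / h) :=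
    hfint.mul_bdd (c := C) hKm.aestronglyMeasurable (Eventually.of_forall fun s => by
      rw [Real.norm_eq_abs, abs_of_nonneg (hK.nonneg _)]; exact hC _)
  have key : ∀ a b : ℝ, a ≤ b → Icc a b ⊆ Icc 0 1 →
      η * (h * ∫ u in ((a - t) / h)..((b - t) / h), K u) ≤ ∫ ω, K ((T ω - t) / h) ∂P := by
    intro a b hab hsub
    have e2 : ∫ s in a..b, K ((s - t) / h) = h * ∫ u in ((a - t) / h)..((b - t) / h), K u := by
      have := intervalIntegral.integral_comp_div_sub (a := a) (b := b) K hh.ne' (t / h)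
      simp only [← sub_div, smul_eq_mul] at this
      exact this
    rw [e1, ← e2, ← intervalIntegral.integral_const_mul, intervalIntegral.integral_of_le hab]
    have hKint : IntegrableOn (fun s => η * K ((s - t) / h)) (Ioc a b) := by
      refine Integrable.const_mul ?_ _
      exact Measure.integrableOn_of_bounded (M := C) (by simp) hKm.aestronglyMeasurable
        (Eventually.of_forall fun s => by
          rw [Real.norm_eq_abs, abs_of_nonneg (hK.nonneg _)]; exact hC _)
    calc ∫ s in Ioc a b, η * K ((s - t) / h) ≤ ∫ s in Ioc a b, fT s * K ((s - t) / h) :=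
          setIntegral_mono_on hKint hint.integrableOn measurableSet_Ioc fun s hs =>
            mul_le_mul_of_nonneg_right (hfT s (hsub (Ioc_subset_Icc_self hs))) (hK.nonneg _)
      _ ≤ ∫ s, fT s * K ((s - t) / h) :=
          setIntegral_le_integral hint (Eventually.of_forall fun s =>
            mul_nonneg (hdens.nonneg_fT s) (hK.nonneg _))
  -- As h ≤ 1/2, the half-window pointing towards the interior of [0,1] is contained in it.
  rcases le_total t (1 / 2) with hle | hle
  · have := key t (t + h) (by linarith) (Icc_subset_Icc ht.1 (by linarith))
    rw [sub_self, zero_div, add_sub_cancel_left, div_self hh.ne', hK.integral_half.1] at this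
    linarith
  · have := key (t - h) t (by linarith) (Icc_subset_Icc (by linarith) ht.2)
    rw [sub_self, zero_div, sub_sub_cancel_left, neg_div, div_self hh.ne',
      hK.integral_half.2] at this
    linarith

theorem IsSmoothingKernel.lintegral_mul_const [IsProbabilityMeasure P]
    (hK : IsSmoothingKernel K) (hT : Measurable T) {b : ℝ} (hb : 0 ≤ b) :
    ∫⁻ s, ENNReal.ofReal (K ((s - t) / h)) * ENNReal.ofReal b ∂(P.map T) =
      ENNReal.ofReal (b * ∫ ω, K ((T ω - t) / h) ∂P) := by
  obtain ⟨C, hC⟩ := hK.bounded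
  have hKm : Measurable fun s => K ((s - t) / h) :=
    hK.measurable.comp ((measurable_id.sub_const t).div_const h)
  have hint : Integrable (fun ω => K ((T ω - t) / h)) P :=
    Integrable.of_bound (hKm.comp hT).aestronglyMeasurable C (Eventually.of_forall fun s => by
          rw [Real.norm_eq_abs, abs_of_nonneg (hK.nonneg _)]; exact hC _)
  rw [MeasureTheory.lintegral_mul_const _ hKm.ennreal_ofReal, lintegral_map hKm.ennreal_ofReal hT,
    ENNReal.ofReal_mul hb, ofReal_integral_eq_lintegral_ofReal hint
      (Eventually.of_forall fun ω => hK.nonneg _), mul_comm]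

theorem IsSmoothingKernel.apply_eq_zero (hK : IsSmoothingKernel K) (hh : 0 < h) {s : ℝ}
    (hs : ¬ |s - t| ≤ h) : K ((s - t) / h) = 0 := by
  refine Function.notMem_support.1 fun hmem => hs ?_
  have := hK.support_subset hmem
  rw [mem_Icc, ← abs_le, abs_div, abs_of_pos hh, div_le_one hh] at this
  exact this

variable [TopologicalSpace E] [HereditarilyLindelofSpace E]

theorem SupportOverlap.ae_stabWeight_mem (hsupp : SupportOverlap P T X fT fTX)
    (hT : Measurable T) (hX : Measurable X) {η₁ η₂ : ℝ}
    (hη : ∀ t ∈ Icc (0 : ℝ) 1, ∀ x ∈ (P.map X).support,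
      η₁ ≤ stabWeight fT fTX t x ∧ stabWeight fT fTX t x ≤ η₂) :
    ∀ᵐ ω ∂P, stabWeight fT fTX (T ω) (X ω) ∈ Icc η₁ η₂ := by
  filter_upwards [hsupp.ae_mem_treatment hT,
    ae_of_ae_map hX.aemeasurable (Measure.support_mem_ae (μ := P.map X))] with ω h1 h2
  exact hη _ h1 _ h2

variable [IsProbabilityMeasure P]

theorem SupportOverlap.integrable_stabWeight_kernel (hsupp : SupportOverlap P T X fT fTX)
    (hmodel : IsTreatmentModel T X Y) (hdens : AreDensities P T X fT fTX)
    (hK : IsSmoothingKernel K) {D : Set ℝ} (hD : MeasurableSet D)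
    (hY : AEMeasurable (observedOutcome T Y) P) :
    Integrable (fun ω => stabWeight fT fTX (T ω) (X ω) * (K ((T ω - t) / h) *
      D.indicator 1 (observedOutcome T Y ω))) P := by
  obtain ⟨C, hC⟩ := hK.bounded
  obtain ⟨η₁, η₂, hη, hover⟩ := hsupp.overlap
  have hw : Measurable fun ω => stabWeight fT fTX (T ω) (X ω) :=
    hdens.measurable_stabWeight.comp (hmodel.measurable_X.prodMk hmodel.measurable_T)
  have hKm : Measurable fun ω => K ((T ω - t) / h) :=
    hK.measurable.comp ((hmodel.measurable_T.sub_const t).div_const h)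
  have hI : AEMeasurable (fun ω => D.indicator (1 : ℝ → ℝ) (observedOutcome T Y ω)) P :=
    (measurable_one.indicator hD).comp_aemeasurable hY
  refine Integrable.of_bound
    (hw.aemeasurable.mul (hKm.aemeasurable.mul hI)).aestronglyMeasurable (η₂ * (C * 1)) ?_
  filter_upwards [hsupp.ae_stabWeight_mem hmodel.measurable_T hmodel.measurable_X hover] with ω hω
  have hI0 : 0 ≤ D.indicator (1 : ℝ → ℝ) (observedOutcome T Y ω) :=
    indicator_nonneg (fun _ _ => zero_le_one) _
  have hI1 : D.indicator (1 : ℝ → ℝ) (observedOutcome T Y ω) ≤ 1 :=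
    indicator_le_self' (fun _ _ => zero_le_one) _
  have hw0 : 0 ≤ stabWeight fT fTX (T ω) (X ω) := hη.le.trans hω.1
  have hC0 : 0 ≤ C := (hK.nonneg 0).trans (hC 0)
  rw [Real.norm_eq_abs, abs_of_nonneg (mul_nonneg hw0 (mul_nonneg (hK.nonneg _) hI0))]
  exact mul_le_mul hω.2 (mul_le_mul (hC _) hI1 hI0 hC0) (mul_nonneg (hK.nonneg _) hI0)
    (hw0.trans hω.2)

theorem SupportOverlap.ofReal_integral_stabWeight_kernel (hsupp : SupportOverlap P T X fT fTX)
    (hmodel : IsTreatmentModel T X Y) (hdens : AreDensities P T X fT fTX)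
    (hunc : Unconfounded P T X Y) (hK : IsSmoothingKernel K) {D : Set ℝ} (hD : MeasurableSet D)
    (hY : AEMeasurable (observedOutcome T Y) P) :
    ENNReal.ofReal (∫ ω, stabWeight fT fTX (T ω) (X ω) * (K ((T ω - t) / h) *
      D.indicator 1 (observedOutcome T Y ω)) ∂P) =
    ∫⁻ s, ENNReal.ofReal (K ((s - t) / h)) * P (Y s ⁻¹' D) ∂(P.map T) := by
  obtain ⟨η₁, η₂, hη, hover⟩ := hsupp.overlap
  have hae := hsupp.ae_stabWeight_mem hmodel.measurable_T hmodel.measurable_X hover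
  have hKm : Measurable fun s => ENNReal.ofReal (K ((s - t) / h)) :=
    (hK.measurable.comp ((measurable_id.sub_const t).div_const h)).ennreal_ofReal
  rw [ofReal_integral_eq_lintegral_ofReal
    (hsupp.integrable_stabWeight_kernel hmodel hdens hK hD hY)
    (hae.mono fun ω hω => mul_nonneg (hη.le.trans hω.1)
      (mul_nonneg (hK.nonneg _) (indicator_nonneg (fun _ _ => zero_le_one) _))),
    ← hsupp.lintegral_stabWeight_mul hmodel hdens hunc hKm hD]
  refine lintegral_congr_ae (hae.mono fun ω hω => ?_)
  simp only
  rw [ENNReal.ofReal_mul (hη.le.trans hω.1), ENNReal.ofReal_mul (hK.nonneg _)]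
  congr 2
  by_cases hω' : observedOutcome T Y ω ∈ D
  · rw [indicator_of_mem hω', indicator_of_mem (show ω ∈ observedOutcome T Y ⁻¹' D from hω')]
    simp
  · rw [indicator_of_notMem hω',
      indicator_of_notMem (show ω ∉ observedOutcome T Y ⁻¹' D from hω')]
    simp

/-- After removal of confounding the left side is an average of P(Y(s) ∈ D) against K((s-t)/h)
dP_T(s). The kernel vanishes unless |s - t| ≤ h, so a local bound on those probabilities is enough.
-/
theorem SupportOverlap.integral_stabWeight_kernel_le (hsupp : SupportOverlap P T X fT fTX)
    (hmodel : IsTreatmentModel T X Y) (hdens : AreDensities P T X fT fTX)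
    (hunc : Unconfounded P T X Y) (hK : IsSmoothingKernel K) {D : Set ℝ} (hD : MeasurableSet D)
    (hY : AEMeasurable (observedOutcome T Y) P) (hh : 0 < h) {b : ℝ} (hb : 0 ≤ b)
    (hbD : ∀ s ∈ Icc (0 : ℝ) 1, |s - t| ≤ h → P (Y s ⁻¹' D) ≤ ENNReal.ofReal b) :
    ∫ ω, stabWeight fT fTX (T ω) (X ω) * (K ((T ω - t) / h) *
      D.indicator 1 (observedOutcome T Y ω)) ∂P ≤ b * ∫ ω, K ((T ω - t) / h) ∂P := by
  rw [← ENNReal.ofReal_le_ofReal_iff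
    (mul_nonneg hb (integral_nonneg fun ω => hK.nonneg _)),
    hsupp.ofReal_integral_stabWeight_kernel hmodel hdens hunc hK hD hY,
    ← hK.lintegral_mul_const hmodel.measurable_T hb]
  refine lintegral_mono_ae ?_
  have := Measure.support_mem_ae (μ := P.map T)
  rw [hsupp.support_T] at this
  filter_upwards [this] with s hs
  by_cases hst : |s - t| ≤ h
  · gcongr
    exact hbD s hs hst
  · simp [hK.apply_eq_zero hh hst]

theorem SupportOverlap.le_integral_stabWeight_kernel (hsupp : SupportOverlap P T X fT fTX)
    (hmodel : IsTreatmentModel T X Y) (hdens : AreDensities P T X fT fTX)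
    (hunc : Unconfounded P T X Y) (hK : IsSmoothingKernel K) {D : Set ℝ} (hD : MeasurableSet D)
    (hY : AEMeasurable (observedOutcome T Y) P) (hh : 0 < h) {b : ℝ} (hb : 0 ≤ b)
    (hbD : ∀ s ∈ Icc (0 : ℝ) 1, |s - t| ≤ h → ENNReal.ofReal b ≤ P (Y s ⁻¹' D)) :
    b * ∫ ω, K ((T ω - t) / h) ∂P ≤ ∫ ω, stabWeight fT fTX (T ω) (X ω) * (K ((T ω - t) / h) *
      D.indicator 1 (observedOutcome T Y ω)) ∂P := by
  obtain ⟨η₁, η₂, hη, hover⟩ := hsupp.overlap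
  have hnn : 0 ≤ ∫ ω, stabWeight fT fTX (T ω) (X ω) * (K ((T ω - t) / h) *
      D.indicator 1 (observedOutcome T Y ω)) ∂P := integral_nonneg_of_ae
    ((hsupp.ae_stabWeight_mem hmodel.measurable_T hmodel.measurable_X hover).mono fun ω hω =>
      mul_nonneg (hη.le.trans hω.1)
      (mul_nonneg (hK.nonneg _) (indicator_nonneg (fun _ _ => zero_le_one) _)))
  rw [← ENNReal.ofReal_le_ofReal_iff hnn,
    hsupp.ofReal_integral_stabWeight_kernel hmodel hdens hunc hK hD hY,
    ← hK.lintegral_mul_const hmodel.measurable_T hb]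
  refine lintegral_mono_ae ?_
  have := Measure.support_mem_ae (μ := P.map T)
  rw [hsupp.support_T] at this
  filter_upwards [this] with s hs
  by_cases hst : |s - t| ≤ h
  · gcongr
    exact hbD s hs hst
  · simp [hK.apply_eq_zero hh hst]

/-- First and second moments of the exceedance scores. -/
theorem SupportOverlap.exceedScore_moments (hsupp : SupportOverlap P T X fT fTX)
    (hmodel : IsTreatmentModel T X Y) (hdens : AreDensities P T X fT fTX)
    (hunc : Unconfounded P T X Y) (hK : IsSmoothingKernel K)
    (hY : AEMeasurable (observedOutcome T Y) P) (hh : 0 < h) {η₁ η₂ C : ℝ} (hη : 0 < η₁)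
    (hover : ∀ t ∈ Icc (0 : ℝ) 1, ∀ x ∈ (P.map X).support,
      η₁ ≤ stabWeight fT fTX t x ∧ stabWeight fT fTX t x ≤ η₂) (hC : ∀ u, K u ≤ C)
    {z a b : ℝ} (ha : a ∈ Ioo (0 : ℝ) 1) (hb : 0 ≤ b)
    (hbS : ∀ s ∈ Icc (0 : ℝ) 1, |s - t| ≤ h → P (Y s ⁻¹' Ioi z) ≤ ENNReal.ofReal b) :
    MemLp (fun ω => exceedScore (stabWeight fT fTX) K t h z a
      (T ω, X ω, observedOutcome T Y ω)) 2 P ∧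
    Integrable (fun ω => exceedMass (E := E) K t h z a (T ω, X ω, observedOutcome T Y ω)) P ∧
    ∫ ω, exceedScore (stabWeight fT fTX) K t h z a (T ω, X ω, observedOutcome T Y ω) ∂P =
      ∫ ω, stabWeight fT fTX (T ω) (X ω) * (K ((T ω - t) / h) *
        (Ioi z).indicator 1 (observedOutcome T Y ω)) ∂P - a * ∫ ω, K ((T ω - t) / h) ∂P ∧
    ∫ ω, exceedScore (stabWeight fT fTX) K t h z a (T ω, X ω, observedOutcome T Y ω) ^ 2 ∂P ≤
      η₂ * C * ((b + a) * ∫ ω, K ((T ω - t) / h) ∂P) ∧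
    ∫ ω, exceedMass (E := E) K t h z a (T ω, X ω, observedOutcome T Y ω) ∂P ≤
      (b + a) / η₁ * ∫ ω, K ((T ω - t) / h) ∂P := by
  set m := ∫ ω, K ((T ω - t) / h) ∂P with hm
  set w : Ω → ℝ := fun ω => stabWeight fT fTX (T ω) (X ω) with hwdef
  set κ : Ω → ℝ := fun ω => K ((T ω - t) / h) with hκ
  set I : Ω → ℝ := fun ω => (Ioi z).indicator 1 (observedOutcome T Y ω) with hIdef
  have hae := hsupp.ae_stabWeight_mem hmodel.measurable_T hmodel.measurable_X hover
  have hC0 : 0 ≤ C := (hK.nonneg 0).trans (hC 0)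
  have hκ0 : ∀ ω, 0 ≤ κ ω := fun ω => hK.nonneg _
  have hI0 : ∀ ω, 0 ≤ I ω := fun ω => indicator_nonneg (fun _ _ => zero_le_one) _
  have hI1 : ∀ ω, I ω ≤ 1 := fun ω => indicator_le_self' (fun _ _ => zero_le_one) _
  have hJint : Integrable (fun ω => w ω * (κ ω * I ω)) P :=
    hsupp.integrable_stabWeight_kernel hmodel hdens hK measurableSet_Ioi hY
  have hJle : ∫ ω, w ω * (κ ω * I ω) ∂P ≤ b * m :=
    hsupp.integral_stabWeight_kernel_le hmodel hdens hunc hK measurableSet_Ioi hY hh hb hbS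
  have hmint : Integrable (fun ω => w ω * κ ω) P := by
    have := hsupp.integrable_stabWeight_kernel (t := t) (h := h) hmodel hdens hK
      MeasurableSet.univ hY
    simpa using this
  -- With D the whole line and b = 1 the upper and lower bounds coincide: the weight leaves the
  -- kernel mass unchanged.
  have hmeq : ∫ ω, w ω * κ ω ∂P = m := by
    have h1 := hsupp.integral_stabWeight_kernel_le (t := t) hmodel hdens hunc hK
      MeasurableSet.univ hY hh zero_le_one (fun s _ _ => by simp)
    have h2 := hsupp.le_integral_stabWeight_kernel (t := t) hmodel hdens hunc hK
      MeasurableSet.univ hY hh zero_le_one (fun s _ _ => by simp)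
    simp only [indicator_univ, Pi.one_apply, mul_one, one_mul] at h1 h2
    exact le_antisymm h1 h2
  have hwm : Measurable w :=
    hdens.measurable_stabWeight.comp (hmodel.measurable_X.prodMk hmodel.measurable_T)
  have hκm : Measurable κ :=
    hK.measurable.comp ((hmodel.measurable_T.sub_const t).div_const h)
  have hIm : AEMeasurable I P :=
    (measurable_one.indicator measurableSet_Ioi).comp_aemeasurable hY
  have hscore : ∀ ω, exceedScore (stabWeight fT fTX) K t h z a
      (T ω, X ω, observedOutcome T Y ω) = w ω * κ ω * (I ω - a) := fun ω => rfl
  have hmass : ∀ ω, exceedMass (E := E) K t h z a (T ω, X ω, observedOutcome T Y ω) =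
      κ ω * (I ω + a) := fun ω => rfl
  simp only [hscore, hmass]
  have habs : ∀ ω, |I ω - a| ≤ 1 := fun ω =>
    abs_le.2 ⟨by linarith [hI0 ω, ha.2], by linarith [hI1 ω, ha.1]⟩
  have hdom : Integrable (fun ω => w ω * (κ ω * I ω) + a * (w ω * κ ω)) P :=
    hJint.add (hmint.const_mul a)
  have hdomle : ∫ ω, (w ω * (κ ω * I ω) + a * (w ω * κ ω)) ∂P ≤ (b + a) * m := by
    rw [integral_add hJint (hmint.const_mul a), integral_const_mul, hmeq]
    linarith
  have hmassint : Integrable (fun ω => κ ω * (I ω + a)) P := by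
    refine Integrable.of_bound
      (hκm.aemeasurable.mul (hIm.add_const a)).aestronglyMeasurable (C * 2)
      (Eventually.of_forall fun ω => ?_)
    rw [Real.norm_eq_abs, abs_of_nonneg (mul_nonneg (hκ0 ω) (by linarith [hI0 ω, ha.1]))]
    exact mul_le_mul (hC _) (by linarith [hI1 ω, ha.2]) (by linarith [hI0 ω, ha.1]) hC0
  refine ⟨?_, hmassint, ?_, ?_, ?_⟩
  · refine MemLp.of_bound ((hwm.mul hκm).aemeasurable.mul
      (hIm.sub_const a)).aestronglyMeasurable (η₂ * C * 1) ?_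
    filter_upwards [hae] with ω hω
    have hw0 : 0 ≤ w ω := hη.le.trans hω.1
    rw [Real.norm_eq_abs, abs_mul, abs_of_nonneg (mul_nonneg hw0 (hκ0 ω))]
    exact mul_le_mul (mul_le_mul hω.2 (hC _) (hκ0 ω) (hw0.trans hω.2)) (habs ω) (abs_nonneg _)
      (mul_nonneg (hw0.trans hω.2) hC0)
  · rw [← hmeq, ← integral_const_mul, ← integral_sub hJint (hmint.const_mul a)]
    exact integral_congr_ae (Eventually.of_forall fun ω => by simp only; ring)
  -- Since (I - a)² ≤ I + a for an indicator I, the second moment is of order (b + a)m; keeping the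
  -- small factor yields the effective sample size kh.
  · have hη₂C : ∀ᵐ ω ∂P, (w ω * κ ω * (I ω - a)) ^ 2 ≤
        η₂ * C * (w ω * (κ ω * I ω) + a * (w ω * κ ω)) := by
      filter_upwards [hae] with ω hω
      have hw0 : 0 ≤ w ω := hη.le.trans hω.1
      have h1 : (I ω - a) ^ 2 ≤ I ω + a := by nlinarith [hI0 ω, hI1 ω, ha.1, ha.2]
      have h2 : w ω * κ ω ≤ η₂ * C := mul_le_mul hω.2 (hC _) (hκ0 ω) (hw0.trans hω.2)
      have h3 : 0 ≤ w ω * κ ω := mul_nonneg hw0 (hκ0 ω)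
      calc (w ω * κ ω * (I ω - a)) ^ 2 = (w ω * κ ω) * ((w ω * κ ω) * (I ω - a) ^ 2) := by ring
        _ ≤ (η₂ * C) * ((w ω * κ ω) * (I ω + a)) := by
            have h4 : 0 ≤ w ω * κ ω * (I ω - a) ^ 2 := mul_nonneg h3 (sq_nonneg _)
            exact mul_le_mul h2 (mul_le_mul_of_nonneg_left h1 h3) h4 (h3.trans h2)
        _ = _ := by ring
    calc ∫ ω, (w ω * κ ω * (I ω - a)) ^ 2 ∂P
        ≤ ∫ ω, η₂ * C * (w ω * (κ ω * I ω) + a * (w ω * κ ω)) ∂P :=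
          integral_mono_of_nonneg (Eventually.of_forall fun ω => sq_nonneg _)
            (hdom.const_mul _) hη₂C
      _ ≤ _ := by
          rw [integral_const_mul]
          have : 0 ≤ η₂ * C := by
            obtain ⟨ω, hω⟩ := hae.exists
            exact mul_nonneg ((hη.le.trans hω.1).trans hω.2) hC0
          exact mul_le_mul_of_nonneg_left hdomle this
  · have : ∫ ω, κ ω * (I ω + a) ∂P ≤
        ∫ ω, 1 / η₁ * (w ω * (κ ω * I ω) + a * (w ω * κ ω)) ∂P := by
      refine integral_mono_ae hmassint (hdom.const_mul _) ?_
      filter_upwards [hae] with ω hω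
      have h3 : 0 ≤ κ ω * (I ω + a) := mul_nonneg (hκ0 ω) (by linarith [hI0 ω, ha.1])
      rw [one_div, inv_mul_eq_div, le_div_iff₀ hη]
      calc κ ω * (I ω + a) * η₁ ≤ κ ω * (I ω + a) * w ω := mul_le_mul_of_nonneg_left hω.1 h3
        _ = _ := by ring
    rw [integral_const_mul] at this
    refine this.trans ?_
    rw [one_div, inv_mul_eq_div, div_mul_eq_mul_div]
    gcongr

end Moments

/-! ## Sample sums -/

section Sample

variable {Ω₀ Ω E : Type*} [MeasurableSpace Ω₀] [MeasurableSpace Ω] [MeasurableSpace E]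
  {P₀ : Measure Ω₀} {P : Measure Ω} {T : Ω₀ → ℝ} {X : Ω₀ → E} {Yobs : Ω₀ → ℝ}
  {Ts : ℕ → Ω → ℝ} {Xs : ℕ → Ω → E} {Ys : ℕ → Ω → ℝ}

/-- Variances of independent terms add, and each is bounded by an uncentred second moment. Nothing
is lost in order for exceedance scores, whose second moment is already proportional to the
exceedance level. -/
theorem IsIIDSample.measure_chebyshev_le [IsProbabilityMeasure P₀] [IsProbabilityMeasure P]
    (hs : IsIIDSample P₀ P T X Yobs Ts Xs Ys) {ψ : ℝ × E × ℝ → ℝ} (hψ : Measurable ψ)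
    (hL : MemLp (fun ω => ψ (T ω, X ω, Yobs ω)) 2 P₀) (N : ℕ) {c : ℝ} (hc : 0 < c) :
    P {ω | c ≤ |∑ i ∈ Finset.range N, ψ (Ts i ω, Xs i ω, Ys i ω) -
        N * ∫ ω, ψ (T ω, X ω, Yobs ω) ∂P₀|} ≤
      ENNReal.ofReal (N * (∫ ω, ψ (T ω, X ω, Yobs ω) ^ 2 ∂P₀) / c ^ 2) := by
  set Z : ℕ → Ω → ℝ := fun i ω => ψ (Ts i ω, Xs i ω, Ys i ω) with hZ
  have hid : ∀ i, IdentDistrib (Z i) (fun ω => ψ (T ω, X ω, Yobs ω)) P P₀ := fun i =>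
    (hs.ident i).comp hψ
  have hZL : ∀ i, MemLp (Z i) 2 P := fun i => (hid i).memLp_iff.2 hL
  have hmean : P[∑ i ∈ Finset.range N, Z i] = N * ∫ ω, ψ (T ω, X ω, Yobs ω) ∂P₀ := by
    simp only [Finset.sum_apply]
    rw [integral_finsetSum _ fun i _ => (hZL i).integrable (by norm_num),
      Finset.sum_congr rfl fun i _ => (hid i).integral_eq]
    simp
  have hvar : Var[∑ i ∈ Finset.range N, Z i; P] ≤ N * ∫ ω, ψ (T ω, X ω, Yobs ω) ^ 2 ∂P₀ := by
    rw [IndepFun.variance_sum (fun i _ => hZL i) fun i _ j _ hij =>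
        (hs.indep.indepFun hij).comp hψ hψ,
      Finset.sum_congr rfl fun i _ => (hid i).variance_eq]
    rw [Finset.sum_const, Finset.card_range, nsmul_eq_mul]
    gcongr
    exact variance_le_expectation_sq hL.aestronglyMeasurable
  have := meas_ge_le_variance_div_sq (memLp_finsetSum' (Finset.range N) fun i _ => hZL i) hc
  rw [hmean] at this
  simp only [Finset.sum_apply] at this
  refine this.trans (ENNReal.ofReal_le_ofReal ?_)
  gcongr

/-- Serves for the error caused by estimated weights. These may depend on the whole sample, so that
error is dominated by a sum of nonnegative terms, controlled through its mean alone. -/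
theorem IsIIDSample.measure_markov_le [IsProbabilityMeasure P]
    (hs : IsIIDSample P₀ P T X Yobs Ts Xs Ys) {χ : ℝ × E × ℝ → ℝ} (hχ : Measurable χ)
    (hχ0 : ∀ p, 0 ≤ χ p) (hL : Integrable (fun ω => χ (T ω, X ω, Yobs ω)) P₀) (N : ℕ)
    {c r : ℝ} (hc : 0 < c) (hr : 0 ≤ r) :
    P {ω | c ≤ r * ∑ i ∈ Finset.range N, χ (Ts i ω, Xs i ω, Ys i ω)} ≤
      ENNReal.ofReal (r * (N * ∫ ω, χ (T ω, X ω, Yobs ω) ∂P₀) / c) := by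
  set Z : ℕ → Ω → ℝ := fun i ω => χ (Ts i ω, Xs i ω, Ys i ω) with hZ
  have hid : ∀ i, IdentDistrib (Z i) (fun ω => χ (T ω, X ω, Yobs ω)) P P₀ := fun i =>
    (hs.ident i).comp hχ
  have hZL : ∀ i, Integrable (Z i) P := fun i => (hid i).integrable_iff.2 hL
  have hint : Integrable (fun ω => r * ∑ i ∈ Finset.range N, Z i ω) P :=
    (integrable_finsetSum _ fun i _ => hZL i).const_mul r
  have hmean : ∫ ω, r * ∑ i ∈ Finset.range N, Z i ω ∂P =
      r * (N * ∫ ω, χ (T ω, X ω, Yobs ω) ∂P₀) := by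
    rw [integral_const_mul, integral_finsetSum _ fun i _ => hZL i,
      Finset.sum_congr rfl fun i _ => (hid i).integral_eq]
    simp
  have := mul_meas_ge_le_integral_of_nonneg (Eventually.of_forall fun ω =>
    mul_nonneg hr (Finset.sum_nonneg fun i _ => hχ0 _)) hint c
  rw [hmean, mul_comm, ← le_div_iff₀ hc] at this
  rw [← ENNReal.ofReal_toReal (measure_ne_top P _)]
  exact ENNReal.ofReal_le_ofReal this

end Sample

theorem measurable_exceedScore {E : Type*} [MeasurableSpace E] {w : ℝ → E → ℝ} {K : ℝ → ℝ}
    (hw : Measurable fun p : E × ℝ => w p.2 p.1) (hK : Measurable K) (t h z a : ℝ) :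
    Measurable (exceedScore w K t h z a) := by
  have h1 : Measurable fun p : ℝ × E × ℝ => w p.1 p.2.1 :=
    hw.comp (measurable_snd.fst.prodMk measurable_fst)
  have h2 : Measurable fun p : ℝ × E × ℝ => K ((p.1 - t) / h) :=
    hK.comp ((measurable_fst.sub_const t).div_const h)
  have h3 : Measurable fun p : ℝ × E × ℝ => (Ioi z).indicator (1 : ℝ → ℝ) p.2.2 :=
    (measurable_one.indicator measurableSet_Ioi).comp measurable_snd.snd
  exact (h1.mul h2).mul (h3.sub_const a)

theorem measurable_exceedMass {E : Type*} [MeasurableSpace E] {K : ℝ → ℝ}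
    (hK : Measurable K) (t h z a : ℝ) : Measurable (exceedMass (E := E) K t h z a) := by
  have h2 : Measurable fun p : ℝ × E × ℝ => K ((p.1 - t) / h) :=
    hK.comp ((measurable_fst.sub_const t).div_const h)
  have h3 : Measurable fun p : ℝ × E × ℝ => (Ioi z).indicator (1 : ℝ → ℝ) p.2.2 :=
    (measurable_one.indicator measurableSet_Ioi).comp measurable_snd.snd
  exact h2.mul (h3.add_const a)

/-- Replacing the weights by an approximation changes the score sum by at most the error times
the mass sum. -/
theorem abs_sum_exceedScore_sub_le {E : Type*} {K : ℝ → ℝ} (hK : ∀ u, 0 ≤ K u)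
    {v w : ℝ → E → ℝ} {N : ℕ} {p : ℕ → ℝ × E × ℝ} {t h z a r : ℝ} (ha : 0 ≤ a)
    (hvw : ∀ i < N, |v (p i).1 (p i).2.1 - w (p i).1 (p i).2.1| ≤ r) :
    |∑ i ∈ Finset.range N, exceedScore v K t h z a (p i) -
      ∑ i ∈ Finset.range N, exceedScore w K t h z a (p i)| ≤
      r * ∑ i ∈ Finset.range N, exceedMass K t h z a (p i) := by
  rw [← Finset.sum_sub_distrib, Finset.mul_sum]
  refine (Finset.abs_sum_le_sum_abs _ _).trans (Finset.sum_le_sum fun i hi => ?_)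
  have h1 := hvw i (Finset.mem_range.1 hi)
  have hI0 : 0 ≤ (Ioi z).indicator (1 : ℝ → ℝ) (p i).2.2 :=
    indicator_nonneg (fun _ _ => zero_le_one) _
  unfold exceedScore exceedMass
  rw [← sub_mul, ← sub_mul, mul_assoc, abs_mul, abs_mul, abs_of_nonneg (hK _)]
  have h2 : |(Ioi z).indicator (1 : ℝ → ℝ) (p i).2.2 - a| ≤
      (Ioi z).indicator (1 : ℝ → ℝ) (p i).2.2 + a :=
    abs_le.2 ⟨by linarith, by linarith⟩
  exact mul_le_mul h1 (mul_le_mul_of_nonneg_left h2 (hK _))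
    (mul_nonneg (hK _) (abs_nonneg _)) ((abs_nonneg _).trans h1)

/-! ### Consistency of the intermediate quantile estimator -/

section Consistency

variable {Ω₀ Ω E : Type*} [MeasurableSpace Ω₀] [MeasurableSpace Ω] [TopologicalSpace E]
  [HereditarilyLindelofSpace E] [MeasurableSpace E]
  {P₀ : Measure Ω₀} [IsProbabilityMeasure P₀] {P : Measure Ω} [IsProbabilityMeasure P]
  {T : Ω₀ → ℝ} {X : Ω₀ → E} {Y : ℝ → Ω₀ → ℝ} {fT : ℝ → ℝ} {fTX : ℝ → E → ℝ}
  {K : ℝ → ℝ} {Ts : ℕ → Ω → ℝ} {Xs : ℕ → Ω → E} {Ys : ℕ → Ω → ℝ}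

/-- Deviation bound for the exceedance sums at a level `z` whose survival probabilities are at most
`2 a`. -/
theorem IsIIDSample.measure_deviation_le
    (hs : IsIIDSample P₀ P T X (observedOutcome T Y) Ts Xs Ys)
    (hsupp : SupportOverlap P₀ T X fT fTX)
    (hmodel : IsTreatmentModel T X Y) (hdens : AreDensities P₀ T X fT fTX)
    (hunc : Unconfounded P₀ T X Y) (hK : IsSmoothingKernel K) {t h : ℝ} (hh : 0 < h)
    {η₁ η₂ C : ℝ} (hη : 0 < η₁)
    (hover : ∀ t ∈ Icc (0 : ℝ) 1, ∀ x ∈ (P₀.map X).support,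
      η₁ ≤ stabWeight fT fTX t x ∧ stabWeight fT fTX t x ≤ η₂) (hC : ∀ u, K u ≤ C)
    {z a ζ r m : ℝ} (ha : a ∈ Ioo (0 : ℝ) 1) (hζ : 0 < ζ) (hr : 0 ≤ r) {N : ℕ} (hN : 0 < N)
    (hm : m = ∫ ω, K ((T ω - t) / h) ∂P₀) (hmpos : 0 < m)
    (hbS : ∀ s ∈ Icc (0 : ℝ) 1, |s - t| ≤ h → P₀ (Y s ⁻¹' Ioi z) ≤ ENNReal.ofReal (2 * a)) :
    P ({ω | N * a * m * ζ / 2 ≤ |∑ i ∈ Finset.range N, exceedScore (stabWeight fT fTX) K t h z a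
          (Ts i ω, Xs i ω, Ys i ω) - N * ∫ ω, exceedScore (stabWeight fT fTX) K t h z a
          (T ω, X ω, observedOutcome T Y ω) ∂P₀|} ∪
        {ω | N * a * m * ζ / 2 ≤ r * ∑ i ∈ Finset.range N, exceedMass K t h z a
          (Ts i ω, Xs i ω, Ys i ω)}) ≤
      ENNReal.ofReal (12 * η₂ * C / (N * a * m * ζ ^ 2)) + ENNReal.ofReal (6 * r / (η₁ * ζ)) := by
  have hY : AEMeasurable (observedOutcome T Y) P₀ :=
    measurable_snd.snd.comp_aemeasurable (hs.ident 0).aemeasurable_snd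
  obtain ⟨h1, h2, -, h4, h5⟩ := hsupp.exceedScore_moments hmodel hdens hunc hK hY hh hη hover hC
    ha (by linarith [ha.1] : (0 : ℝ) ≤ 2 * a) hbS
  rw [← hm] at h4 h5
  have hN' : (0 : ℝ) < N := Nat.cast_pos.2 hN
  have ha0 := ha.1
  have hc : 0 < N * a * m * ζ / 2 := by positivity
  refine (measure_union_le _ _).trans (add_le_add ?_ ?_)
  · refine (hs.measure_chebyshev_le
      (measurable_exceedScore hdens.measurable_stabWeight hK.measurable t h z a) h1 N hc).trans
      (ENNReal.ofReal_le_ofReal ?_)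
    -- The drift N a m ζ is shared equally between random fluctuation and weight error; b + a = 3a
    -- with these halves gives the constants 12 and 6.
    calc _ ≤ N * (η₂ * C * ((2 * a + a) * m)) / (N * a * m * ζ / 2) ^ 2 := by gcongr
      _ = _ := by field_simp; ring
  · refine (hs.measure_markov_le (measurable_exceedMass hK.measurable t h z a)
      (fun p => mul_nonneg (hK.nonneg _) (add_nonneg
        (indicator_nonneg (fun _ _ => zero_le_one) _) ha0.le)) h2 N hc hr).trans
      (ENNReal.ofReal_le_ofReal ?_)
    calc _ ≤ r * (N * ((2 * a + a) / η₁ * m)) / (N * a * m * ζ / 2) := by gcongr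
      _ = _ := by field_simp; ring

/-- The intermediate quantile estimator is consistent in relative error, at every rate slower than
`1 / √(k h)`. -/
theorem tendsto_measure_quantileEst_notMem
    {γ : ℝ → ℝ} (hmodel : IsTreatmentModel T X Y)
    (hdens : AreDensities P₀ T X fT fTX) (htail : HeavyTail (survival P₀ Y) γ)
    (hunc : Unconfounded P₀ T X Y) (hsupp : SupportOverlap P₀ T X fT fTX)
    (hfT : ∃ η₃ : ℝ, 0 < η₃ ∧ ∀ t ∈ Icc (0 : ℝ) 1, η₃ ≤ fT t)
    (hK : IsSmoothingKernel K) (hs : IsIIDSample P₀ P T X (observedOutcome T Y) Ts Xs Ys)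
    {piHat : ℕ → Ω → ℝ → E → ℝ} {δ : ℕ → ℝ} (hδ : Tendsto δ atTop (𝓝 0))
    (hpi : IsBigOInProb P
      (fun N ω => ⨆ i : Fin N, |piHat N ω (Ts i ω) (Xs i ω) -
        stabWeight fT fTX (Ts i ω) (Xs i ω)|) δ)
    {h : ℕ → ℝ} {k : ℕ → ℕ} (hh_pos : ∀ N, 0 < h N) (hh : Tendsto h atTop (𝓝 0))
    (hk : Tendsto k atTop atTop) (hkN : Tendsto (fun N : ℕ => (k N : ℝ) / N) atTop (𝓝 0))
    (hkhδ : Tendsto (fun N : ℕ => k N * h N * δ N ^ 2) atTop (𝓝 0))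
    {t : ℝ} (ht : t ∈ Icc (0 : ℝ) 1) {lam : ℝ} (hlam : 1 < lam)
    (hosc : Tendsto (fun N : ℕ => ENNReal.ofReal (Real.sqrt (k N * h N)) *
        tailOscillation (survival P₀ Y) t (popQuantile P₀ Y t (1 - lam * (k N / N))) (h N) *
          ENNReal.ofReal |Real.log (k N / N)|) atTop (𝓝 0))
    {η : ℕ → ℝ} (hη : Tendsto η atTop (𝓝 0)) (hηpos : ∀ᶠ N in atTop, 0 < η N)
    (hkη : Tendsto (fun N : ℕ => Real.sqrt (k N * h N) * η N) atTop atTop) :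
    Tendsto (fun N : ℕ => P {ω | quantileEst K N (piHat N ω) (fun i => Ts i ω) (fun i => Xs i ω)
        (fun i => Ys i ω) (h N) t (1 - (k N : ℝ) / N) ∉
      Icc (popQuantile P₀ Y t (1 - (k N : ℝ) / N) * (1 - η N))
        (popQuantile P₀ Y t (1 - (k N : ℝ) / N) * (1 + η N))}) atTop (𝓝 0) := by
  have hheavy : ∀ s ∈ Icc (0 : ℝ) 1, IsHeavyTailed (survival P₀ Y s) (γ s) := fun s hs =>
    htail.isHeavyTailed hs (hmodel.measurable_Y s hs)
  obtain ⟨η₁, η₂, hη₁, hover⟩ := hsupp.overlap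
  obtain ⟨η₃, hη₃, hfT3⟩ := hfT
  obtain ⟨C, hC⟩ := hK.bounded
  have hC0 : 0 ≤ C := (hK.nonneg 0).trans (hC 0)
  have hη₂ : 0 ≤ η₂ := by
    obtain ⟨ω, hω⟩ := (hsupp.ae_stabWeight_mem hmodel.measurable_T hmodel.measurable_X hover).exists
    exact (hη₁.le.trans hω.1).trans hω.2
  have hkN0 : ∀ᶠ N : ℕ in atTop, (0 : ℝ) < k N / N := by
    filter_upwards [hk.eventually_gt_atTop 0, eventually_gt_atTop 0] with N h1 h2
    have : (0 : ℝ) < k N := Nat.cast_pos.2 h1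
    have : (0 : ℝ) < N := Nat.cast_pos.2 h2
    positivity
  obtain ⟨c, hc, hwin⟩ := exists_survival_window hheavy ht hkN hkN0 hη hηpos
    (fun N => Real.sqrt_nonneg _) hkη hlam hosc
  have hYae : AEMeasurable (observedOutcome T Y) P₀ :=
    measurable_snd.snd.comp_aemeasurable (hs.ident 0).aemeasurable_snd
  have hweights : ∀ᵐ ω ∂P, ∀ i, η₁ ≤ stabWeight fT fTX (Ts i ω) (Xs i ω) := by
    refine ae_all_iff.2 fun i => ?_
    have hm : MeasurableSet {p : ℝ × E × ℝ | η₁ ≤ stabWeight fT fTX p.1 p.2.1} :=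
      measurableSet_le measurable_const
        (hdens.measurable_stabWeight.comp (measurable_snd.fst.prodMk measurable_fst))
    exact (hs.ident i).symm.ae_snd hm
      ((hsupp.ae_stabWeight_mem hmodel.measurable_T hmodel.measurable_X hover).mono
        fun ω hω => hω.1)
  -- √(kh)·δ → 0 while √(kh)·η → ∞, so the weight error is negligible against the drift.
  have hδη : Tendsto (fun N => |δ N| / η N) atTop (𝓝 0) := by
    have h1 : Tendsto (fun N : ℕ => Real.sqrt (k N * h N * δ N ^ 2)) atTop (𝓝 0) := by
      simpa using hkhδ.sqrt
    have h2 := h1.mul hkη.inv_tendsto_atTop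
    rw [zero_mul] at h2
    refine h2.congr' ?_
    filter_upwards [hk.eventually_gt_atTop 0] with N hN
    have hpos : 0 < Real.sqrt (k N * h N) :=
      Real.sqrt_pos.2 (mul_pos (Nat.cast_pos.2 hN) (hh_pos N))
    rw [Real.sqrt_mul (mul_nonneg (Nat.cast_nonneg _) (hh_pos N).le), Real.sqrt_sq_eq_abs,
      Pi.inv_apply, mul_inv]
    field_simp
  refine ENNReal.tendsto_nhds_zero.2 fun ε hε => ?_
  obtain ⟨ε', hε', hεε⟩ : ∃ ε' : ℝ, 0 < ε' ∧ ENNReal.ofReal (2 * ε') ≤ ε := by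
    rcases eq_or_ne ε ∞ with rfl | hne
    · exact ⟨1, one_pos, le_top⟩
    · refine ⟨ε.toReal / 2, half_pos (ENNReal.toReal_pos hε.ne' hne), ?_⟩
      rw [mul_div_cancel₀ _ (two_ne_zero), ENNReal.ofReal_toReal hne]
  obtain ⟨M, hM⟩ := hpi ε' hε'
  -- The constant of the O_p bound has no prescribed sign, hence the absolute value.
  set r : ℕ → ℝ := fun N => |M| * |δ N| with hr
  have hr0 : ∀ N, 0 ≤ r N := fun N => by positivity
  have hrt : Tendsto r atTop (𝓝 0) := by
    simpa using hδ.abs.const_mul |M|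
  have herr : Tendsto (fun N : ℕ => 2 * (24 * η₂ * C / (η₃ * c ^ 2) *
      ((Real.sqrt (k N * h N) * η N) ^ 2)⁻¹ + 6 * |M| / (η₁ * c) * (|δ N| / η N)))
      atTop (𝓝 0) := by
    have h1 := ((tendsto_pow_atTop two_ne_zero).comp hkη).inv_tendsto_atTop
    have := ((h1.const_mul (24 * η₂ * C / (η₃ * c ^ 2))).add
      (hδη.const_mul (6 * |M| / (η₁ * c)))).const_mul 2
    simpa using this
  filter_upwards [hM, hwin, hηpos, hkN0, hkN.eventually_lt_const one_pos,
    hk.eventually_gt_atTop 0, eventually_gt_atTop 0, hrt.eventually_lt_const hη₁,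
    hh.eventually_le_const (show (0 : ℝ) < 1 / 2 by norm_num), herr.eventually_lt_const hε']
    with N hMN hwN hηN haN ha1 hkN' hN hrN hhN herrN
  set a : ℝ := k N / N with hadef
  set q := popQuantile P₀ Y t (1 - a) with hq
  set m := ∫ ω, K ((T ω - t) / h N) ∂P₀ with hm
  have hNpos : (0 : ℝ) < N := Nat.cast_pos.2 hN
  have hkpos : (0 : ℝ) < k N := Nat.cast_pos.2 hkN'
  have hhp := hh_pos N
  have hmlow : η₃ * h N / 2 ≤ m :=
    hdens.le_integral_kernel hmodel.measurable_T hK hfT3 ht hhp hhN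
  have hmpos : 0 < m := lt_of_lt_of_le (by positivity) hmlow
  have hζ : 0 < c * η N := by positivity
  have hexc : ∀ s ∈ Icc (0 : ℝ) 1, ∀ z, P₀ (Y s ⁻¹' Ioi z) =
      ENNReal.ofReal (survival P₀ Y s z) := fun s hs z =>
    measure_preimage_Ioi_eq_survival (hmodel.measurable_Y s hs)
      (hheavy s hs).smooth.continuous z
  have hζ1 : 0 ≤ 1 - c * η N := by
    have h1 := (hwN t ht (by simpa using hhp.le)).1
    have h2 := ((hheavy t ht).pos _).le.trans h1
    exact nonneg_of_mul_nonneg_right h2 haN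
  set Bad : ℝ → Set Ω := fun z =>
    {ω | N * a * m * (c * η N) / 2 ≤ |∑ i ∈ Finset.range N,
        exceedScore (stabWeight fT fTX) K t (h N) z a (Ts i ω, Xs i ω, Ys i ω) -
        N * ∫ ω, exceedScore (stabWeight fT fTX) K t (h N) z a
          (T ω, X ω, observedOutcome T Y ω) ∂P₀|} ∪
      {ω | N * a * m * (c * η N) / 2 ≤ r N * ∑ i ∈ Finset.range N, exceedMass K t (h N) z a
          (Ts i ω, Xs i ω, Ys i ω)} with hBad
  have hBadle : ∀ z, (∀ s ∈ Icc (0 : ℝ) 1, |s - t| ≤ h N → survival P₀ Y s z ≤ 2 * a) →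
      P (Bad z) ≤ ENNReal.ofReal (24 * η₂ * C / (η₃ * c ^ 2) *
        ((Real.sqrt (k N * h N) * η N) ^ 2)⁻¹ + 6 * |M| / (η₁ * c) * (|δ N| / η N)) := by
    intro z hz
    refine (hs.measure_deviation_le hsupp hmodel hdens hunc hK hhp hη₁ hover hC ⟨haN, ha1⟩ hζ
      (hr0 N) hN hm hmpos fun s hsI hst => by
        rw [hexc s hsI]; exact ENNReal.ofReal_le_ofReal (hz s hsI hst)).trans ?_
    rw [ENNReal.ofReal_add (by positivity) (by positivity)]
    refine add_le_add (ENNReal.ofReal_le_ofReal ?_) (ENNReal.ofReal_le_ofReal (le_of_eq ?_))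
    -- With m at least η₃h/2, the Chebyshev term becomes a multiple of 1/(√(kh)·η)², which vanishes.
    · have hNa : N * a = k N := by rw [hadef]; field_simp
      rw [hNa, mul_pow, mul_pow, Real.sq_sqrt (by positivity)]
      calc 12 * η₂ * C / (k N * m * (c ^ 2 * η N ^ 2))
          ≤ 12 * η₂ * C / (k N * (η₃ * h N / 2) * (c ^ 2 * η N ^ 2)) := by gcongr
        _ = _ := by field_simp; ring
    · rw [hr]; field_simp
  have hq1 : ∀ s ∈ Icc (0 : ℝ) 1, |s - t| ≤ h N →
      survival P₀ Y s (q * (1 + η N)) ≤ a * (1 - c * η N) := fun s hs hst => (hwN s hs hst).1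
  have hq2 : ∀ s ∈ Icc (0 : ℝ) 1, |s - t| ≤ h N →
      survival P₀ Y s (q * (1 + η N)) ≤ 2 * a := fun s hs hst =>
    (hq1 s hs hst).trans (by nlinarith)
  -- Off these exceptional events the estimated weights are positive because r < η₁. At q(1 - η) and
  -- q(1 + η) fluctuation and weight error each stay below half the drift, so the score sums have
  -- the signs that trap the estimated quantile.
  have hsub : {ω | quantileEst K N (piHat N ω) (fun i => Ts i ω) (fun i => Xs i ω)
        (fun i => Ys i ω) (h N) t (1 - a) ∉ Icc (q * (1 - η N)) (q * (1 + η N))} ⊆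
      {ω | ¬ ∀ i, η₁ ≤ stabWeight fT fTX (Ts i ω) (Xs i ω)} ∪
      ({ω | M * |δ N| < |(⨆ i : Fin N, |piHat N ω (Ts i ω) (Xs i ω) -
        stabWeight fT fTX (Ts i ω) (Xs i ω)|)|} ∪
      (Bad (q * (1 - η N)) ∪ Bad (q * (1 + η N)))) := by
    intro ω hω
    by_contra hnot
    simp only [mem_union, not_or, mem_ofPred_eq, not_not, not_lt] at hnot
    obtain ⟨hw, hsup, hb1, hb2⟩ := hnot
    simp only [hBad, mem_union, not_or, mem_ofPred_eq, not_le] at hb1 hb2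
    have hdiff : ∀ i < N, |piHat N ω (Ts i ω) (Xs i ω) -
        stabWeight fT fTX (Ts i ω) (Xs i ω)| ≤ r N := by
      intro i hi
      have h1 := le_ciSup (f := fun i : Fin N => |piHat N ω (Ts i ω) (Xs i ω) -
        stabWeight fT fTX (Ts i ω) (Xs i ω)|) (Set.finite_range _).bddAbove ⟨i, hi⟩
      refine h1.trans ((le_abs_self _).trans (hsup.trans ?_))
      exact mul_le_mul_of_nonneg_right (le_abs_self M) (abs_nonneg _)
    have happ : ∀ z, _ := fun z => abs_sum_exceedScore_sub_le (v := piHat N ω)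
      (w := stabWeight fT fTX) (p := fun i => (Ts i ω, Xs i ω, Ys i ω)) (t := t) (h := h N)
      (z := z) hK.nonneg haN.le hdiff
    refine hω (quantileEst_mem_Icc hK.nonneg (fun i hi => ?_) ?_ ?_)
    · have := (abs_le.1 (hdiff i hi)).1
      linarith [hw i]
    · have hmean : a * (c * η N) * m ≤ ∫ ω, exceedScore (stabWeight fT fTX) K t (h N)
          (q * (1 - η N)) a (T ω, X ω, observedOutcome T Y ω) ∂P₀ := by
        rw [(hsupp.exceedScore_moments hmodel hdens hunc hK hYae hhp hη₁ hover hC ⟨haN, ha1⟩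
          (by positivity : 0 ≤ 2 * a) fun s hsI hst => by
            rw [hexc s hsI]; exact ENNReal.ofReal_le_ofReal (hwN s hsI hst).2.2).2.2.1]
        have := hsupp.le_integral_stabWeight_kernel (t := t) (D := Ioi (q * (1 - η N))) hmodel hdens hunc hK
          measurableSet_Ioi hYae hhp (by positivity : 0 ≤ a * (1 + c * η N)) fun s hsI hst => by
            rw [hexc s hsI]; exact ENNReal.ofReal_le_ofReal (hwN s hsI hst).2.1
        rw [← hm] at this ⊢
        linarith
      have h1 := (abs_lt.1 hb1.1).1
      have h2 := (abs_le.1 (happ (q * (1 - η N)))).1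
      have h3 := mul_le_mul_of_nonneg_left hmean hNpos.le
      have h4 := hb1.2
      have h5 : 0 < ∑ i ∈ Finset.range N, exceedScore (piHat N ω) K t (h N) (q * (1 - η N)) a
          (Ts i ω, Xs i ω, Ys i ω) := by linarith
      exact h5
    · have hmean : ∫ ω, exceedScore (stabWeight fT fTX) K t (h N)
          (q * (1 + η N)) a (T ω, X ω, observedOutcome T Y ω) ∂P₀ ≤ -(a * (c * η N) * m) := by
        rw [(hsupp.exceedScore_moments hmodel hdens hunc hK hYae hhp hη₁ hover hC ⟨haN, ha1⟩
          (by positivity : 0 ≤ 2 * a) fun s hsI hst => by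
            rw [hexc s hsI]; exact ENNReal.ofReal_le_ofReal (hq2 s hsI hst)).2.2.1]
        have := hsupp.integral_stabWeight_kernel_le (t := t) hmodel hdens hunc hK
          measurableSet_Ioi hYae hhp (mul_nonneg haN.le hζ1) fun s hsI hst => by
            rw [hexc s hsI]; exact ENNReal.ofReal_le_ofReal (hq1 s hsI hst)
        rw [← hm] at this ⊢
        linarith
      have h1 := (abs_lt.1 hb2.1).2
      have h2 := (abs_le.1 (happ (q * (1 + η N)))).2
      have h3 := mul_le_mul_of_nonneg_left hmean hNpos.le
      have h4 := hb2.2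
      have h5 : ∑ i ∈ Finset.range N, exceedScore (piHat N ω) K t (h N) (q * (1 + η N)) a
          (Ts i ω, Xs i ω, Ys i ω) < 0 := by linarith
      exact h5
  refine (measure_mono hsub).trans ((measure_union_le _ _).trans ?_)
  rw [show P {ω | ¬ ∀ i, η₁ ≤ stabWeight fT fTX (Ts i ω) (Xs i ω)} = 0 from hweights, zero_add]
  refine (measure_union_le _ _).trans (le_trans ?_ hεε)
  rw [two_mul, ENNReal.ofReal_add hε'.le hε'.le]
  refine add_le_add hMN ((measure_union_le _ _).trans
    ((add_le_add (hBadle _ fun s hsI hst => (hwN s hsI hst).2.2) (hBadle _ hq2)).trans ?_))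
  rw [← ENNReal.ofReal_add (by positivity) (by positivity), ← two_mul]
  exact ENNReal.ofReal_le_ofReal herrN.le

end Consistency

/-! ## Weak convergence to random constants in `ℓ^∞` -/

/-- Off a measurable hull of the exceptional set φ and G differ by at most ε, and on it by at most
2B. Every integrable majorant of φ must satisfy the lower estimate, and one explicit majorant
attains the upper one, so φ itself needs no measurability. -/
theorem abs_outerExpectation_sub_integral_le {Ω : Type*} [MeasurableSpace Ω] {P : Measure Ω}
    [IsProbabilityMeasure P] {φ G : Ω → ℝ} (hG : AEMeasurable G P) {B ε ε' : ℝ}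
    (hφB : ∀ ω, |φ ω| ≤ B) (hGB : ∀ ω, |G ω| ≤ B) (hε : 0 ≤ ε) (hε' : 0 ≤ ε')
    (hP : P {ω | ε < |φ ω - G ω|} ≤ ENNReal.ofReal ε') :
    |outerExpectation P φ - ∫ ω, G ω ∂P| ≤ ε + 2 * B * ε' := by
  have hB : 0 ≤ B := by
    obtain ⟨ω⟩ : Nonempty Ω := by
      by_contra hne
      rw [not_nonempty_iff] at hne
      exact IsProbabilityMeasure.ne_zero P (Measure.eq_zero_of_isEmpty P)
    exact (abs_nonneg _).trans (hφB ω)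
  set G' := hG.mk G with hG'
  have hGG' : G =ᵐ[P] G' := hG.ae_eq_mk
  -- The hull also swallows the null set where G differs from its measurable version, because
  -- majorants in the outer expectation must be measurable.
  set A := toMeasurable P ({ω | ε < |φ ω - G ω|} ∪ {ω | G ω ≠ G' ω}) with hA
  have hAm : MeasurableSet A := measurableSet_toMeasurable _ _
  have hsub := subset_toMeasurable P ({ω | ε < |φ ω - G ω|} ∪ {ω | G ω ≠ G' ω})
  have hPA : P.real A ≤ ε' := by
    refine ENNReal.toReal_le_of_le_ofReal hε' ?_
    rw [hA, measure_toMeasurable]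
    refine (measure_union_le _ _).trans ?_
    rw [show P {ω | G ω ≠ G' ω} = 0 from hGG', add_zero]
    exact hP
  have hoff : ∀ ω ∉ A, |φ ω - G ω| ≤ ε ∧ G ω = G' ω := by
    intro ω hω
    have := fun h => hω (hsub h)
    simp only [mem_union, mem_ofPred_eq, not_or, not_lt, ne_eq, not_not, imp_false] at this
    exact this
  have hGint : Integrable G P := Integrable.of_bound hG.aestronglyMeasurable B
    (Eventually.of_forall hGB)
  have hAint : Integrable (A.indicator fun _ => (1 : ℝ)) P := (integrable_const 1).indicator hAm
  have hcint : Integrable (fun _ : Ω => ε) P := integrable_const ε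
  have hGsub : Integrable (fun ω => G ω - ε) P := hGint.sub hcint
  have hGadd : Integrable (fun ω => G ω + ε) P := hGint.add hcint
  have hAval : ∫ ω, A.indicator (fun _ => (1 : ℝ)) ω ∂P = P.real A := by
    rw [integral_indicator hAm]
    simp [Measure.real]
  have hlow : ∀ c ∈ {c | ∃ U : Ω → ℝ, Measurable U ∧ Integrable U P ∧ (∀ ω, φ ω ≤ U ω) ∧
      c = ∫ ω, U ω ∂P}, ∫ ω, G ω ∂P - (ε + 2 * B * ε') ≤ c := by
    rintro c ⟨U, -, hUint, hU, rfl⟩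
    have h1 : ∫ ω, (G ω - ε - 2 * B * A.indicator (fun _ => (1 : ℝ)) ω) ∂P ≤ ∫ ω, U ω ∂P := by
      refine integral_mono (hGsub.sub (hAint.const_mul _)) hUint
        fun ω => ?_
      have h2 := hU ω
      by_cases hω : ω ∈ A
      · simp only [indicator_of_mem hω]
        linarith [(abs_le.1 (hφB ω)).1, (abs_le.1 (hGB ω)).2]
      · simp only [indicator_of_notMem hω]
        linarith [(abs_le.1 (hoff ω hω).1).1]
    rw [integral_sub hGsub (hAint.const_mul _),
      integral_sub hGint hcint, integral_const_mul, hAval] at h1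
    simp only [integral_const, probReal_univ, smul_eq_mul, one_mul] at h1
    have h3 := mul_le_mul_of_nonneg_left hPA (by positivity : 0 ≤ 2 * B)
    linarith
  set U₀ : Ω → ℝ := fun ω => A.indicator (fun _ => B) ω + Aᶜ.indicator (fun ω => G' ω + ε) ω
    with hU₀
  have hU₀m : Measurable U₀ := (measurable_const.indicator hAm).add
    ((hG.measurable_mk.add_const ε).indicator hAm.compl)
  have hU₀val : ∀ ω, (ω ∈ A → U₀ ω = B) ∧ (ω ∉ A → U₀ ω = G ω + ε) := by
    refine fun ω => ⟨fun hω => ?_, fun hω => ?_⟩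
    · simp [hU₀, hω]
    · simp [hU₀, hω, (hoff ω hω).2]
  have hU₀int : Integrable U₀ P := by
    refine Integrable.of_bound hU₀m.aestronglyMeasurable (B + ε) (Eventually.of_forall fun ω => ?_)
    rw [Real.norm_eq_abs, abs_le]
    by_cases hω : ω ∈ A
    · rw [(hU₀val ω).1 hω]
      constructor <;> linarith
    · rw [(hU₀val ω).2 hω]
      have := abs_le.1 (hGB ω)
      constructor <;> linarith [this.1, this.2]
  have hmem : ∫ ω, U₀ ω ∂P ∈ {c | ∃ U : Ω → ℝ, Measurable U ∧ Integrable U P ∧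
      (∀ ω, φ ω ≤ U ω) ∧ c = ∫ ω, U ω ∂P} := by
    refine ⟨U₀, hU₀m, hU₀int, fun ω => ?_, rfl⟩
    by_cases hω : ω ∈ A
    · rw [(hU₀val ω).1 hω]
      exact (abs_le.1 (hφB ω)).2
    · rw [(hU₀val ω).2 hω]
      linarith [(abs_le.1 (hoff ω hω).1).2]
  have hup : ∫ ω, U₀ ω ∂P ≤ ∫ ω, G ω ∂P + (ε + 2 * B * ε') := by
    have h1 : ∫ ω, U₀ ω ∂P ≤ ∫ ω, (G ω + ε + 2 * B * A.indicator (fun _ => (1 : ℝ)) ω) ∂P := by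
      refine integral_mono hU₀int (hGadd.add (hAint.const_mul _))
        fun ω => ?_
      by_cases hω : ω ∈ A
      · simp only [(hU₀val ω).1 hω, indicator_of_mem hω]
        linarith [(abs_le.1 (hGB ω)).1]
      · simp only [(hU₀val ω).2 hω, indicator_of_notMem hω]
        linarith
    rw [integral_add hGadd (hAint.const_mul _),
      integral_add hGint hcint, integral_const_mul, hAval] at h1
    simp only [integral_const, probReal_univ, smul_eq_mul, one_mul] at h1
    have h3 := mul_le_mul_of_nonneg_left hPA (by positivity : 0 ≤ 2 * B)
    linarith
  rw [abs_le]
  constructor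
  · have := le_csInf ⟨_, hmem⟩ hlow
    unfold outerExpectation
    linarith
  · have := csInf_le ⟨_, hlow⟩ hmem
    unfold outerExpectation
    linarith

section ConstantLimit

variable {ι F : Type*} [NormedAddCommGroup F]

theorem memℓp_const_top (x : F) : Memℓp (E := fun _ : ι => F) (fun _ => x) ∞ :=
  memℓp_infty ⟨‖x‖, by rintro _ ⟨i, rfl⟩; exact le_rfl⟩

theorem norm_toLinfty_sub_le {g g' : ι → F} (hg : Memℓp (E := fun _ : ι => F) g ∞)
    (hg' : Memℓp (E := fun _ : ι => F) g' ∞) {ε : ℝ} (hε : 0 ≤ ε) (h : ∀ i, ‖g i - g' i‖ ≤ ε) :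
    ‖toLinfty g - toLinfty g'‖ ≤ ε := by
  refine lp.norm_le_of_forall_le hε fun i => ?_
  rw [toLinfty, toLinfty, dif_pos hg, dif_pos hg']
  exact h i

/-- The embedding of constants is 1-Lipschitz. A bounded continuous test function on ℓ^∞ thus
restricts to one on F, where ordinary convergence in distribution applies. -/
theorem continuous_toLinfty_const : Continuous fun x : F => toLinfty (fun _ : ι => x) := by
  refine (LipschitzWith.of_dist_le_mul (K := 1) fun x y => ?_).continuous
  rw [dist_eq_norm, dist_eq_norm, NNReal.coe_one, one_mul]
  exact norm_toLinfty_sub_le (memℓp_const_top x) (memℓp_const_top y) (norm_nonneg _)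
    fun _ => le_rfl

variable {Ω Λ : Type*} [MeasurableSpace Ω] [MeasurableSpace Λ] [MeasurableSpace F] [BorelSpace F]
  {P : Measure Ω} [IsProbabilityMeasure P] {Q : Measure Λ} [IsProbabilityMeasure Q]
  {W : ℕ → Ω → F} {V : Λ → F}

/-- A sequence converging in distribution is asymptotically tight. -/
theorem MeasureTheory.TendstoInDistribution.exists_norm_bound [ProperSpace F]
    (hW : TendstoInDistribution W atTop V (fun _ => P) Q) {ε : ℝ≥0∞} (hε : 0 < ε) :
    ∃ R : ℝ, ∀ᶠ n in atTop, P {ω | R ≤ ‖W n ω‖} ≤ ε := by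
  obtain ⟨ε', hε', hlt⟩ := exists_between hε
  have hprob : IsProbabilityMeasure (Q.map V) :=
    Measure.isProbabilityMeasure_map hW.aemeasurable_limit
  obtain ⟨K, hK, hKε⟩ := isTightMeasureSet_iff_exists_isCompact_measure_compl_le.1
    (isTightMeasureSet_singleton (μ := Q.map V)) ε' hε'
  obtain ⟨R, hR⟩ := hK.isBounded.exists_norm_le
  have hcl : IsClosed {x : F | R + 1 ≤ ‖x‖} := isClosed_le continuous_const continuous_norm
  have h1 := ProbabilityMeasure.limsup_measure_closed_le_of_tendsto hW.tendsto hcl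
  have h2 : Q.map V {x : F | R + 1 ≤ ‖x‖} ≤ ε' := by
    refine (measure_mono fun x hx hxK => ?_).trans (hKε _ rfl)
    have := hR x hxK
    simp only [mem_ofPred_eq] at hx
    linarith
  have h3 := eventually_lt_of_limsup_lt (lt_of_le_of_lt (h1.trans h2) hlt)
  refine ⟨R + 1, h3.mono fun n hn => ?_⟩
  have h4 : P.map (W n) {x : F | R + 1 ≤ ‖x‖} < ε := hn
  rw [Measure.map_apply_of_aemeasurable (hW.forall_aemeasurable n) hcl.measurableSet] at h4
  exact h4.le

/-- If the paths of `Zₙ` are uniformly close, in outer probability, to random constants `Wₙ` that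
converge in distribution to `V`, then `Zₙ` converges weakly in `ℓ^∞` to the constant process `V`. -/
theorem weakConvLinfty_const [ProperSpace F]
    (hW : TendstoInDistribution W atTop V (fun _ => P) Q) {Z : ℕ → Ω → ι → F}
    (hbd : ∀ᶠ n in atTop, ∀ ω, Memℓp (E := fun _ : ι => F) (Z n ω) ∞)
    (hclose : ∀ ε : ℝ, 0 < ε →
      Tendsto (fun n => P {ω | ¬ ∀ i, ‖Z n ω i - W n ω‖ ≤ ε}) atTop (𝓝 0)) :
    WeakConvLinfty P Q Z (fun l _ => V l) where
  bounded := hbd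
  bounded_lim l := memℓp_const_top _
  measurable_lim f :=
    ((f.continuous.comp continuous_toLinfty_const).measurable.comp_aemeasurable
      hW.aemeasurable_limit).aestronglyMeasurable
  tendsto f := by
    set g : F →ᵇ ℝ := f.compContinuous ⟨_, continuous_toLinfty_const (ι := ι)⟩ with hg
    have hgm : ∀ n, AEMeasurable (fun ω => g (W n ω)) P := fun n =>
      g.continuous.measurable.comp_aemeasurable (hW.forall_aemeasurable n)
    have hlim : Tendsto (fun n => ∫ ω, g (W n ω) ∂P) atTop (𝓝 (∫ l, g (V l) ∂Q)) := by
      have := (ProbabilityMeasure.tendsto_iff_forall_integral_tendsto.1 hW.tendsto) g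
      simp only [ProbabilityMeasure.coe_mk] at this
      rw [integral_map hW.aemeasurable_limit
        g.continuous.measurable.aestronglyMeasurable] at this
      refine this.congr fun n => ?_
      rw [integral_map (hW.forall_aemeasurable n) g.continuous.measurable.aestronglyMeasurable]
    have hdiff : Tendsto (fun n => outerExpectation P (fun ω => f (toLinfty (Z n ω))) -
        ∫ ω, g (W n ω) ∂P) atTop (𝓝 0) := by
      refine Metric.tendsto_nhds.2 fun τ hτ => ?_
      -- Chosen so that the total error ε + 2‖f‖·(2ε) equals τ/2.
      set ε := τ / (2 * (1 + 4 * ‖f‖)) with hεdef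
      have hε : 0 < ε := by positivity
      obtain ⟨R, hR⟩ := hW.exists_norm_bound (ENNReal.ofReal_pos.2 hε)
      -- A continuous f need not be uniformly continuous on ℓ^∞, but it is so at the points of a
      -- compact set. By tightness the approximating constants lie in such a set with high
      -- probability.
      have hcomp : IsCompact ((fun x : F => toLinfty (fun _ : ι => x)) '' Metric.closedBall 0 R) :=
        (isCompact_closedBall 0 R).image continuous_toLinfty_const
      have hunif := hcomp.uniformContinuousAt_of_continuousAt f
        (fun a _ => f.continuous.continuousAt) (Metric.dist_mem_uniformity hε)
      obtain ⟨δ, hδ, hδf⟩ := Metric.mem_uniformity_dist.1 hunif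
      filter_upwards [hR, hbd, (hclose (δ / 2) (half_pos hδ)).eventually_le_const
        (ENNReal.ofReal_pos.2 hε)] with n hn1 hn2 hn3
      have hbad : P {ω | ε < |f (toLinfty (Z n ω)) - g (W n ω)|} ≤ ENNReal.ofReal (2 * ε) := by
        have hsub : {ω | ε < |f (toLinfty (Z n ω)) - g (W n ω)|} ⊆
            {ω | R ≤ ‖W n ω‖} ∪ {ω | ¬ ∀ i, ‖Z n ω i - W n ω‖ ≤ δ / 2} := by
          intro ω hω
          by_contra hnot
          simp only [mem_union, mem_ofPred_eq, not_or, not_le, not_not] at hnot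
          have h1 : ‖toLinfty (Z n ω) - toLinfty (fun _ : ι => W n ω)‖ ≤ δ / 2 :=
            norm_toLinfty_sub_le (hn2 ω) (memℓp_const_top _) (half_pos hδ).le hnot.2
          have h2 := hδf (a := toLinfty (fun _ : ι => W n ω)) (b := toLinfty (Z n ω)) (by
            rw [dist_comm, dist_eq_norm]; linarith)
            ⟨W n ω, by simpa using hnot.1.le, rfl⟩
          simp only [mem_ofPred_eq] at h2
          rw [dist_comm, Real.dist_eq] at h2
          exact absurd h2 (not_lt.2 (le_of_lt hω))
        refine (measure_mono hsub).trans ((measure_union_le _ _).trans ?_)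
        rw [two_mul, ENNReal.ofReal_add hε.le hε.le]
        exact add_le_add hn1 hn3
      have := abs_outerExpectation_sub_integral_le (hgm n) (B := ‖f‖)
        (fun ω => f.norm_coe_le_norm _) (fun ω => f.norm_coe_le_norm _) hε.le
        (by positivity : 0 ≤ 2 * ε) hbad
      rw [Real.dist_eq, sub_zero]
      refine lt_of_le_of_lt this ?_
      have h5 : ε + 2 * ‖f‖ * (2 * ε) = τ / 2 := by
        rw [hεdef]; field_simp; ring
      linarith
    have := hdiff.add hlim
    simp only [sub_add_cancel, zero_add] at this
    exact this

end ConstantLimit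

/-! ## Extrapolation -/

/-- With l = L/s and exponent e, the error is (e₁ + e₃ + (exp e - 1 - e))/l. The first two terms
contribute at most 2ε, and the quadratic remainder at most e²/l ≤ (M + 1)² l. -/
theorem abs_exp_expansion_sub_le {s L ε M W e₁ e₃ : ℝ} (hs : 0 < s) (hL : 0 < L)
    (h₁ : |e₁| ≤ ε * (L / s)) (h₃ : |e₃| ≤ ε * (L / s)) (hε : ε ≤ 1 / 2) (hW : |W| ≤ M)
    (hsmall : (M + 1) * (L / s) ≤ 1) :
    |s / L * (Real.exp (e₁ + W * (L / s) + e₃) - 1) - W| ≤ 2 * ε + (M + 1) ^ 2 * (L / s) := by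
  have hinv : s / L = (L / s)⁻¹ := (inv_div L s).symm
  have hl : 0 < L / s := div_pos hL hs
  rw [hinv]
  set l := L / s
  set e := e₁ + W * l + e₃ with he
  have hWl : |W * l| ≤ M * l := by
    rw [abs_mul, abs_of_pos hl]
    exact mul_le_mul_of_nonneg_right hW hl.le
  have hεl : ε * l ≤ 1 / 2 * l := mul_le_mul_of_nonneg_right hε hl.le
  have habs : |e| ≤ (M + 1) * l := by
    have := (abs_add_le (e₁ + W * l) e₃).trans (add_le_add_left (abs_add_le e₁ (W * l)) _)
    rw [← he] at this
    linarith
  have hexp := Real.abs_exp_sub_one_sub_id_le (habs.trans hsmall)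
  have hsq : e ^ 2 ≤ ((M + 1) * l) ^ 2 := by
    rw [← sq_abs e]
    exact pow_le_pow_left₀ (abs_nonneg _) habs 2
  have hid : l⁻¹ * (Real.exp e - 1) - W = l⁻¹ * (e₁ + e₃ + (Real.exp e - 1 - e)) := by
    rw [he]
    field_simp
    ring
  rw [hid, abs_mul, abs_of_pos (inv_pos.2 hl), inv_mul_le_iff₀ hl]
  calc |e₁ + e₃ + (Real.exp e - 1 - e)| ≤ |e₁| + |e₃| + |Real.exp e - 1 - e| :=
        (abs_add_le _ _).trans (add_le_add_left (abs_add_le _ _) _)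
    _ ≤ ε * l + ε * l + ((M + 1) * l) ^ 2 := add_le_add (add_le_add h₁ h₃) (hexp.trans hsq)
    _ = l * (2 * ε + (M + 1) ^ 2 * l) := by ring

/-- Isolates the intermediate quantile error, the normalised index error and the extrapolation bias
in one exponent. The reference values q and γ are arbitrary (q positive) and cancel. -/
theorem extremeProcess_eq_exp {E : Type*} {S : ℝ → ℝ} {K : ℝ → ℝ} {N k : ℕ} {w : ℝ → E → ℝ}
    {Ts : ℕ → ℝ} {Xs : ℕ → E} {Ys : ℕ → ℝ} {h t g α υ γ q : ℝ} (hN : 0 < N) (hk : 0 < k)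
    (hh : 0 < h) (hα : α < 1) (hυ : 0 < υ) (hq : 0 < q)
    (hq' : 0 < quantileEst K N w Ts Xs Ys h t (1 - (k : ℝ) / N))
    (hy : 0 < survivalQuantile S (1 - υ * (1 - α))) :
    extremeProcess S K N k w Ts Xs Ys h t g α υ =
      Real.sqrt (k * h) / Real.log (k / (N * υ * (1 - α))) *
        (Real.exp (Real.log (quantileEst K N w Ts Xs Ys h t (1 - (k : ℝ) / N) / q) +
          Real.sqrt (k * h) * (g - γ) * (Real.log (k / (N * υ * (1 - α))) / Real.sqrt (k * h)) +
          (Real.log q + γ * Real.log (k / (N * υ * (1 - α))) -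
            Real.log (survivalQuantile S (1 - υ * (1 - α))))) - 1) := by
  have hN' : (0 : ℝ) < N := Nat.cast_pos.2 hN
  have hk' : (0 : ℝ) < k := Nat.cast_pos.2 hk
  have hp : 0 < 1 - α := sub_pos.2 hα
  have hs : 0 < Real.sqrt (k * h) := Real.sqrt_pos.2 (by positivity)
  have hd : 0 < (k : ℝ) / (N * υ * (1 - α)) := by positivity
  unfold extremeProcess extremeQuantileEst
  rw [sub_sub_cancel, ← mul_assoc]
  congr 2
  set L := Real.log (k / (N * υ * (1 - α))) with hL
  rw [Real.rpow_def_of_pos hd, ← hL]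
  nth_rewrite 1 [← Real.exp_log hq']
  nth_rewrite 1 [← Real.exp_log hy]
  rw [← Real.exp_add, ← Real.exp_sub, Real.log_div hq'.ne' hq.ne']
  congr 1
  field_simp
  ring

/-- Path boundedness holds sample point by sample point: over [Δ₀, 1] the log factor is smallest at
υ = 1, the extrapolation ratio largest at υ = Δ₀, and the true quantile smallest at υ = 1. The sign
of the estimated index is unknown, hence |g|. -/
theorem IsHeavyTailed.exists_abs_extremeRelError_le {E : Type*} {S : ℝ → ℝ} {γ : ℝ}
    (hS : IsHeavyTailed S γ) (K : ℝ → ℝ) {N k : ℕ} (w : ℝ → E → ℝ) (Ts : ℕ → ℝ) (Xs : ℕ → E)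
    (Ys : ℕ → ℝ) (h t g : ℝ) {α Δ₀ : ℝ} (hN : 0 < N) (hα : α ∈ Ioo (0 : ℝ) 1)
    (hd : 1 < (k : ℝ) / (N * (1 - α))) (hq : 0 < survivalQuantile S (1 - (1 - α)))
    (hΔ₀ : Δ₀ ∈ Ioo (0 : ℝ) 1) :
    ∃ B, ∀ υ : Icc Δ₀ 1, |(extremeProcess S K N k w Ts Xs Ys h t g α υ)| ≤ B := by
  have hN' : (0 : ℝ) < N := Nat.cast_pos.2 hN
  have hp : 0 < 1 - α := sub_pos.2 hα.2
  set d₀ := (k : ℝ) / (N * (1 - α)) with hd₀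
  set q := survivalQuantile S (1 - (1 - α)) with hqdef
  set b := |quantileEst K N w Ts Xs Ys h t (1 - (k : ℝ) / N)| with hb
  have hlog0 : 0 < Real.log d₀ := Real.log_pos hd
  refine ⟨Real.sqrt (k * h) / Real.log d₀ *
    (b * Real.exp (Real.log (d₀ / Δ₀) * |g|) / q + 1), fun υ => ?_⟩
  obtain ⟨υ, hυ⟩ := υ
  have hυ0 : 0 < υ := hΔ₀.1.trans_le hυ.1
  have hdv : (k : ℝ) / (N * υ * (1 - α)) = d₀ / υ := by rw [hd₀]; field_simp
  have hd1 : d₀ ≤ d₀ / υ := by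
    rw [le_div_iff₀ hυ0]
    exact mul_le_of_le_one_right (by linarith) hυ.2
  have hd2 : d₀ / υ ≤ d₀ / Δ₀ := div_le_div_of_nonneg_left (by linarith) hΔ₀.1 hυ.1
  have hdpos : 0 < d₀ / υ := by linarith
  have hl1 : Real.log d₀ ≤ Real.log (d₀ / υ) := Real.log_le_log (by linarith) hd1
  have hl2 : Real.log (d₀ / υ) ≤ Real.log (d₀ / Δ₀) := Real.log_le_log hdpos hd2
  have hυp : υ * (1 - α) ∈ Ioo (0 : ℝ) 1 := ⟨by positivity, by nlinarith [hυ.2, hα.1]⟩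
  have hqy : q ≤ survivalQuantile S (1 - υ * (1 - α)) :=
    hS.quantile_anti hυp ⟨hp, by linarith [hα.1]⟩ (mul_le_of_le_one_left hp.le hυ.2)
  unfold extremeProcess extremeQuantileEst
  rw [sub_sub_cancel, ← mul_assoc, hdv, abs_mul, abs_of_nonneg
    (div_nonneg (Real.sqrt_nonneg _) (hlog0.le.trans hl1))]
  refine mul_le_mul ?_ ?_ (abs_nonneg _) (by positivity)
  · exact div_le_div_of_nonneg_left (Real.sqrt_nonneg _) hlog0 hl1
  · refine (abs_sub _ _).trans ?_
    rw [abs_one, abs_div, abs_mul, abs_of_pos (hq.trans_le hqy), ← hb,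
      abs_of_pos (Real.rpow_pos_of_pos hdpos _), Real.rpow_def_of_pos hdpos]
    have he : Real.log (d₀ / υ) * g ≤ Real.log (d₀ / Δ₀) * |g| := by
      have : 0 ≤ Real.log (d₀ / υ) := hlog0.le.trans hl1
      exact (mul_le_mul_of_nonneg_left (le_abs_self g) this).trans
        (mul_le_mul_of_nonneg_right hl2 (abs_nonneg _))
    have hb0 : 0 ≤ b := abs_nonneg _
    gcongr

/-- The bias of the extrapolated quantile is of the order of the second-order function. -/
theorem IsHeavyTailed.exists_extrapolation_bound {S : ℝ → ℝ} {γ ρ : ℝ} {A : ℝ → ℝ}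
    (hS : IsHeavyTailed S γ) (hρ : ρ < 0)
    (hsign : (∀ᶠ y in atTop, 0 < A y) ∨ (∀ᶠ y in atTop, A y < 0))
    (hA : Tendsto A atTop (𝓝 0))
    (hlim : ∀ z : ℝ, 0 < z → Tendsto (fun y => (S (z * y) / S y - z ^ (-1 / γ)) / A (1 / S y))
      atTop (𝓝 (z ^ (-1 / γ) * ((z ^ (ρ / γ) - 1) / (γ * ρ))))) :
    ∃ C y₀ : ℝ, 0 ≤ C ∧ 0 < y₀ ∧ ∀ a ∈ Ioo (0 : ℝ) 1, y₀ ≤ survivalQuantile S (1 - a) →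
      ∀ p, 0 < p → p ≤ a →
      |Real.log (survivalQuantile S (1 - a)) + γ * Real.log (a / p) -
        Real.log (survivalQuantile S (1 - p))| ≤ C * |A (1 / a)| := by
  obtain ⟨C, y₀, hC, hy₀, hb⟩ := hS.exists_second_order_bound hρ hsign hA hlim
  have hγ := hS.index_pos
  refine ⟨γ * C, y₀, by positivity, hy₀, fun a ha hq p hp hpa => ?_⟩
  have hp' : p ∈ Ioo (0 : ℝ) 1 := ⟨hp, hpa.trans_lt ha.2⟩
  have hle := hS.quantile_anti hp' ha hpa
  -- Evaluated at the quantiles of tail probabilities a and p, where the survival function equals a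
  -- and p; multiplication by γ then solves for the log-quantile.
  have h1 := hb _ _ hq hle
  rw [hS.apply_quantile ha, hS.apply_quantile hp',
    Real.log_div (hy₀.trans_le (hq.trans hle)).ne' (hy₀.trans_le hq).ne'] at h1
  rw [Real.log_div ha.1.ne' hp.ne', mul_assoc]
  refine le_trans (le_of_eq ?_) (mul_le_mul_of_nonneg_left h1 hγ.le)
  nth_rewrite 2 [← abs_of_pos hγ]
  rw [← abs_mul, ← abs_neg]
  congr 1
  field_simp
  ring

theorem abs_log_div_le_of_mem_Icc {q q' η : ℝ} (hq : 0 < q) (hη0 : 0 < η) (hη : η ≤ 1 / 2)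
    (h : q' ∈ Icc (q * (1 - η)) (q * (1 + η))) : 0 < q' ∧ |Real.log (q' / q)| ≤ 2 * η := by
  have h1 : 0 < 1 - η := by linarith
  have hq' : 0 < q' := lt_of_lt_of_le (by positivity) h.1
  have hx1 : 1 - η ≤ q' / q := by rw [le_div_iff₀ hq]; linarith [h.1]
  have hx2 : q' / q ≤ 1 + η := by rw [div_le_iff₀ hq]; linarith [h.2]
  have hx : 0 < q' / q := by positivity
  refine ⟨hq', abs_le.2 ⟨?_, ?_⟩⟩
  · have h2 := Real.one_sub_inv_le_log_of_pos hx
    have h3 : (q' / q)⁻¹ ≤ 1 + 2 * η := by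
      rw [inv_le_iff_one_le_mul₀ hx]
      nlinarith
    linarith
  · linarith [Real.log_le_sub_one_of_pos hx]

/-- The factor equals kh divided by Nh(1-α): the numerator diverges and the denominator stays
bounded. -/
theorem tendsto_extrapolation_factor {α h : ℕ → ℝ} {k : ℕ → ℕ} {c : ℝ} (hα : ∀ N, α N < 1)
    (hh : ∀ N, 0 < h N) (hc : Tendsto (fun N : ℕ => N * h N * (1 - α N)) atTop (𝓝 c))
    (hkh : Tendsto (fun N : ℕ => k N * h N) atTop atTop) :
    Tendsto (fun N : ℕ => (k N : ℝ) / (N * (1 - α N))) atTop atTop := by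
  have hc0 : 0 ≤ c := ge_of_tendsto' hc fun N =>
    mul_nonneg (mul_nonneg (Nat.cast_nonneg _) (hh N).le) (sub_pos.2 (hα N)).le
  refine tendsto_atTop_mono' _ ?_ (hkh.atTop_div_const (show 0 < c + 1 by linarith))
  filter_upwards [hc.eventually_le_const (lt_add_one c), eventually_gt_atTop 0] with N h1 h2
  have hN : (0 : ℝ) < N := Nat.cast_pos.2 h2
  have hp : 0 < 1 - α N := sub_pos.2 (hα N)
  have hhN := hh N
  calc k N * h N / (c + 1) ≤ k N * h N / (N * h N * (1 - α N)) := by gcongr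
    _ = _ := by field_simp

section Extrapolation

variable {Ω₀ Ω E : Type*} [MeasurableSpace Ω₀] [MeasurableSpace Ω] [TopologicalSpace E]
  [HereditarilyLindelofSpace E] [MeasurableSpace E]
  {P₀ : Measure Ω₀} [IsProbabilityMeasure P₀] {P : Measure Ω} [IsProbabilityMeasure P]
  {T : Ω₀ → ℝ} {X : Ω₀ → E} {Y : ℝ → Ω₀ → ℝ} {fT : ℝ → ℝ} {fTX : ℝ → E → ℝ}
  {K : ℝ → ℝ} {Ts : ℕ → Ω → ℝ} {Xs : ℕ → Ω → E} {Ys : ℕ → Ω → ℝ}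

/-- The extrapolated quantile process is uniformly close to the normalised error of the tail index
estimator. -/
theorem tendsto_measure_extremeProcess_sub
    {γ ρ : ℝ → ℝ} {A : ℝ → ℝ → ℝ} (hmodel : IsTreatmentModel T X Y)
    (hdens : AreDensities P₀ T X fT fTX) (htail : HeavyTail (survival P₀ Y) γ)
    (hunc : Unconfounded P₀ T X Y) (hsupp : SupportOverlap P₀ T X fT fTX)
    (hfT : ∃ η₃ : ℝ, 0 < η₃ ∧ ∀ t ∈ Icc (0 : ℝ) 1, η₃ ≤ fT t)
    (hK : IsSmoothingKernel K) (hsecond : SecondOrder (survival P₀ Y) γ ρ A)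
    (hs : IsIIDSample P₀ P T X (observedOutcome T Y) Ts Xs Ys)
    {piHat : ℕ → Ω → ℝ → E → ℝ} {δ : ℕ → ℝ} (hδ : Tendsto δ atTop (𝓝 0))
    (hpi : IsBigOInProb P
      (fun N ω => ⨆ i : Fin N, |piHat N ω (Ts i ω) (Xs i ω) -
        stabWeight fT fTX (Ts i ω) (Xs i ω)|) δ)
    {α h : ℕ → ℝ} {k : ℕ → ℕ} (hα_mem : ∀ N, α N ∈ Ioo (0 : ℝ) 1)
    (hh_pos : ∀ N, 0 < h N) (hh : Tendsto h atTop (𝓝 0))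
    (hk : Tendsto k atTop atTop) (hkN : Tendsto (fun N : ℕ => (k N : ℝ) / N) atTop (𝓝 0))
    (hkh : Tendsto (fun N : ℕ => k N * h N) atTop atTop)
    (hd : Tendsto (fun N : ℕ => (k N : ℝ) / (N * (1 - α N))) atTop atTop)
    (hkhδ : Tendsto (fun N : ℕ => k N * h N * δ N ^ 2) atTop (𝓝 0))
    {t : ℝ} (ht : t ∈ Icc (0 : ℝ) 1) {lam : ℝ} (hlam : 1 < lam)
    (hosc : Tendsto (fun N : ℕ => ENNReal.ofReal (Real.sqrt (k N * h N)) *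
        tailOscillation (survival P₀ Y) t (popQuantile P₀ Y t (1 - lam * (k N / N))) (h N) *
          ENNReal.ofReal |Real.log (k N / N)|) atTop (𝓝 0))
    (hA : Tendsto (fun N : ℕ => Real.sqrt (k N * h N) * A t (N / k N)) atTop (𝓝 0))
    (hlog : Tendsto (fun N : ℕ =>
      Real.sqrt (k N * h N) / Real.log (k N / (N * (1 - α N)))) atTop atTop)
    {gHat : ℕ → Ω → ℝ}
    (htight : ∀ ε : ℝ≥0∞, 0 < ε → ∃ R : ℝ, ∀ᶠ N : ℕ in atTop,
      P {ω | R ≤ |Real.sqrt (k N * h N) * (gHat N ω - γ t)|} ≤ ε)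
    {Δ₀ : ℝ} (hΔ₀ : Δ₀ ∈ Ioo (0 : ℝ) 1) {ε : ℝ} (hε : 0 < ε) :
    Tendsto (fun N : ℕ => P {ω | ¬ ∀ υ : Icc Δ₀ 1,
      |(extremeProcess (survival P₀ Y t) K N (k N) (piHat N ω) (fun i => Ts i ω)
        (fun i => Xs i ω) (fun i => Ys i ω) (h N) t (gHat N ω) (α N) υ) -
        Real.sqrt (k N * h N) * (gHat N ω - γ t)| ≤ ε}) atTop (𝓝 0) := by
  have hT : IsHeavyTailed (survival P₀ Y t) (γ t) :=
    htail.isHeavyTailed ht (hmodel.measurable_Y t ht)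
  obtain ⟨C, y₀, hC, hy₀, hbias⟩ := hT.exists_extrapolation_bound (hsecond.rho_neg t ht)
    (hsecond.eventual_sign t ht) (hsecond.tendsto_zero t ht) (hsecond.limit t ht)
  set s : ℕ → ℝ := fun N => Real.sqrt (k N * h N) with hsdef
  set L₀ : ℕ → ℝ := fun N => Real.log (k N / (N * (1 - α N))) with hL₀def
  have hL₀ : Tendsto L₀ atTop atTop := Real.tendsto_log_atTop.comp hd
  have hs_atTop : Tendsto s atTop atTop := Real.tendsto_sqrt_atTop.comp hkh
  have hLs : Tendsto (fun N => L₀ N / s N) atTop (𝓝 0) := by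
    refine hlog.inv_tendsto_atTop.congr fun N => ?_
    rw [Pi.inv_apply, inv_div]
  -- For υ in [Δ₀, 1] the log factor exceeds its value at υ = 1 by at most this constant, which
  -- makes every estimate uniform in υ.
  set l₁ := Real.log (1 / Δ₀) with hl₁
  have hLl : Tendsto (fun N => (L₀ N + l₁) / s N) atTop (𝓝 0) := by
    have := hLs.add (hs_atTop.const_div_atTop l₁)
    rw [zero_add] at this
    exact this.congr fun N => (add_div _ _ _).symm
  -- Two error terms of size ε₁ use ε/2 of the budget and the quadratic remainder the rest; the cap
  -- 1/2 is required by the exponential expansion.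
  set ε₁ := min (ε / 4) (1 / 2) with hε₁
  have hε₁0 : 0 < ε₁ := lt_min (by positivity) (by norm_num)
  -- Large enough that sη = ε₁L₀/2 → ∞, as consistency of the intermediate quantile demands, yet
  -- after scaling by s/L its contribution 2η is at most ε₁.
  set η : ℕ → ℝ := fun N => ε₁ / 2 * (L₀ N / s N) with hη
  have hηt : Tendsto η atTop (𝓝 0) := by simpa using hLs.const_mul (ε₁ / 2)
  have hηpos : ∀ᶠ N in atTop, 0 < η N := by
    filter_upwards [hL₀.eventually_gt_atTop 0, hs_atTop.eventually_gt_atTop 0] with N h1 h2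
    positivity
  have hsη : Tendsto (fun N => s N * η N) atTop atTop := by
    refine (hL₀.const_mul_atTop (half_pos hε₁0)).congr' ?_
    filter_upwards [hs_atTop.eventually_gt_atTop 0] with N h2
    rw [hη]
    field_simp
  have hquant := tendsto_measure_quantileEst_notMem hmodel hdens htail hunc hsupp hfT hK hs hδ hpi
    hh_pos hh hk hkN hkhδ ht hlam hosc hηt hηpos hsη
  have hkN0 : ∀ᶠ N : ℕ in atTop, (0 : ℝ) < k N / N := by
    filter_upwards [hk.eventually_gt_atTop 0, eventually_gt_atTop 0] with N h1 h2
    have : (0 : ℝ) < k N := Nat.cast_pos.2 h1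
    have : (0 : ℝ) < N := Nat.cast_pos.2 h2
    positivity
  have hQ := hT.tendsto_quantile hkN hkN0
  have hsA : Tendsto (fun N : ℕ => C * |s N * A t (N / k N)|) atTop (𝓝 0) := by
    have := hA.abs.const_mul C
    rwa [abs_zero, mul_zero] at this
  refine ENNReal.tendsto_nhds_zero.2 fun τ hτ => ?_
  obtain ⟨R, hR⟩ := htight (τ / 2) (ENNReal.half_pos hτ.ne')
  have hM1 : Tendsto (fun N => (|R| + 1) * ((L₀ N + l₁) / s N)) atTop (𝓝 0) := by
    simpa using hLl.const_mul (|R| + 1)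
  have hM2 : Tendsto (fun N => (|R| + 1) ^ 2 * ((L₀ N + l₁) / s N)) atTop (𝓝 0) := by
    simpa using hLl.const_mul ((|R| + 1) ^ 2)
  filter_upwards [hR, hquant.eventually_le_const (ENNReal.half_pos hτ.ne'), hηpos,
    hηt.eventually_le_const (show (0 : ℝ) < 1 / 2 by norm_num), hL₀.eventually_gt_atTop 0,
    hs_atTop.eventually_gt_atTop 0, hkN0, hkN.eventually_lt_const one_pos,
    hQ.eventually_ge_atTop y₀, hsA.eventually_le_const one_pos,
    hL₀.eventually_ge_atTop (1 / ε₁), hM1.eventually_le_const one_pos,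
    hM2.eventually_le_const (half_pos hε), hk.eventually_gt_atTop 0, eventually_gt_atTop 0,
    hd.eventually_gt_atTop 1]
    with N hRN hqN hη0 hη2 hL0 hs0 ha0 ha1 hqy hsAN hL1 hm1 hm2 hkpos hN hd1
  set a : ℝ := k N / N with hadef
  set q := survivalQuantile (survival P₀ Y t) (1 - a) with hq
  have hqpos : 0 < q := hy₀.trans_le hqy
  have hN' : (0 : ℝ) < N := Nat.cast_pos.2 hN
  have hk' : (0 : ℝ) < k N := Nat.cast_pos.2 hkpos
  have hp : 0 < 1 - α N := sub_pos.2 (hα_mem N).2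
  have hpa : 1 - α N ≤ a := by
    rw [hadef, le_div_iff₀ hN']
    rw [one_lt_div (by positivity)] at hd1
    linarith
  have hsub : {ω | ¬ ∀ υ : Icc Δ₀ 1,
      |(extremeProcess (survival P₀ Y t) K N (k N) (piHat N ω) (fun i => Ts i ω)
        (fun i => Xs i ω) (fun i => Ys i ω) (h N) t (gHat N ω) (α N) υ) -
        s N * (gHat N ω - γ t)| ≤ ε} ⊆
      {ω | R ≤ |s N * (gHat N ω - γ t)|} ∪
      {ω | quantileEst K N (piHat N ω) (fun i => Ts i ω) (fun i => Xs i ω)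
        (fun i => Ys i ω) (h N) t (1 - a) ∉ Icc (q * (1 - η N)) (q * (1 + η N))} := by
    intro ω hω
    by_contra hnot
    simp only [mem_union, mem_ofPred_eq, not_or, not_le, not_not] at hnot
    refine hω fun υ => ?_
    obtain ⟨υ, hυ⟩ := υ
    have hυ0 : 0 < υ := hΔ₀.1.trans_le hυ.1
    obtain ⟨hq'0, he₁⟩ := abs_log_div_le_of_mem_Icc hqpos hη0 hη2 hnot.2
    have hpυ : 0 < υ * (1 - α N) := by positivity
    have hpυa : υ * (1 - α N) ≤ a := (mul_le_of_le_one_left hp.le hυ.2).trans hpa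
    have hqle : q ≤ survivalQuantile (survival P₀ Y t) (1 - υ * (1 - α N)) :=
      hT.quantile_anti ⟨hpυ, hpυa.trans_lt ha1⟩ ⟨ha0, ha1⟩ hpυa
    have he₃ := hbias a ⟨ha0, ha1⟩ hqy _ hpυ hpυa
    have hdiv : a / (υ * (1 - α N)) = k N / (N * υ * (1 - α N)) := by
      rw [hadef]; field_simp
    have hinv : 1 / a = N / k N := by rw [hadef]; field_simp
    rw [hdiv, hinv] at he₃
    set L := Real.log (k N / (N * υ * (1 - α N))) with hL
    have hLeq : L = L₀ N + Real.log (1 / υ) := by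
      rw [hL, hL₀def, ← Real.log_mul (by positivity) (by positivity)]
      congr 1
      field_simp
    have hLge : L₀ N ≤ L := by
      rw [hLeq]
      have : 0 ≤ Real.log (1 / υ) := Real.log_nonneg (by rw [le_div_iff₀ hυ0]; linarith [hυ.2])
      linarith
    have hLle : L ≤ L₀ N + l₁ := by
      rw [hLeq]
      have : Real.log (1 / υ) ≤ l₁ := Real.log_le_log (by positivity)
        (one_div_le_one_div_of_le hΔ₀.1 hυ.1)
      linarith
    have hLpos : 0 < L := hL0.trans_le hLge
    have hLs1 : L₀ N / s N ≤ L / s N := div_le_div_of_nonneg_right hLge hs0.le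
    have hLs2 : L / s N ≤ (L₀ N + l₁) / s N := div_le_div_of_nonneg_right hLle hs0.le
    have hε₁L : ε₁ * (L₀ N / s N) ≤ ε₁ * (L / s N) := mul_le_mul_of_nonneg_left hLs1 hε₁0.le
    have h1 : |Real.log (quantileEst K N (piHat N ω) (fun i => Ts i ω) (fun i => Xs i ω)
        (fun i => Ys i ω) (h N) t (1 - a) / q)| ≤ ε₁ * (L / s N) := by
      refine he₁.trans (le_trans (le_of_eq ?_) hε₁L)
      rw [hη]; ring
    -- Eventually C s |A| ≤ 1 ≤ ε₁L₀, so the bias fits the same budget as the quantile error.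
    have h3 : C * |A t (N / k N)| ≤ ε₁ * (L / s N) := by
      refine le_trans ?_ hε₁L
      rw [mul_div_assoc', le_div_iff₀ hs0]
      rw [abs_mul, abs_of_pos hs0] at hsAN
      rw [div_le_iff₀ hε₁0] at hL1
      linarith
    rw [extremeProcess_eq_exp (γ := γ t) (q := q) hN hkpos (hh_pos N) (hα_mem N).2 hυ0 hqpos hq'0
      (hqpos.trans_le hqle)]
    have hfin := abs_exp_expansion_sub_le hs0 hLpos h1 (he₃.trans h3) (min_le_right _ _)
      (hnot.1.le.trans (le_abs_self R))
      ((mul_le_mul_of_nonneg_left hLs2 (by positivity)).trans hm1)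
    refine hfin.trans ?_
    have h5 : (|R| + 1) ^ 2 * (L / s N) ≤ ε / 2 :=
      (mul_le_mul_of_nonneg_left hLs2 (by positivity)).trans hm2
    have h6 : ε₁ ≤ ε / 4 := min_le_left _ _
    linarith
  refine (measure_mono hsub).trans ((measure_union_le _ _).trans ?_)
  exact (add_le_add hRN hqN).trans (ENNReal.add_halves τ).le

end Extrapolation

/-! ### Joint weak convergence at two treatment levels -/

theorem mainTheorem4 {r : ℕ} {Ω₀ Ω Λ : Type*}
    [MeasurableSpace Ω₀] [MeasurableSpace Ω] [MeasurableSpace Λ]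
    (P₀ : Measure Ω₀) [IsProbabilityMeasure P₀]
    (P : Measure Ω) [IsProbabilityMeasure P]
    (Q : Measure Λ) [IsProbabilityMeasure Q]
    -- population: treatment, covariates, potential outcomes, densities
    (T : Ω₀ → ℝ) (X : Ω₀ → EuclideanSpace ℝ (Fin r)) (Y : ℝ → Ω₀ → ℝ)
    (fT : ℝ → ℝ) (fTX : ℝ → EuclideanSpace ℝ (Fin r) → ℝ)
    (γ ρ : ℝ → ℝ) (A : ℝ → ℝ → ℝ) (K : ℝ → ℝ)
    (hmodel : IsTreatmentModel T X Y)
    (hdens : AreDensities P₀ T X fT fTX)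
    (htail : HeavyTail (survival P₀ Y) γ)
    (hunconf : Unconfounded P₀ T X Y)
    (hsupp : SupportOverlap P₀ T X fT fTX)
    (hsmooth : SmoothLaws P₀ T X (observedOutcome T Y) fT)
    (hK : IsSmoothingKernel K)
    (hsecond : SecondOrder (survival P₀ Y) γ ρ A)
    -- sample and weight estimator
    (Ts : ℕ → Ω → ℝ) (Xs : ℕ → Ω → EuclideanSpace ℝ (Fin r)) (Ys : ℕ → Ω → ℝ)
    (hsample : IsIIDSample P₀ P T X (observedOutcome T Y) Ts Xs Ys)
    (piHat : ℕ → Ω → ℝ → EuclideanSpace ℝ (Fin r) → ℝ)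
    (hpi_meas : ∀ N, Measurable
      (fun p : Ω × ℝ × EuclideanSpace ℝ (Fin r) => piHat N p.1 p.2.1 p.2.2))
    (δ : ℕ → ℝ) (hδ : Tendsto δ atTop (𝓝 0))
    (hpi : IsBigOInProb P
      (fun N ω => ⨆ i : Fin N, |piHat N ω (Ts i ω) (Xs i ω) -
        stabWeight fT fTX (Ts i ω) (Xs i ω)|) δ)
    -- rates
    (α h : ℕ → ℝ) (k : ℕ → ℕ) (c : ℝ)
    (hα_mem : ∀ N, α N ∈ Ioo (0 : ℝ) 1) (hα : Tendsto α atTop (𝓝 1))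
    (hh_pos : ∀ N, 0 < h N) (hh : Tendsto h atTop (𝓝 0))
    (hk : Tendsto k atTop atTop) (hc : 0 ≤ c)
    (hextreme : Tendsto (fun N : ℕ => N * h N * (1 - α N)) atTop (𝓝 c))
    (hkN : Tendsto (fun N : ℕ => (k N : ℝ) / N) atTop (𝓝 0))
    (hkh : Tendsto (fun N : ℕ => k N * h N) atTop atTop)
    (hkh3 : Tendsto (fun N : ℕ => k N * h N ^ 3) atTop (𝓝 0))
    (hkhδ : Tendsto (fun N : ℕ => k N * h N * δ N ^ 2) atTop (𝓝 0))
    (hosc : ∀ t ∈ Icc (0 : ℝ) 1, ∃ lam : ℝ, 1 < lam ∧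
      Tendsto (fun N : ℕ =>
        tailOscillation (survival P₀ Y) t (popQuantile P₀ Y t (1 - lam * (k N / N))) (h N) *
          ENNReal.ofReal |Real.log (k N / N)|) atTop (𝓝 0) ∧
      Tendsto (fun N : ℕ => ENNReal.ofReal (Real.sqrt (k N * h N)) *
        tailOscillation (survival P₀ Y) t (popQuantile P₀ Y t (1 - lam * (k N / N))) (h N) *
          ENNReal.ofReal |Real.log (k N / N)|) atTop (𝓝 0))
    (hA : ∀ t ∈ Icc (0 : ℝ) 1,
      Tendsto (fun N : ℕ => Real.sqrt (k N * h N) * A t (N / k N)) atTop (𝓝 0))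
    (hlog : Tendsto (fun N : ℕ =>
      Real.sqrt (k N * h N) / Real.log (k N / (N * (1 - α N)))) atTop atTop)
    -- tail index estimator
    (gammaHat : ℕ → ℝ → Ω → ℝ) (Γ : ℝ → Λ → ℝ)
    (hΓ_indep : ∀ t₁ ∈ Icc (0 : ℝ) 1, ∀ t₂ ∈ Icc (0 : ℝ) 1, t₁ ≠ t₂ →
      IndepFun (Γ t₁) (Γ t₂) Q)
    (hgamma : ∀ t₁ ∈ Icc (0 : ℝ) 1, ∀ t₂ ∈ Icc (0 : ℝ) 1, t₁ ≠ t₂ →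
      TendstoInDistribution
        (fun (N : ℕ) ω => (Real.sqrt (k N * h N) * (gammaHat N t₁ ω - γ t₁),
          Real.sqrt (k N * h N) * (gammaHat N t₂ ω - γ t₂)))
        atTop (fun l => (Γ t₁ l, Γ t₂ l)) (fun _ => P) Q)
    (Δ₀ : ℝ) (hΔ₀ : Δ₀ ∈ Ioo (0 : ℝ) 1) :
    ∀ t₁ ∈ Icc (0 : ℝ) 1, ∀ t₂ ∈ Icc (0 : ℝ) 1, t₁ ≠ t₂ →
      WeakConvLinfty P Q
        (fun (N : ℕ) ω (υ : Icc Δ₀ 1) =>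
          (extremeProcess (survival P₀ Y t₁) K N (k N) (piHat N ω) (fun i => Ts i ω)
              (fun i => Xs i ω) (fun i => Ys i ω) (h N) t₁ (gammaHat N t₁ ω) (α N) υ,
            extremeProcess (survival P₀ Y t₂) K N (k N) (piHat N ω) (fun i => Ts i ω)
              (fun i => Xs i ω) (fun i => Ys i ω) (h N) t₂ (gammaHat N t₂ ω) (α N) υ))
        (fun l (_ : Icc Δ₀ 1) => (Γ t₁ l, Γ t₂ l)) := by
  intro t₁ ht₁ t₂ ht₂ hne
  have hd := tendsto_extrapolation_factor (fun N => (hα_mem N).2) hh_pos hextreme hkh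
  have hfT : ∃ η₃ : ℝ, 0 < η₃ ∧ ∀ t ∈ Icc (0 : ℝ) 1, η₃ ≤ fT t :=
    let ⟨η₃, _, h0, hb⟩ := hsmooth.bounds_fT
    ⟨η₃, h0, fun t ht => (hb t ht).1⟩
  have hW := hgamma t₁ ht₁ t₂ ht₂ hne
  have hclose : ∀ t ∈ Icc (0 : ℝ) 1, (∀ ε : ℝ≥0∞, 0 < ε → ∃ R : ℝ, ∀ᶠ N : ℕ in atTop,
      P {ω | R ≤ |Real.sqrt (k N * h N) * (gammaHat N t ω - γ t)|} ≤ ε) →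
      ∀ ε : ℝ, 0 < ε → Tendsto (fun N : ℕ => P {ω | ¬ ∀ υ : Icc Δ₀ 1,
        |(extremeProcess (survival P₀ Y t) K N (k N) (piHat N ω) (fun i => Ts i ω)
          (fun i => Xs i ω) (fun i => Ys i ω) (h N) t (gammaHat N t ω) (α N) υ) -
          Real.sqrt (k N * h N) * (gammaHat N t ω - γ t)| ≤ ε}) atTop (𝓝 0) := by
    intro t ht htight ε hε
    obtain ⟨lam, hlam, -, hosc'⟩ := hosc t ht
    exact tendsto_measure_extremeProcess_sub hmodel hdens htail hunconf hsupp hfT hK hsecond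
      hsample hδ hpi hα_mem hh_pos hh hk hkN hkh hd hkhδ ht hlam hosc' (hA t ht) hlog htight
      hΔ₀ hε
  refine weakConvLinfty_const hW ?_ fun ε hε => ?_
  · have hp0 : Tendsto (fun N => 1 - α N) atTop (𝓝 0) := by simpa using hα.const_sub 1
    have hq : ∀ t ∈ Icc (0 : ℝ) 1, ∀ᶠ N in atTop,
        0 < survivalQuantile (survival P₀ Y t) (1 - (1 - α N)) := fun t ht =>
      ((htail.isHeavyTailed ht (hmodel.measurable_Y t ht)).tendsto_quantile hp0
        (Eventually.of_forall fun N => sub_pos.2 (hα_mem N).2)).eventually_gt_atTop 0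
    filter_upwards [hq t₁ ht₁, hq t₂ ht₂, hd.eventually_gt_atTop 1, eventually_gt_atTop 0]
      with N hq₁ hq₂ hdN hN ω
    obtain ⟨B₁, hB₁⟩ := (htail.isHeavyTailed ht₁ (hmodel.measurable_Y t₁ ht₁)).exists_abs_extremeRelError_le
      K (piHat N ω) (fun i => Ts i ω) (fun i => Xs i ω) (fun i => Ys i ω) (h N) t₁
      (gammaHat N t₁ ω) hN (hα_mem N) hdN hq₁ hΔ₀
    obtain ⟨B₂, hB₂⟩ := (htail.isHeavyTailed ht₂ (hmodel.measurable_Y t₂ ht₂)).exists_abs_extremeRelError_le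
      K (piHat N ω) (fun i => Ts i ω) (fun i => Xs i ω) (fun i => Ys i ω) (h N) t₂
      (gammaHat N t₂ ω) hN (hα_mem N) hdN hq₂ hΔ₀
    refine memℓp_infty ⟨max B₁ B₂, ?_⟩
    rintro _ ⟨υ, rfl⟩
    exact max_le_max (hB₁ υ) (hB₂ υ)
  -- Joint convergence gives tightness of the pair, and each coordinate is dominated by the norm of
  -- the pair.
  · have h₁ := hclose t₁ ht₁ (fun τ hτ => by
      obtain ⟨R, hR⟩ := hW.exists_norm_bound hτ
      exact ⟨R, hR.mono fun N hN => (measure_mono fun ω hω =>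
        le_trans hω (norm_fst_le (_ : ℝ × ℝ))).trans hN⟩) ε hε
    have h₂ := hclose t₂ ht₂ (fun τ hτ => by
      obtain ⟨R, hR⟩ := hW.exists_norm_bound hτ
      exact ⟨R, hR.mono fun N hN => (measure_mono fun ω hω =>
        le_trans hω (norm_snd_le (_ : ℝ × ℝ))).trans hN⟩) ε hε
    have h₃ := h₁.add h₂
    rw [add_zero] at h₃
    -- The product carries the max norm, so the pair is far from its constant only if one coordinate
    -- is.
    refine tendsto_of_tendsto_of_tendsto_of_le_of_le tendsto_const_nhds h₃ (fun _ => zero_le)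
      fun N => (measure_mono fun ω hω => ?_).trans (measure_union_le _ _)
    by_contra hnot
    simp only [mem_union, mem_ofPred_eq, not_or, not_not] at hnot
    exact hω fun υ => max_le (hnot.1 υ) (hnot.2 υ)
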